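/- Let $V\in C^\infty(\mathbb R)$ be real-valued and even, $V=V_{\rm per}+V_{\rm def}$ with $V_{\rm per}(x+1)=V_{\rm per}(x)$ for all $x$ and $V_{\rm def}(x)=0$ for $|x|>\rho$, where $\rho\ge 0$. Suppose that $H=-\frac{d^2}{dx^2}+V$ on $L^2(\mathbb R)$ has a bound state $\Phi\in L^2(\mathbb R)$, $\Phi\neq 0$, $H\Phi=E\Phi$, with $E>0$. Then $\Phi$ is even or odd. For $z\in\mathbb C$ let $u_z,v_z$ be the solutions of $-w''+Vw=zw$ with $u_z(0)=1,\ u_z'(0)=0,\ v_z(0)=0,\ v_z'(0)=1$ if $\Phi$ is even, and with $u_z(0)=0,\ u_z'(0)=1,\ v_z(0)=-1,\ v_z'(0)=0$ if $\Phi$ is odd. Let $\sqrt{\cdot}$ be the principal branch of the square root on $\mathbb C\setminus(-\infty,0]$. For $M>0$ let $V_{\rm trunc}(x)=V(x)$ for $|x|\le M$ and $V_{\rm trunc}(x)=0$ for $|x|>M$, and let $H_{\rm trunc}=-\frac{d^2}{dx^2}+V_{\rm trunc}$ on $L^2(\mathbb R)$. A resonance of $H_{\rm trunc}$ is a number $z$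 such that $\lambda=\sqrt z$ has $\operatorname{Im}\lambda<0$ and is a pole of the resolvent $(H_{\rm trunc}-\lambda^2)^{-1}$, continued meromorphically in $\lambda$ from the upper half-plane (as an operator from compactly supported $L^2$ functions to $L^2_{\rm loc}$). A resonant state at $z$ is a nonzero solution $\Psi\in H^2_{\rm loc}(\mathbb R)$ of $-\Psi''+V_{\rm trunc}\Psi=z\Psi$ that is outgoing: it is a constant multiple of $e^{i\sqrt z\,|x|}$ near $+\infty$, and a constant multiple of it near $-\infty$. Let $k$ be the logarithm of the larger of the absolute values of the two characteristic multipliers of $-\psi''+V_{\rm per}\psi=E\psi$ (these are real with product $1$). Then $k>0$, and there are $M_0>\rho$ and $C$ such that for all real $M\ge M_0$ the operator $H_{\rm trunc}$ has a resonance $z^*$ with $\operatorname{Re}z^*>0$, $\operatorname{Im}z^*<0$, $|\operatorname{Im}z^*|\le Ce^{-2kM}$ and $$\operatorname{Re}z^*=E+\frac{u_E'(M)v_E'(M)+E\,u_E(M)v_E(M)}{\left[(v_E'(M))^2+E\,(v_E(M))^2\right]\int_0^M u_E^2(y)\,dy}+O(Me^{-4kM}),$$ $$\operatorname{Im}z^*=\frac{-\sqrt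 E}{\left[(v_E'(M))^2+E\,(v_E(M))^2\right]\int_0^M u_E^2(y)\,dy}+O(Me^{-4kM}),$$ where each $O(Me^{-4kM})$ is bounded in absolute value by $C\,Me^{-4kM}$. The associated resonant state $\Phi^*$, unique up to a constant factor, is for $x\ge0$ given by $$\Phi^*(x)=\begin{cases}u_{z^*}(x),&0\le x\le M,\\ u_{z^*}(M)\,e^{i\sqrt{z^*}(x-M)},&x>M,\end{cases}$$ and $\Phi^*$ is even if $\Phi$ is even, and odd if $\Phi$ is odd. -/

import Mathlib

open MeasureTheory Set
open scoped ContDiff Interval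

noncomputable section

/-- The potential cut off outside the interval of half-length `M`. -/
def truncate (V : ℝ → ℝ) (M : ℝ) : ℝ → ℝ :=
  fun x => if |x| ≤ M then V x else 0

/-- The principal branch of the complex square root, cut along the negative real axis. -/
def csqrt (z : ℂ) : ℂ := z ^ ((1 : ℂ) / 2)

/-- `(-d²/dx² + U - z) w = f` in the sense of functions `w` that are locally `H²`:
`w` is continuously differentiable, its derivative is locally absolutely continuous, and
`w'' = (U - z) w - f` almost everywhere (written in integrated form, since `U` and `f` may jump).
For continuous `U` and `f` this is the classical equation. -/
def SolvesSchrodinger (U : ℝ → ℝ) (z : ℂ) (f w : ℝ → ℂ) : Prop :=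
  Differentiable ℝ w ∧
  (∀ a b : ℝ, IntervalIntegrable (fun x => ((U x : ℂ) - z) * w x - f x) volume a b) ∧
  ∀ a b : ℝ, deriv w b - deriv w a = ∫ x in a..b, (((U x : ℂ) - z) * w x - f x)

/-- The solution of `(-d²/dx² + U - z) w = 0` with initial data `w 0 = a`, `w' 0 = b`. -/
def SolvesIVP (U : ℝ → ℝ) (z a b : ℂ) (w : ℝ → ℂ) : Prop :=
  SolvesSchrodinger U z 0 w ∧ w 0 = a ∧ deriv w 0 = b

/-- `w` lies in the domain `H²(ℝ)` of the operator `H_U = -d²/dx² + U` on `L²(ℝ)` and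
`(H_U - z) w = f`. Since `U` is bounded, `w ∈ L²` together with `w'' = (U - z) w - f ∈ L²` is
exactly membership in `H²(ℝ)`. -/
def IsResolventImage (U : ℝ → ℝ) (z : ℂ) (f w : ℝ → ℂ) : Prop :=
  MemLp w 2 volume ∧ SolvesSchrodinger U z f w

/-- `Φ` is a bound state (a nonzero `L²` eigenfunction) of `-d²/dx² + U` with eigenvalue `E`. -/
def IsBoundState (U : ℝ → ℝ) (E : ℝ) (Φ : ℝ → ℂ) : Prop :=
  Φ ≠ 0 ∧ IsResolventImage U (E : ℂ) 0 Φ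

/-- `μ` is a characteristic (Floquet) multiplier of `-ψ'' + W ψ = E ψ`, where `W` has period `1`. -/
def IsCharacteristicMultiplier (W : ℝ → ℝ) (E : ℝ) (μ : ℝ) : Prop :=
  ∃ ψ : ℝ → ℂ, ψ ≠ 0 ∧ SolvesSchrodinger W (E : ℂ) 0 ψ ∧ ∀ x, ψ (x + 1) = (μ : ℂ) * ψ x

/-- `F` is the meromorphic continuation to `ℂ`, in the variable `ζ = √z`, of the matrix element
`∫ g (H_U - ζ²)⁻¹ f` of the resolvent of `H_U = -d²/dx² + U`. For `ζ` in the open first quadrant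
`ζ²` has positive imaginary part, so it is never in the spectrum of the self-adjoint operator `H_U`
and `w = (H_U - ζ²)⁻¹ f` is the only possible `w`; by the identity theorem the values of `F` there
determine the continuation (and they agree with the resolvent wherever it exists on `Im ζ > 0`). -/
def IsContinuedResolvent (U : ℝ → ℝ) (f g : ℝ → ℂ) (F : ℂ → ℂ) : Prop :=
  MeromorphicOn F univ ∧
  ∀ ζ : ℂ, 0 < ζ.re → 0 < ζ.im →
    ∃ w : ℝ → ℂ, IsResolventImage U (ζ ^ 2) f w ∧ F ζ = ∫ x, g x * w x

/-- `ζ₀` is a pole of the resolvent `(H_U - ζ²)⁻¹ : L²_comp → L²_loc`, continued meromorphically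
in `ζ`: some matrix element between compactly supported `L²` functions has a pole at `ζ₀`. -/
def IsResolventPole (U : ℝ → ℝ) (ζ₀ : ℂ) : Prop :=
  ∃ f g : ℝ → ℂ, MemLp f 2 volume ∧ HasCompactSupport f ∧
    MemLp g 2 volume ∧ HasCompactSupport g ∧
    ∃ F : ℂ → ℂ, IsContinuedResolvent U f g F ∧ meromorphicOrderAt F ζ₀ < 0

/-- `z` is a resonance of `-d²/dx² + U`: `√z` lies in the open lower half-plane and is a pole of
the continued resolvent. -/
def IsResonance (U : ℝ → ℝ) (z : ℂ) : Prop :=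
  (csqrt z).im < 0 ∧ IsResolventPole U (csqrt z)

/-- `Ψ` is a resonant state of `-d²/dx² + U` (with `U` compactly supported) at `z`: a nonzero
solution of the eigenvalue equation that is outgoing, i.e. a multiple of `e^{i√z|x|}` near `+∞`
and a multiple of it near `-∞`. -/
def IsResonantState (U : ℝ → ℝ) (z : ℂ) (Ψ : ℝ → ℂ) : Prop :=
  Ψ ≠ 0 ∧ SolvesSchrodinger U z 0 Ψ ∧
  ∃ (R : ℝ) (a b : ℂ),
    (∀ x, R < x → Ψ x = a * Complex.exp (Complex.I * csqrt z * (x : ℂ))) ∧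
    (∀ x, x < -R → Ψ x = b * Complex.exp (-(Complex.I * csqrt z * (x : ℂ))))

/-- `[(v_E'(M))² + E (v_E(M))²] ∫₀ᴹ u_E²` for the solutions `uE`, `vE` at energy `E`. -/
def correctionDenom (E : ℝ) (uE vE : ℝ → ℂ) (M : ℝ) : ℂ :=
  ((deriv vE M) ^ 2 + (E : ℂ) * (vE M) ^ 2) * ∫ y in (0 : ℝ)..M, (uE y) ^ 2

end

/-! The bound state has a definite parity because the Wronskian of an `L²` solution and its
reflection is constant and vanishes at infinity (`mul_eq_zero_of_memLp`, `even_or_odd`). Hence `u E`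
is a multiple of `Φ`. Floquet theory near `+∞` (`exists_floquet`, `exists_exp_bounds`) then makes `u
E` of size `q = e^{-kM}` at `M`, while `v E` is of size at most `q⁻¹`.

By parity, a zero of `F(z) = u_z'(M) - i√z u_z(M)` produces a resonant state: glue outgoing waves to
`u_z` at both edges. The exact formula of `variation` expresses `u_z` through `u_E` and `v_E` and
turns `F` into `F(z) = N(z) (1 + (z - E) ∫ u_z v_E) - (z - E) (∫ u_z u_E) D(z)`, where `N = u_E' -
i√z u_E = O(q)` and `D = v_E' - i√z v_E` has size exactly `q⁻¹`, the lower bound coming from the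
Wronskian being `1` (`le_norm_growing`). So `F` moves at rate at least a constant times `q⁻¹` away
from `E`, while `F(E) = O(q)`. A quantitative open mapping theorem gives a zero within `O(q²)` of
`E`, and dropping the lower-order terms gives `z - E = N(E) / (D(E) ∫ u_E²) + O(M q⁴)`
(`exists_outgoing`). Multiplying by the conjugate of `D(E)` and using the Wronskian once more yields
the stated real and imaginary parts (`newton_step_eq`). The imaginary part of the leading term is
negative and at least a constant times `q²` in modulus, so it dominates the error and `Im z < 0`.

That such a zero is a pole of the continued resolvent is seen on one explicit matrix element, with
sources just outside the truncated potential: it equals `J² p / D + G` with `D(ζ) = F(ζ²)` (where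
`ζ` takes the place of `√z`), and `J`, `p` do not vanish at the zero (`isResolventPole`). -/

open Filter Topology

/-! ### Classical solutions and uniqueness -/

/-- `w` is a classical solution of `-w'' + V w = z w` with derivative `w₁`. -/
def IsClassicalSolution (V : ℝ → ℝ) (z : ℂ) (w w₁ : ℝ → ℂ) : Prop :=
  ∀ x, HasDerivAt w (w₁ x) x ∧ HasDerivAt w₁ (((V x : ℂ) - z) * w x) x

namespace IsClassicalSolution

variable {V : ℝ → ℝ} {z z' : ℂ} {w w₁ y y₁ : ℝ → ℂ}

theorem continuous (h : IsClassicalSolution V z w w₁) : Continuous w :=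
  continuous_iff_continuousAt.2 fun x => (h x).1.continuousAt

theorem continuous' (h : IsClassicalSolution V z w w₁) : Continuous w₁ :=
  continuous_iff_continuousAt.2 fun x => (h x).2.continuousAt

theorem deriv_eq (h : IsClassicalSolution V z w w₁) : deriv w = w₁ :=
  funext fun x => (h x).1.deriv

theorem const_mul (h : IsClassicalSolution V z w w₁) (c : ℂ) :
    IsClassicalSolution V z (fun x => c * w x) (fun x => c * w₁ x) := fun x =>
  ⟨(h x).1.const_mul c, ((h x).2.const_mul c).congr_deriv (by ring)⟩

theorem add (h : IsClassicalSolution V z w w₁) (h' : IsClassicalSolution V z y y₁) :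
    IsClassicalSolution V z (fun x => w x + y x) (fun x => w₁ x + y₁ x) := fun x =>
  ⟨(h x).1.add (h' x).1, ((h x).2.add (h' x).2).congr_deriv (by ring)⟩

theorem sub (h : IsClassicalSolution V z w w₁) (h' : IsClassicalSolution V z y y₁) :
    IsClassicalSolution V z (fun x => w x - y x) (fun x => w₁ x - y₁ x) := fun x =>
  ⟨(h x).1.sub (h' x).1, ((h x).2.sub (h' x).2).congr_deriv (by ring)⟩

theorem star (h : IsClassicalSolution V z w w₁) :
    IsClassicalSolution V (starRingEnd ℂ z) (fun x => starRingEnd ℂ (w x))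
      (fun x => starRingEnd ℂ (w₁ x)) := fun x =>
  ⟨(h x).1.star, ((h x).2.star).congr_deriv (by simp)⟩

theorem comp_neg (hV : Function.Even V) (h : IsClassicalSolution V z w w₁) :
    IsClassicalSolution V z (fun x => w (-x)) (fun x => -w₁ (-x)) := fun x => by
  have h1 := (h (-x)).1.scomp x (hasDerivAt_neg x)
  have h2 := ((h (-x)).2.scomp x (hasDerivAt_neg x)).neg
  refine ⟨h1.congr_deriv (by simp), h2.congr_deriv ?_⟩
  simp [hV x]

/-- The derivative of the Wronskian of solutions at two energies. -/
theorem hasDerivAt_wronskian (h : IsClassicalSolution V z w w₁)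
    (h' : IsClassicalSolution V z' y y₁) (x : ℝ) :
    HasDerivAt (fun x => w x * y₁ x - w₁ x * y x) ((z - z') * (w x * y x)) x :=
  (((h x).1.mul (h' x).2).sub ((h x).2.mul (h' x).1)).congr_deriv (by ring)

theorem wronskian_sub (h : IsClassicalSolution V z w w₁)
    (h' : IsClassicalSolution V z' y y₁) (a b : ℝ) :
    (w b * y₁ b - w₁ b * y b) - (w a * y₁ a - w₁ a * y a)
      = (z - z') * ∫ t in a..b, w t * y t := by
  rw [← intervalIntegral.integral_const_mul]
  refine (intervalIntegral.integral_eq_sub_of_hasDerivAt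
    (fun x _ => h.hasDerivAt_wronskian h' x) ?_).symm
  exact (continuous_const.mul (h.continuous.mul h'.continuous)).intervalIntegrable _ _

theorem wronskian_const (h : IsClassicalSolution V z w w₁)
    (h' : IsClassicalSolution V z y y₁) (a b : ℝ) :
    w b * y₁ b - w₁ b * y b = w a * y₁ a - w₁ a * y a := by
  have := h.wronskian_sub h' a b
  rw [sub_self, zero_mul] at this
  exact sub_eq_zero.1 this

end IsClassicalSolution

/-- Gronwall's inequality for a first-order system in integrated form. -/
theorem eq_zero_right_of_norm_le_integral {w w₁ : ℝ → ℂ} {a K : ℝ}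
    (hw : ∀ x, HasDerivAt w (w₁ x) x) (hc : Continuous w₁) (ha : w a = 0)
    (h : ∀ x, a ≤ x → ‖w₁ x‖ ≤ ∫ t in a..x, K * ‖w t‖) :
    ∀ x, a ≤ x → w x = 0 ∧ w₁ x = 0 := by
  have hcw : Continuous w := continuous_iff_continuousAt.2 fun x => (hw x).continuousAt
  have hg : ∀ x, a ≤ x → ‖w x‖ ≤ ∫ t in a..x, ‖w₁ t‖ := by
    intro x hx
    have h1 : ∫ t in a..x, w₁ t = w x - w a :=
      intervalIntegral.integral_eq_sub_of_hasDerivAt (fun t _ => hw t) (hc.intervalIntegrable _ _)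
    rw [ha, sub_zero] at h1
    rw [← h1]
    exact intervalIntegral.norm_integral_le_integral_norm hx
  -- Both norms are controlled by `g`, so `g' ≤ (1 + |K|) g` with `g a = 0`, and Gronwall gives `g =
  -- 0` on the half-line.
  set g : ℝ → ℝ := fun x => ∫ t in a..x, (‖w t‖ + ‖w₁ t‖) with hgdef
  have hcs : Continuous fun t => ‖w t‖ + ‖w₁ t‖ := hcw.norm.add hc.norm
  have hg' : ∀ x, HasDerivAt g (‖w x‖ + ‖w₁ x‖) x := fun x =>
    intervalIntegral.integral_hasDerivAt_right (hcs.intervalIntegrable _ _)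
      (hcs.stronglyMeasurableAtFilter _ _) hcs.continuousAt
  have hg0 : ∀ x, a ≤ x → 0 ≤ g x := fun x hx =>
    intervalIntegral.integral_nonneg hx fun t _ => by positivity
  have hbound : ∀ x, a ≤ x → ‖w x‖ + ‖w₁ x‖ ≤ (1 + |K|) * g x := by
    intro x hx
    have e : g x = (∫ t in a..x, ‖w t‖) + ∫ t in a..x, ‖w₁ t‖ :=
      intervalIntegral.integral_add (hcw.norm.intervalIntegrable _ _)
        (hc.norm.intervalIntegrable _ _)
    have h1 := hg x hx
    have h2 := h x hx
    rw [intervalIntegral.integral_const_mul] at h2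
    have p1 : 0 ≤ ∫ t in a..x, ‖w t‖ := intervalIntegral.integral_nonneg hx fun t _ => by positivity
    have p2 : 0 ≤ ∫ t in a..x, ‖w₁ t‖ :=
      intervalIntegral.integral_nonneg hx fun t _ => by positivity
    have h3 : K * (∫ t in a..x, ‖w t‖) ≤ |K| * ∫ t in a..x, ‖w t‖ :=
      mul_le_mul_of_nonneg_right (le_abs_self K) p1
    rw [e]
    nlinarith [abs_nonneg K, mul_nonneg (abs_nonneg K) p2]
  intro x hx
  have key := norm_le_gronwallBound_of_norm_deriv_right_le (f := g)
    (f' := fun x => ‖w x‖ + ‖w₁ x‖) (δ := 0) (K := 1 + |K|) (ε := 0) (a := a) (b := x)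
    (fun t _ => (hg' t).continuousAt.continuousWithinAt)
    (fun t _ => (hg' t).hasDerivWithinAt) (by simp [hgdef])
    (fun t ht => by
      have := hbound t ht.1
      rw [Real.norm_of_nonneg (by positivity), Real.norm_of_nonneg (hg0 t ht.1), add_zero]
      exact this) x ⟨hx, le_rfl⟩
  rw [gronwallBound_ε0_δ0, Real.norm_of_nonneg (hg0 x hx)] at key
  have h1 := hbound x hx
  have h2 : (1 + |K|) * g x ≤ 0 := mul_nonpos_of_nonneg_of_nonpos (by positivity) key
  have n1 := norm_nonneg (w x)
  have n2 := norm_nonneg (w₁ x)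
  exact ⟨norm_le_zero_iff.1 (by linarith), norm_le_zero_iff.1 (by linarith)⟩

/-- Uniqueness on a half-line for `w'' = q w` with continuous bounded `q`. -/
theorem eq_zero_right_of_hasDerivAt {w w₁ q : ℝ → ℂ} {a K : ℝ}
    (hw : ∀ x, HasDerivAt w (w₁ x) x) (hc : Continuous w₁) (hq : Continuous q)
    (hw₁ : ∀ x, a ≤ x → HasDerivAt w₁ (q x * w x) x) (hK : ∀ x, a ≤ x → ‖q x‖ ≤ K)
    (ha : w a = 0) (ha' : w₁ a = 0) : ∀ x, a ≤ x → w x = 0 ∧ w₁ x = 0 := by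
  have hcw : Continuous w := continuous_iff_continuousAt.2 fun x => (hw x).continuousAt
  refine eq_zero_right_of_norm_le_integral (K := K) hw hc ha fun x hx => ?_
  have h1 : ∫ t in a..x, q t * w t = w₁ x - w₁ a :=
    intervalIntegral.integral_eq_sub_of_hasDerivAt
      (fun t ht => hw₁ t (by rw [uIcc_of_le hx] at ht; exact ht.1))
      ((hq.mul hcw).intervalIntegrable _ _)
  rw [ha', sub_zero] at h1
  rw [← h1]
  refine intervalIntegral.norm_integral_le_of_norm_le hx (ae_of_all _ fun t ht => ?_)
    ((continuous_const.mul hcw.norm).intervalIntegrable _ _)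
  rw [norm_mul]
  exact mul_le_mul_of_nonneg_right (hK t ht.1.le) (norm_nonneg _)

theorem SolvesSchrodinger.continuous_deriv {U : ℝ → ℝ} {z : ℂ} {f w : ℝ → ℂ}
    (h : SolvesSchrodinger U z f w) : Continuous (deriv w) := by
  have e : deriv w = fun x => deriv w 0 + ∫ t in (0 : ℝ)..x, (((U t : ℂ) - z) * w t - f t) := by
    funext x
    rw [← h.2.2 0 x]
    ring
  rw [e]
  exact continuous_const.add (intervalIntegral.continuous_primitive h.2.1 0)

theorem SolvesSchrodinger.isClassicalSolution {V : ℝ → ℝ} {z : ℂ} {w : ℝ → ℂ}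
    (hV : Continuous V) (h : SolvesSchrodinger V z 0 w) :
    IsClassicalSolution V z w (deriv w) := by
  intro x
  have hc : Continuous fun t => ((V t : ℂ) - z) * w t :=
    ((Complex.continuous_ofReal.comp hV).sub continuous_const).mul h.1.continuous
  refine ⟨(h.1 x).hasDerivAt, ?_⟩
  have e : deriv w = fun x => deriv w 0 + ∫ t in (0 : ℝ)..x, ((V t : ℂ) - z) * w t := by
    funext x
    have := h.2.2 0 x
    simp only [Pi.zero_apply, sub_zero] at this
    rw [← this]
    ring
  rw [e]
  exact (intervalIntegral.integral_hasDerivAt_right (hc.intervalIntegrable _ _)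
      (hc.stronglyMeasurableAtFilter _ _) hc.continuousAt).const_add _

/-- The fundamental theorem of calculus tolerates a countable exceptional set; this absorbs the
jumps of the truncated potential and of the source. -/
theorem solvesSchrodinger_of_hasDerivAt {U : ℝ → ℝ} {z : ℂ} {f w w₁ : ℝ → ℂ} {s : Set ℝ}
    (hs : s.Countable) (hw : ∀ x, HasDerivAt w (w₁ x) x) (hc : Continuous w₁)
    (hi : ∀ a b, IntervalIntegrable (fun x => ((U x : ℂ) - z) * w x - f x) volume a b)
    (hw₁ : ∀ x, x ∉ s → HasDerivAt w₁ (((U x : ℂ) - z) * w x - f x) x) :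
    SolvesSchrodinger U z f w := by
  refine ⟨fun x => (hw x).differentiableAt, hi, fun a b => ?_⟩
  have e : deriv w = w₁ := funext fun x => (hw x).deriv
  rw [e]
  exact (integral_eq_of_hasDerivAt_off_countable w₁ _ hs hc.continuousOn
    (fun x hx => hw₁ x hx.2) (hi a b)).symm

theorem IsClassicalSolution.solvesSchrodinger {V : ℝ → ℝ} {z : ℂ} {w w₁ : ℝ → ℂ}
    (hV : Continuous V) (h : IsClassicalSolution V z w w₁) : SolvesSchrodinger V z 0 w := by
  refine solvesSchrodinger_of_hasDerivAt countable_empty (fun x => (h x).1) h.continuous'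
    (fun a b => ?_) fun x _ => (h x).2.congr_deriv (by simp)
  have : Continuous fun x => ((V x : ℂ) - z) * w x - (0 : ℝ → ℂ) x := by
    simp only [Pi.zero_apply, sub_zero]
    exact ((Complex.continuous_ofReal.comp hV).sub continuous_const).mul h.continuous
  exact this.intervalIntegrable _ _

theorem SolvesSchrodinger.sub_const_mul {U : ℝ → ℝ} {z : ℂ} {w y : ℝ → ℂ}
    (h : SolvesSchrodinger U z 0 w) (h' : SolvesSchrodinger U z 0 y) (c : ℂ) :
    SolvesSchrodinger U z 0 (fun x => w x - c * y x) := by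
  have ed : deriv (fun x => w x - c * y x) = fun x => deriv w x - c * deriv y x := funext fun x =>
    ((h.1 x).hasDerivAt.sub ((h'.1 x).hasDerivAt.const_mul c)).deriv
  have ei : (fun x => ((U x : ℂ) - z) * (w x - c * y x) - (0 : ℝ → ℂ) x)
      = fun x => (((U x : ℂ) - z) * w x - (0 : ℝ → ℂ) x)
        - c * (((U x : ℂ) - z) * y x - (0 : ℝ → ℂ) x) := by
    funext x
    simp only [Pi.zero_apply]
    ring
  refine ⟨fun x => (h.1 x).sub ((h'.1 x).const_mul c), fun a b => ?_, fun a b => ?_⟩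
  · rw [ei]
    exact (h.2.1 a b).sub ((h'.2.1 a b).const_mul c)
  · rw [ed, ei, intervalIntegral.integral_sub (h.2.1 a b) ((h'.2.1 a b).const_mul c),
      intervalIntegral.integral_const_mul, ← h.2.2, ← h'.2.2]
    ring

theorem SolvesSchrodinger.comp_neg {U : ℝ → ℝ} {z : ℂ} {w : ℝ → ℂ}
    (h : SolvesSchrodinger U z 0 w) :
    SolvesSchrodinger (fun x => U (-x)) z 0 (fun x => w (-x)) := by
  have ed : deriv (fun x => w (-x)) = fun x => -deriv w (-x) := funext fun x => by
    have := ((h.1 (-x)).hasDerivAt.scomp x (hasDerivAt_neg x)).deriv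
    rw [neg_smul, one_smul] at this
    exact this
  refine ⟨fun x => (h.1 (-x)).comp x differentiable_neg.differentiableAt, fun a b => ?_,
    fun a b => ?_⟩
  · simpa using (IntervalIntegrable.iff_comp_neg).1 (h.2.1 (-a) (-b))
  · rw [ed]
    have := intervalIntegral.integral_comp_neg (a := a) (b := b)
      (fun x => ((U x : ℂ) - z) * w x - (0 : ℝ → ℂ) x)
    rw [← h.2.2] at this
    simp only [Pi.zero_apply] at this ⊢
    rw [this]
    ring

/-- Uniqueness for the initial value problem with a bounded potential. -/
theorem SolvesSchrodinger.eq_zero_right {U : ℝ → ℝ} {z : ℂ} {w : ℝ → ℂ} {a K : ℝ}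
    (h : SolvesSchrodinger U z 0 w) (hU : ∀ x, |U x| ≤ K) (ha : w a = 0) (ha' : deriv w a = 0) :
    ∀ x, a ≤ x → w x = 0 := by
  intro x hx
  refine (eq_zero_right_of_norm_le_integral (K := K + ‖z‖) (fun x => (h.1 x).hasDerivAt)
    h.continuous_deriv ha (fun x hx => ?_) x hx).1
  have h1 := h.2.2 a x
  rw [ha', sub_zero] at h1
  rw [h1]
  refine intervalIntegral.norm_integral_le_of_norm_le hx (ae_of_all _ fun t ht => ?_)
    ((continuous_const.mul h.1.continuous.norm).intervalIntegrable _ _)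
  rw [Pi.zero_apply, sub_zero, norm_mul]
  refine mul_le_mul_of_nonneg_right ((norm_sub_le _ _).trans ?_) (norm_nonneg _)
  rw [Complex.norm_real, Real.norm_eq_abs]
  linarith [hU t]

theorem SolvesSchrodinger.eq_zero {U : ℝ → ℝ} {z : ℂ} {w : ℝ → ℂ} {a K : ℝ}
    (h : SolvesSchrodinger U z 0 w) (hU : ∀ x, |U x| ≤ K) (ha : w a = 0) (ha' : deriv w a = 0)
    (x : ℝ) : w x = 0 := by
  rcases le_total a x with hx | hx
  · exact h.eq_zero_right hU ha ha' x hx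
  · have h1 := h.comp_neg.eq_zero_right (a := -a) (fun x => hU (-x)) (by simpa using ha)
      (by
        have := ((h.1 (- -a)).hasDerivAt.scomp (-a) (hasDerivAt_neg (-a))).deriv
        simp only [neg_neg, ha', smul_zero] at this
        exact this) (-x) (neg_le_neg hx)
    simpa using h1

theorem IsClassicalSolution.eq_zero {V : ℝ → ℝ} {z : ℂ} {w w₁ : ℝ → ℂ} {a K : ℝ}
    (h : IsClassicalSolution V z w w₁) (hV : Continuous V) (hK : ∀ x, |V x| ≤ K)
    (ha : w a = 0) (ha' : w₁ a = 0) (x : ℝ) : w x = 0 :=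
  (h.solvesSchrodinger hV).eq_zero hK ha (by rw [h.deriv_eq]; exact ha') x

/-! ### Decay of square-integrable solutions -/

/-- The compact interval `[0, |R| + 1]` contains a whole period to the right of `R`; every later
point is moved into it by unit steps. -/
theorem exists_bound_of_periodic_right {h : ℝ → ℝ} {R : ℝ} (hc : Continuous h)
    (hp : ∀ x, R ≤ x → h (x + 1) = h x) : ∃ C, ∀ x, 0 ≤ x → |h x| ≤ C := by
  obtain ⟨C, hC⟩ := isCompact_Icc.exists_bound_of_continuousOn
    (hc.continuousOn (s := Icc 0 (|R| + 1)))
  refine ⟨C, ?_⟩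
  have key : ∀ n : ℕ, ∀ x, 0 ≤ x → x ≤ |R| + 1 + n → |h x| ≤ C := by
    intro n
    induction n with
    | zero => exact fun x h0 h1 => hC x ⟨h0, by simpa using h1⟩
    | succ n ih =>
      intro x h0 h1
      push_cast at h1
      by_cases hx : x ≤ |R| + 1 + n
      · exact ih x h0 hx
      · have hn : (0 : ℝ) ≤ n := n.cast_nonneg
        have h2 : |R| ≤ x - 1 := by linarith
        have := hp (x - 1) ((le_abs_self R).trans h2)
        rw [sub_add_cancel] at this
        rw [this]
        exact ih (x - 1) ((abs_nonneg R).trans h2) (by linarith)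
  intro x hx
  obtain ⟨n, hn⟩ := exists_nat_ge x
  exact key n x hx (by linarith [abs_nonneg R])

/-- The `L²` mass of a sliding window tends to `0`. It controls the `L¹` mass through `t ≤ s + t² /
s`; with `s = ε / 4` the window of length `2` contributes at most `2s + s = 3ε / 4`. -/
theorem tendsto_integral_norm_of_memLp {w : ℝ → ℂ} (hc : Continuous w)
    (hw : MemLp w 2 volume) : Tendsto (fun x => ∫ t in x..x + 2, ‖w t‖) atTop (𝓝 0) := by
  have hi : Integrable (fun t => ‖w t‖ ^ 2) :=
    (memLp_two_iff_integrable_sq_norm hw.aestronglyMeasurable).1 hw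
  have h1 := intervalIntegral_tendsto_integral_Ioi (μ := volume) 0 hi.integrableOn tendsto_id
  have h2 := intervalIntegral_tendsto_integral_Ioi (μ := volume) 0 hi.integrableOn
    (tendsto_atTop_add_const_right atTop (2 : ℝ) tendsto_id)
  have h3 := h2.sub h1
  rw [sub_self] at h3
  have hsq : Continuous fun t => ‖w t‖ ^ 2 := hc.norm.pow 2
  have h4 : Tendsto (fun x => ∫ t in x..x + 2, ‖w t‖ ^ 2) atTop (𝓝 0) := by
    refine h3.congr fun x => ?_
    exact intervalIntegral.integral_interval_sub_left (hsq.intervalIntegrable _ _)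
      (hsq.intervalIntegrable _ _)
  rw [Metric.tendsto_atTop] at h4 ⊢
  intro ε hε
  obtain ⟨X, hX⟩ := h4 (ε / 4 * (ε / 4)) (by positivity)
  refine ⟨X, fun x hx => ?_⟩
  have h5 := hX x hx
  rw [Real.dist_0_eq_abs] at h5 ⊢
  have hx2 : x ≤ x + 2 := by linarith
  rw [abs_of_nonneg (intervalIntegral.integral_nonneg hx2 fun t _ => by positivity)] at h5 ⊢
  have h6 : ∫ t in x..x + 2, ‖w t‖ ≤ ∫ t in x..x + 2, (ε / 4 + (ε / 4)⁻¹ * ‖w t‖ ^ 2) := by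
    refine intervalIntegral.integral_mono_on hx2 (hc.norm.intervalIntegrable _ _)
      ((continuous_const.add (continuous_const.mul hsq)).intervalIntegrable _ _) fun t _ => ?_
    have hs : (0 : ℝ) < ε / 4 := by positivity
    have e : ε / 4 + (ε / 4)⁻¹ * ‖w t‖ ^ 2 - ‖w t‖
        = (ε / 4)⁻¹ * ((‖w t‖ - ε / 4 / 2) ^ 2 + 3 / 4 * (ε / 4) ^ 2) := by
      field_simp
      ring
    have : 0 ≤ ε / 4 + (ε / 4)⁻¹ * ‖w t‖ ^ 2 - ‖w t‖ := by
      rw [e]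
      positivity
    linarith
  have hsq' : Continuous fun t => (ε / 4)⁻¹ * ‖w t‖ ^ 2 := continuous_const.mul hsq
  rw [intervalIntegral.integral_add intervalIntegrable_const
    (hsq'.intervalIntegrable _ _), intervalIntegral.integral_const,
    intervalIntegral.integral_const_mul] at h6
  have h7 : (ε / 4)⁻¹ * ∫ t in x..x + 2, ‖w t‖ ^ 2 < ε / 4 := by
    rw [inv_mul_lt_iff₀ (by positivity)]
    exact h5
  simp only [add_sub_cancel_left, smul_eq_mul] at h6
  linarith

theorem exists_norm_le_of_integral {w : ℝ → ℂ} (hc : Continuous w) {a b η : ℝ} (hab : a < b)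
    (h : ∫ t in a..b, ‖w t‖ ≤ (b - a) * η) : ∃ p ∈ Icc a b, ‖w p‖ ≤ η := by
  obtain ⟨p, hp, hmin⟩ := isCompact_Icc.exists_isMinOn (nonempty_Icc.2 hab.le)
    (hc.norm.continuousOn (s := Icc a b))
  refine ⟨p, hp, ?_⟩
  have h1 : ∫ _ in a..b, ‖w p‖ ≤ ∫ t in a..b, ‖w t‖ :=
    intervalIntegral.integral_mono_on hab.le intervalIntegrable_const
      (hc.norm.intervalIntegrable _ _) fun t ht => hmin ht
  rw [intervalIntegral.integral_const, smul_eq_mul] at h1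
  exact le_of_mul_le_mul_left (h1.trans h) (sub_pos.2 hab)

theorem integral_norm_le_of_subinterval {w : ℝ → ℂ} (hc : Continuous w) {a b c d : ℝ}
    (hca : c ≤ a) (hab : a ≤ b) (hbd : b ≤ d) :
    ∫ t in a..b, ‖w t‖ ≤ ∫ t in c..d, ‖w t‖ :=
  intervalIntegral.integral_mono_interval hca hab hbd (ae_of_all _ fun _ => norm_nonneg _)
    (hc.norm.intervalIntegrable _ _)

/-- By the equation, `w₁` varies on the window by at most `L η`. Averaging gives points `p` and `q`,
at least `1/2` apart, where `w` is `O(η)`; the difference quotient between them bounds `w₁ x`, and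
integrating back from `p` bounds `w x`. Hence an `L²` solution decays pointwise together with its
derivative. -/
theorem IsClassicalSolution.norm_le_integral {V : ℝ → ℝ} {z : ℂ} {w w₁ : ℝ → ℂ} {K : ℝ}
    (h : IsClassicalSolution V z w w₁) (hV : Continuous V) (hK : ∀ x, |V x| ≤ K) (x : ℝ) :
    ‖w₁ x‖ ≤ (6 + 4 * (K + ‖z‖)) * (∫ t in x..x + 2, ‖w t‖) ∧
    ‖w x‖ ≤ (8 + 6 * (K + ‖z‖)) * ∫ t in x..x + 2, ‖w t‖ := by
  have hc := h.continuous
  set L := K + ‖z‖ with hL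
  set η := ∫ t in x..x + 2, ‖w t‖ with hη
  have hL0 : 0 ≤ L := add_nonneg ((abs_nonneg _).trans (hK 0)) (norm_nonneg _)
  have hη0 : 0 ≤ η := intervalIntegral.integral_nonneg (by linarith) fun t _ => norm_nonneg _
  have hd : ∀ t ∈ Icc x (x + 2), ‖w₁ t - w₁ x‖ ≤ L * η := by
    intro t ht
    have hq : Continuous fun s => ((V s : ℂ) - z) * w s :=
      ((Complex.continuous_ofReal.comp hV).sub continuous_const).mul hc
    rw [← intervalIntegral.integral_eq_sub_of_hasDerivAt (fun s _ => (h s).2)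
      (hq.intervalIntegrable _ _)]
    refine (intervalIntegral.norm_integral_le_of_norm_le ht.1 (g := fun s => L * ‖w s‖)
      (ae_of_all _ fun s hs => ?_) ((continuous_const.mul hc.norm).intervalIntegrable _ _)).trans ?_
    · rw [norm_mul]
      refine mul_le_mul_of_nonneg_right ((norm_sub_le _ _).trans ?_) (norm_nonneg _)
      rw [Complex.norm_real, Real.norm_eq_abs]
      linarith [hK s]
    · rw [intervalIntegral.integral_const_mul]
      exact mul_le_mul_of_nonneg_left
        (integral_norm_le_of_subinterval hc le_rfl ht.1 ht.2) hL0
  obtain ⟨p, hp, hpw⟩ := exists_norm_le_of_integral hc (a := x) (b := x + 1 / 2) (η := 2 * η)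
    (by linarith) (by
      refine (integral_norm_le_of_subinterval hc le_rfl (by linarith)
        (by linarith : x + 1 / 2 ≤ x + 2)).trans (le_of_eq ?_)
      rw [← hη]
      ring)
  obtain ⟨q, hq, hqw⟩ := exists_norm_le_of_integral hc (a := x + 1) (b := x + 2) (η := η)
    (by linarith) (by
      refine (integral_norm_le_of_subinterval hc (by linarith : x ≤ x + 1) (by linarith)
        le_rfl).trans (le_of_eq ?_)
      rw [← hη]
      ring)
  have hg : ∀ t ∈ Icc x (x + 2), HasDerivWithinAt (fun t : ℝ => w t - t * w₁ x)
      (w₁ t - w₁ x) (Icc x (x + 2)) t := fun t _ =>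
    (((h t).1.sub (((hasDerivAt_id t).ofReal_comp).mul_const (w₁ x))).congr_deriv
      (by simp)).hasDerivWithinAt
  have hmem : ∀ {t}, x ≤ t → t ≤ x + 2 → t ∈ Icc x (x + 2) := fun h1 h2 => ⟨h1, h2⟩
  have m1 := Convex.norm_image_sub_le_of_norm_hasDerivWithin_le hg hd (convex_Icc _ _)
    (hmem hp.1 (by linarith [hp.2])) (hmem (by linarith [hq.1]) hq.2)
  have m2 := Convex.norm_image_sub_le_of_norm_hasDerivWithin_le hg hd (convex_Icc _ _)
    (hmem hp.1 (by linarith [hp.2])) (hmem le_rfl (by linarith))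
  have hpq : 1 / 2 ≤ q - p := by linarith [hp.2, hq.1]
  have hLη : 0 ≤ L * η := mul_nonneg hL0 hη0
  have b1 : ‖w₁ x‖ ≤ (6 + 4 * L) * η := by
    have e : ((q - p : ℝ) : ℂ) * w₁ x = w q - w p - ((w q - q * w₁ x) - (w p - p * w₁ x)) := by
      push_cast
      ring
    have n1 : (q - p) * ‖w₁ x‖ ≤ ‖w q‖ + ‖w p‖ + L * η * ‖q - p‖ := by
      have := congrArg norm e
      rw [norm_mul, Complex.norm_real, Real.norm_of_nonneg (by linarith)] at this
      rw [this]
      exact (norm_sub_le _ _).trans (add_le_add (norm_sub_le _ _) m1)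
    rw [Real.norm_of_nonneg (by linarith)] at n1
    have h2 : q - p ≤ 2 := by linarith [hp.1, hq.2]
    nlinarith [norm_nonneg (w₁ x), mul_le_mul_of_nonneg_left h2 hLη,
      mul_le_mul_of_nonneg_right hpq (norm_nonneg (w₁ x))]
  refine ⟨b1, ?_⟩
  have e : w x = w p + ((w x - x * w₁ x) - (w p - p * w₁ x)) - ((p - x : ℝ) : ℂ) * w₁ x := by
    push_cast
    ring
  have n2 : ‖w x‖ ≤ ‖w p‖ + L * η * ‖x - p‖ + (p - x) * ‖w₁ x‖ := by
    have e2 : ‖((p - x : ℝ) : ℂ) * w₁ x‖ = (p - x) * ‖w₁ x‖ := by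
      rw [norm_mul, Complex.norm_real, Real.norm_of_nonneg (by linarith [hp.1])]
    rw [← e2]
    nth_rewrite 1 [e]
    exact (norm_sub_le _ _).trans (add_le_add_left ((norm_add_le _ _).trans
      (add_le_add_right m2 _)) _)
  have h3 : ‖x - p‖ ≤ 1 / 2 := by
    rw [norm_sub_rev, Real.norm_of_nonneg (by linarith [hp.1])]
    linarith [hp.2]
  have h4 : (p - x) * ‖w₁ x‖ ≤ 1 / 2 * ‖w₁ x‖ :=
    mul_le_mul_of_nonneg_right (by linarith [hp.2]) (norm_nonneg _)
  nlinarith [mul_le_mul_of_nonneg_left h3 hLη]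

theorem IsClassicalSolution.tendsto_zero {V : ℝ → ℝ} {z : ℂ} {w w₁ : ℝ → ℂ} {K : ℝ}
    (h : IsClassicalSolution V z w w₁) (hV : Continuous V) (hK : ∀ x, |V x| ≤ K)
    (hw : MemLp w 2 volume) : Tendsto w atTop (𝓝 0) ∧ Tendsto w₁ atTop (𝓝 0) := by
  have h0 := tendsto_integral_norm_of_memLp h.continuous hw
  constructor
  · exact squeeze_zero_norm (fun x => (h.norm_le_integral hV hK x).2)
      (by simpa using h0.const_mul (8 + 6 * (K + ‖z‖)))
  · exact squeeze_zero_norm (fun x => (h.norm_le_integral hV hK x).1)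
      (by simpa using h0.const_mul (6 + 4 * (K + ‖z‖)))

theorem IsClassicalSolution.tendsto_zero_atBot {V : ℝ → ℝ} {z : ℂ} {w w₁ : ℝ → ℂ} {K : ℝ}
    (h : IsClassicalSolution V z w w₁) (hV : Continuous V) (hVe : Function.Even V)
    (hK : ∀ x, |V x| ≤ K) (hw : MemLp w 2 volume) :
    Tendsto (fun x => w (-x)) atTop (𝓝 0) ∧ Tendsto (fun x => -w₁ (-x)) atTop (𝓝 0) :=
  (h.comp_neg hVe).tendsto_zero hV hK
    (hw.comp_measurePreserving (Measure.measurePreserving_neg volume))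

/-- An `L²` solution with an even potential satisfies a Dirichlet or Neumann condition at `0`. -/
theorem IsClassicalSolution.mul_eq_zero_of_memLp {V : ℝ → ℝ} {z : ℂ} {w w₁ : ℝ → ℂ} {K : ℝ}
    (h : IsClassicalSolution V z w w₁) (hV : Continuous V) (hVe : Function.Even V)
    (hK : ∀ x, |V x| ≤ K) (hw : MemLp w 2 volume) : w 0 * w₁ 0 = 0 := by
  obtain ⟨t1, t2⟩ := h.tendsto_zero hV hK hw
  obtain ⟨t3, t4⟩ := h.tendsto_zero_atBot hV hVe hK hw
  -- The Wronskian of `w` and `x ↦ w (-x)` is constant. It tends to `0` at infinity and equals `-2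
  -- w(0) w₁(0)` at the origin.
  have t5 := (t1.mul t4).sub (t2.mul t3)
  have t6 : Tendsto (fun _ : ℝ => w 0 * -w₁ (-0) - w₁ 0 * w (-0)) atTop (𝓝 (0 * 0 - 0 * 0)) :=
    t5.congr fun x => h.wronskian_const (h.comp_neg hVe) 0 x
  have t7 := tendsto_nhds_unique tendsto_const_nhds t6
  rw [neg_zero] at t7
  linear_combination (-1 / 2 : ℂ) * t7

theorem IsClassicalSolution.even_or_odd {V : ℝ → ℝ} {z : ℂ} {w w₁ : ℝ → ℂ} {K : ℝ}
    (h : IsClassicalSolution V z w w₁) (hV : Continuous V) (hVe : Function.Even V)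
    (hK : ∀ x, |V x| ≤ K) (h0 : w 0 * w₁ 0 = 0) :
    (w₁ 0 = 0 ∧ Function.Even w) ∨ (w 0 = 0 ∧ Function.Odd w) := by
  rcases mul_eq_zero.1 h0 with h0 | h0
  · refine Or.inr ⟨h0, fun x => ?_⟩
    have := ((h.comp_neg hVe).add h).eq_zero hV hK (a := 0) (by simp [h0]) (by simp) x
    exact eq_neg_of_add_eq_zero_left this
  · refine Or.inl ⟨h0, fun x => ?_⟩
    have := ((h.comp_neg hVe).sub h).eq_zero hV hK (a := 0) (by simp) (by simp [h0]) x
    exact sub_eq_zero.1 this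

/-! ### Floquet theory on a half-line -/

namespace IsClassicalSolution

variable {V : ℝ → ℝ} {z : ℂ} {u u₁ v v₁ w w₁ y y₁ : ℝ → ℂ} {K R : ℝ}

theorem shift_eq (hV : Continuous V) (hK : ∀ x, |V x| ≤ K)
    (hp : ∀ x, R ≤ x → V (x + 1) = V x) (hw : IsClassicalSolution V z w w₁)
    (hy : IsClassicalSolution V z y y₁) (h0 : w (R + 1) = y R) (h1 : w₁ (R + 1) = y₁ R) :
    ∀ x, R ≤ x → w (x + 1) = y x ∧ w₁ (x + 1) = y₁ x := by
  intro x hx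
  have d1 : ∀ x, HasDerivAt (fun x => w (x + 1) - y x) (w₁ (x + 1) - y₁ x) x := fun x =>
    ((hw (x + 1)).1.comp_add_const x 1).sub (hy x).1
  have d2 : ∀ x, R ≤ x → HasDerivAt (fun x => w₁ (x + 1) - y₁ x)
      (((V x : ℂ) - z) * (w (x + 1) - y x)) x := fun x hx =>
    (((hw (x + 1)).2.comp_add_const x 1).sub (hy x).2).congr_deriv (by rw [hp x hx]; ring)
  have := eq_zero_right_of_hasDerivAt (K := K + ‖z‖) d1
    ((hw.continuous'.comp (continuous_add_const 1)).sub hy.continuous')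
    ((Complex.continuous_ofReal.comp hV).sub continuous_const) d2
    (fun x _ => (norm_sub_le _ _).trans (by
      simp only [Function.comp_apply, Complex.norm_real, Real.norm_eq_abs]
      linarith [hK x])) (sub_eq_zero.2 h0) (sub_eq_zero.2 h1) x hx
  exact ⟨sub_eq_zero.1 this.1, sub_eq_zero.1 this.2⟩

/-- The shift by a period acts linearly on solutions near `+∞`. -/
theorem exists_shift_eq (hV : Continuous V) (hK : ∀ x, |V x| ≤ K)
    (hp : ∀ x, R ≤ x → V (x + 1) = V x) (hu : IsClassicalSolution V z u u₁)
    (hv : IsClassicalSolution V z v v₁) (hW : ∀ x, u x * v₁ x - u₁ x * v x = 1)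
    (hw : IsClassicalSolution V z w w₁) :
    ∃ α β : ℂ, ∀ x, R ≤ x → w (x + 1) = α * u x + β * v x ∧ w₁ (x + 1) = α * u₁ x + β * v₁ x := by
  refine ⟨w (R + 1) * v₁ R - w₁ (R + 1) * v R, u R * w₁ (R + 1) - u₁ R * w (R + 1), ?_⟩
  refine shift_eq hV hK hp hw ((hu.const_mul _).add (hv.const_mul _)) ?_ ?_
  · linear_combination (-w (R + 1)) * hW R
  · linear_combination (-w₁ (R + 1)) * hW R

/-- The shift by one period has determinant `1` on solutions. The decaying `u` is an eigenvector,
its eigenvalue `m` is real because `u` is, and decay forces `|m| < 1`. The other eigenvalue `m⁻¹` is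
then distinct, so a multiple of `u` can be added to `v` to diagonalize the shift. -/
theorem exists_floquet (hV : Continuous V) (hK : ∀ x, |V x| ≤ K)
    (hp : ∀ x, R ≤ x → V (x + 1) = V x) (hu : IsClassicalSolution V z u u₁)
    (hv : IsClassicalSolution V z v v₁) (hW : ∀ x, u x * v₁ x - u₁ x * v x = 1)
    (hre : ∀ x, starRingEnd ℂ (u x) = u x) (hre' : ∀ x, starRingEnd ℂ (u₁ x) = u₁ x)
    (hL : MemLp u 2 volume) :
    ∃ m : ℝ, m ≠ 0 ∧ |m| < 1 ∧ (∀ x, R ≤ x → u (x + 1) = m * u x ∧ u₁ (x + 1) = m * u₁ x) ∧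
      ∃ γ : ℂ, ∀ x, R ≤ x → v (x + 1) + γ * u (x + 1) = (m : ℂ)⁻¹ * (v x + γ * u x) ∧
        v₁ (x + 1) + γ * u₁ (x + 1) = (m : ℂ)⁻¹ * (v₁ x + γ * u₁ x) := by
  obtain ⟨μ, β, h1⟩ := exists_shift_eq hV hK hp hu hv hW hu
  obtain ⟨α, β', h2⟩ := exists_shift_eq hV hK hp hu hv hW hv
  obtain ⟨t0, t1⟩ := hu.tendsto_zero hV hK hL
  have ts : Tendsto (fun x : ℝ => x + 1) atTop atTop :=
    tendsto_atTop_add_const_right _ _ tendsto_id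
  -- The Wronskian of `u` and its shift is the constant `β` on `[R, ∞)`, and it tends to `0` since
  -- `u` and `u₁` do.
  have hβ : β = 0 := by
    have t2 := (t0.mul (t1.comp ts)).sub (t1.mul (t0.comp ts))
    refine tendsto_nhds_unique (tendsto_const_nhds.congr' ?_) (by simpa using t2)
    filter_upwards [eventually_ge_atTop R] with x hx
    simp only [(h1 x hx).1, (h1 x hx).2]
    linear_combination (-β) * hW x
  subst hβ
  simp only [zero_mul, add_zero] at h1
  have hμβ : μ * β' = 1 := by
    have e1 := hW (R + 1)
    rw [(h1 R le_rfl).1, (h1 R le_rfl).2, (h2 R le_rfl).1, (h2 R le_rfl).2] at e1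
    linear_combination e1 - μ * β' * hW R
  have hμ0 : μ ≠ 0 := left_ne_zero_of_mul_eq_one hμβ
  have hne : u R ≠ 0 ∨ u₁ R ≠ 0 := by
    by_contra hcon
    push Not at hcon
    have := hW R
    rw [hcon.1, hcon.2] at this
    simp at this
  have hreal : starRingEnd ℂ μ = μ := by
    have e1 := congrArg (starRingEnd ℂ) (h1 R le_rfl).1
    have e2 := congrArg (starRingEnd ℂ) (h1 R le_rfl).2
    rw [map_mul, hre, hre, (h1 R le_rfl).1] at e1
    rw [map_mul, hre', hre', (h1 R le_rfl).2] at e2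
    rcases hne with h | h
    · exact (mul_right_cancel₀ h e1).symm
    · exact (mul_right_cancel₀ h e2).symm
  obtain ⟨m, rfl⟩ := Complex.conj_eq_iff_real.1 hreal
  have hpow : ∀ n : ℕ, u (R + n) = (m : ℂ) ^ n * u R ∧ u₁ (R + n) = (m : ℂ) ^ n * u₁ R := by
    intro n
    induction n with
    | zero => simp
    | succ n ih =>
      have hn : R ≤ R + n := by
        have : (0 : ℝ) ≤ n := n.cast_nonneg
        linarith
      have e := h1 (R + n) hn
      rw [add_assoc] at e
      push_cast
      rw [e.1, e.2, ih.1, ih.2]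
      constructor <;> ring
  have tn : Tendsto (fun n : ℕ => R + (n : ℝ)) atTop atTop :=
    tendsto_atTop_add_const_left _ _ tendsto_natCast_atTop_atTop
  have hm1 : |m| < 1 := by
    have aux : ∀ {c : ℂ}, c ≠ 0 → Tendsto (fun n : ℕ => (m : ℂ) ^ n * c) atTop (𝓝 0) → |m| < 1 := by
      intro c hc ht
      have := ht.mul_const c⁻¹
      simp only [mul_assoc, mul_inv_cancel₀ hc, mul_one, zero_mul] at this
      have := tendsto_pow_atTop_nhds_zero_iff_norm_lt_one.1 this
      simpa using this
    rcases hne with h | h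
    · exact aux h ((t0.comp tn).congr fun n => (hpow n).1)
    · exact aux h ((t1.comp tn).congr fun n => (hpow n).2)
  have hm0 : m ≠ 0 := by exact_mod_cast hμ0
  have hmm : (1 : ℂ) - m ^ 2 ≠ 0 := by
    have : (1 : ℝ) - m ^ 2 ≠ 0 := by
      have := (sq_lt_one_iff_abs_lt_one m).2 hm1
      linarith
    exact_mod_cast this
  have hβ' : β' = (m : ℂ)⁻¹ := eq_inv_of_mul_eq_one_right hμβ
  -- This `γ` solves `α + γ m = γ / m`, the condition for `v + γ u` to be an eigenvector with
  -- eigenvalue `m⁻¹`.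
  refine ⟨m, hm0, hm1, h1, α * m / (1 - m ^ 2), fun x hx => ?_⟩
  rw [(h1 x hx).1, (h1 x hx).2, (h2 x hx).1, (h2 x hx).2, hβ']
  constructor <;>
  · field_simp
    ring

end IsClassicalSolution

/-- Dividing `‖g‖` by `|m|^x` leaves a function of period `1` near `+∞`, which is bounded. -/
theorem exists_exp_bound_of_shift {g : ℝ → ℂ} {R m : ℝ} (hg : Continuous g) (hm : m ≠ 0)
    (h : ∀ x, R ≤ x → g (x + 1) = m * g x) :
    ∃ C, ∀ x, 0 ≤ x → ‖g x‖ ≤ C * Real.exp (Real.log |m| * x) := by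
  obtain ⟨C, hC⟩ := exists_bound_of_periodic_right
    (h := fun x => ‖g x‖ * Real.exp (-(Real.log |m| * x))) (R := R) (by fun_prop) (fun x hx => by
      rw [h x hx, norm_mul, Complex.norm_real, Real.norm_eq_abs]
      have e : Real.exp (-(Real.log |m| * (x + 1)))
          = Real.exp (-(Real.log |m| * x)) * |m|⁻¹ := by
        rw [mul_add, neg_add, Real.exp_add, mul_one, Real.exp_neg (Real.log |m|),
          Real.exp_log (abs_pos.2 hm)]
      rw [e]
      have := abs_ne_zero.2 hm
      field_simp)
  refine ⟨C, fun x hx => ?_⟩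
  have := (le_abs_self _).trans (hC x hx)
  rwa [Real.exp_neg, mul_inv_le_iff₀ (Real.exp_pos _)] at this

/-- Exponential bounds for the decaying solution and for a complementary solution. -/
theorem IsClassicalSolution.exists_exp_bounds {u u₁ v v₁ : ℝ → ℂ} {V : ℝ → ℝ} {z : ℂ} {R m : ℝ}
    {γ : ℂ} (hu : IsClassicalSolution V z u u₁) (hv : IsClassicalSolution V z v v₁) (hm : m ≠ 0)
    (hm1 : |m| < 1) (h : ∀ x, R ≤ x → u (x + 1) = m * u x ∧ u₁ (x + 1) = m * u₁ x)
    (hγ : ∀ x, R ≤ x → v (x + 1) + γ * u (x + 1) = (m : ℂ)⁻¹ * (v x + γ * u x) ∧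
        v₁ (x + 1) + γ * u₁ (x + 1) = (m : ℂ)⁻¹ * (v₁ x + γ * u₁ x)) :
    ∃ C, ∀ x, 0 ≤ x → ‖u x‖ ≤ C * Real.exp (-(Real.log |m⁻¹| * x)) ∧
      ‖u₁ x‖ ≤ C * Real.exp (-(Real.log |m⁻¹| * x)) ∧
      ‖v x‖ ≤ C * Real.exp (Real.log |m⁻¹| * x) ∧ ‖v₁ x‖ ≤ C * Real.exp (Real.log |m⁻¹| * x) := by
  have hk : -Real.log |m⁻¹| = Real.log |m| := by rw [abs_inv, Real.log_inv, neg_neg]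
  have hk0 : 0 < Real.log |m⁻¹| := by
    rw [← neg_neg (Real.log _), hk]
    exact neg_pos.2 (Real.log_neg (abs_pos.2 hm) hm1)
  obtain ⟨C1, h1⟩ := exists_exp_bound_of_shift hu.continuous hm fun x hx => (h x hx).1
  obtain ⟨C2, h2⟩ := exists_exp_bound_of_shift hu.continuous' hm fun x hx => (h x hx).2
  obtain ⟨C3, h3⟩ := exists_exp_bound_of_shift (m := m⁻¹)
    (hv.continuous.add (continuous_const.mul hu.continuous)) (inv_ne_zero hm)
    (fun x hx => by push_cast; exact (hγ x hx).1)
  obtain ⟨C4, h4⟩ := exists_exp_bound_of_shift (m := m⁻¹)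
    (hv.continuous'.add (continuous_const.mul hu.continuous')) (inv_ne_zero hm)
    (fun x hx => by push_cast; exact (hγ x hx).2)
  rw [← hk] at h1 h2
  set k := Real.log |m⁻¹| with hkdef
  have mono : ∀ {a b c t : ℝ}, 0 < t → c ≤ a * t → a ≤ b → c ≤ b * t := fun ht h h' =>
    h.trans (mul_le_mul_of_nonneg_right h' ht.le)
  have second : ∀ {a b : ℂ} {c d x : ℝ}, 0 ≤ x → ‖a + γ * b‖ ≤ c * Real.exp (k * x) →
      ‖b‖ ≤ d * Real.exp (-k * x) → ‖a‖ ≤ (|c| + ‖γ‖ * |d|) * Real.exp (k * x) := by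
    intro a b c d x hx ha hb
    have e1 : Real.exp (-k * x) ≤ Real.exp (k * x) :=
      Real.exp_le_exp.2 (by nlinarith [mul_nonneg hk0.le hx])
    have hb' : ‖b‖ ≤ |d| * Real.exp (k * x) :=
      hb.trans ((mul_le_mul_of_nonneg_right (le_abs_self d) (Real.exp_pos _).le).trans
        (mul_le_mul_of_nonneg_left e1 (abs_nonneg d)))
    have ha' := ha.trans (mul_le_mul_of_nonneg_right (le_abs_self c) (Real.exp_pos _).le)
    calc ‖a‖ = ‖(a + γ * b) - γ * b‖ := by rw [add_sub_cancel_right]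
      _ ≤ ‖a + γ * b‖ + ‖γ‖ * ‖b‖ := (norm_sub_le _ _).trans (by rw [norm_mul])
      _ ≤ |c| * Real.exp (k * x) + ‖γ‖ * (|d| * Real.exp (k * x)) :=
        add_le_add ha' (mul_le_mul_of_nonneg_left hb' (norm_nonneg _))
      _ = _ := by ring
  have n1 := abs_nonneg C1
  have n2 := abs_nonneg C2
  have n3 := abs_nonneg C3
  have n4 := abs_nonneg C4
  have g1 := mul_nonneg (norm_nonneg γ) n1
  have g2 := mul_nonneg (norm_nonneg γ) n2
  refine ⟨|C1| + |C2| + (|C3| + ‖γ‖ * |C1|) + (|C4| + ‖γ‖ * |C2|), fun x hx => ?_⟩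
  rw [← neg_mul]
  refine ⟨mono (Real.exp_pos _) (h1 x hx) ?_, mono (Real.exp_pos _) (h2 x hx) ?_,
    mono (Real.exp_pos _) (second hx (h3 x hx) (h1 x hx)) ?_,
    mono (Real.exp_pos _) (second hx (h4 x hx) (h2 x hx)) ?_⟩
  · linarith [le_abs_self C1]
  · linarith [le_abs_self C2]
  · linarith
  · linarith

/-- A quasi-periodic solution near `+∞` extends to a Floquet solution of the periodic equation. -/
theorem isCharacteristicMultiplier_of_shift {V W : ℝ → ℝ} {E R m : ℝ} {ψ ψ₁ : ℝ → ℂ}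
    (hV : Continuous V) (hW : ∀ x, W (x + 1) = W x) (hVW : ∀ x, R < x → V x = W x)
    (hm : m ≠ 0) (hψ : IsClassicalSolution V E ψ ψ₁) (hne : ∃ x, R ≤ x ∧ ψ x ≠ 0)
    (h : ∀ x, R ≤ x → ψ (x + 1) = m * ψ x ∧ ψ₁ (x + 1) = m * ψ₁ x) :
    IsCharacteristicMultiplier W E m := by
  have hmC : (m : ℂ) ≠ 0 := by exact_mod_cast hm
  have hpow : ∀ (n : ℕ) x, R ≤ x → ψ (x + n) = (m : ℂ) ^ n * ψ x ∧
      ψ₁ (x + n) = (m : ℂ) ^ n * ψ₁ x := by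
    intro n x hx
    induction n with
    | zero => simp
    | succ n ih =>
      have hn : R ≤ x + n := by
        have : (0 : ℝ) ≤ n := n.cast_nonneg
        linarith
      have e := h (x + n) hn
      rw [add_assoc] at e
      push_cast
      rw [e.1, e.2, ih.1, ih.2]
      constructor <;> ring
  have hWn : ∀ (n : ℕ) x, W (x + n) = W x := by
    intro n x
    induction n with
    | zero => simp
    | succ n ih =>
      push_cast
      rw [← add_assoc, hW, ih]
  have hceil : ∀ x : ℝ, R ≤ x + (⌈R - x⌉₊ : ℕ) := fun x => by
    linarith [Nat.le_ceil (R - x)]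
  -- Extension to the left by quasi-periodicity: move `x` right by the least number of periods that
  -- reaches `[R, ∞)` and divide by the power of `m`. By `hχ` any larger number gives the same
  -- value, so one shift can be used on a whole neighbourhood of a point.
  set χ : ℝ → ℂ := fun x => ((m : ℂ) ^ ⌈R - x⌉₊)⁻¹ * ψ (x + (⌈R - x⌉₊ : ℕ)) with hχdef
  set χ₁ : ℝ → ℂ := fun x => ((m : ℂ) ^ ⌈R - x⌉₊)⁻¹ * ψ₁ (x + (⌈R - x⌉₊ : ℕ)) with hχ₁def
  have hχ : ∀ (n : ℕ) x, R ≤ x + n → χ x = ((m : ℂ) ^ n)⁻¹ * ψ (x + n) ∧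
      χ₁ x = ((m : ℂ) ^ n)⁻¹ * ψ₁ (x + n) := by
    intro n x hx
    have hle : ⌈R - x⌉₊ ≤ n := Nat.ceil_le.2 (by linarith)
    obtain ⟨d, rfl⟩ := Nat.exists_eq_add_of_le hle
    have e := hpow d _ (hceil x)
    push_cast
    rw [← add_assoc, e.1, e.2, pow_add]
    simp only [hχdef, hχ₁def]
    constructor <;> field_simp
  -- No regularity of `W` is assumed: it is inherited from `V` far to the right and transported by
  -- periodicity.
  have hWc : Continuous W := by
    rw [continuous_iff_continuousAt]
    intro x
    obtain ⟨n, hn⟩ := exists_nat_gt (R - x)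
    have hev : ∀ᶠ t in 𝓝 x, R < t + n :=
      (continuous_add_const (n : ℝ)).continuousAt.eventually
        (lt_mem_nhds (by simp only; linarith))
    refine ((hV.comp (continuous_add_const (n : ℝ))).continuousAt).congr ?_
    filter_upwards [hev] with t ht
    rw [Function.comp_apply, hVW _ ht, hWn]
  have hsol : IsClassicalSolution W E χ χ₁ := by
    intro x
    obtain ⟨n, hn⟩ := exists_nat_gt (R - x)
    have hx : R < x + n := by linarith
    have hev : ∀ᶠ t in 𝓝 x, R < t + n :=
      (continuous_add_const (n : ℝ)).continuousAt.eventually (lt_mem_nhds hx)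
    have e1 : χ =ᶠ[𝓝 x] fun t => ((m : ℂ) ^ n)⁻¹ * ψ (t + n) := by
      filter_upwards [hev] with t ht
      exact (hχ n t ht.le).1
    have e2 : χ₁ =ᶠ[𝓝 x] fun t => ((m : ℂ) ^ n)⁻¹ * ψ₁ (t + n) := by
      filter_upwards [hev] with t ht
      exact (hχ n t ht.le).2
    constructor
    · refine HasDerivAt.congr_of_eventuallyEq ?_ e1
      rw [(hχ n x hx.le).2]
      exact ((hψ (x + n)).1.comp_add_const x n).const_mul _
    · refine HasDerivAt.congr_of_eventuallyEq ?_ e2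
      rw [(hχ n x hx.le).1, ← hWn n x, ← hVW _ hx]
      exact (((hψ (x + n)).2.comp_add_const x n).const_mul _).congr_deriv (by ring)
  refine ⟨χ, fun h0 => ?_, hsol.solvesSchrodinger hWc, fun x => ?_⟩
  · obtain ⟨x, hx, hx'⟩ := hne
    have := (hχ 0 x (by simpa using hx)).1
    rw [h0] at this
    simp at this
    exact hx' this.symm
  · have hn := hceil x
    set n := ⌈R - x⌉₊
    rw [(hχ n x hn).1, (hχ n (x + 1) (by linarith)).1, add_right_comm, (h _ hn).1]
    ring

/-! ### Dependence of solutions on the spectral parameter -/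

/-- For every `z`, `u z` and `v z` are classical solutions of `-w'' + V w = z w` with derivatives
`u₁ z` and `v₁ z` and Wronskian `1`; the initial data of `u z` do not depend on `z`. -/
structure IsSolutionFamily (V : ℝ → ℝ) (u u₁ v v₁ : ℂ → ℝ → ℂ) : Prop where
  left : ∀ z, IsClassicalSolution V z (u z) (u₁ z)
  right : ∀ z, IsClassicalSolution V z (v z) (v₁ z)
  apply_zero : ∀ z z', u z 0 = u z' 0
  deriv_zero : ∀ z z', u₁ z 0 = u₁ z' 0
  wronskian_zero : ∀ z, u z 0 * v₁ z 0 - u₁ z 0 * v z 0 = 1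

theorem norm_integral_mul_le {f g : ℝ → ℂ} {x X S P : ℝ} (hx : 0 ≤ x) (hxX : x ≤ X) (hS : 0 ≤ S)
    (hP : 0 ≤ P) (hf : ∀ t, 0 ≤ t → t ≤ X → ‖f t‖ ≤ S) (hg : ∀ t, 0 ≤ t → t ≤ X → ‖g t‖ ≤ P) :
    ‖∫ t in (0 : ℝ)..x, f t * g t‖ ≤ X * (S * P) := by
  have h := intervalIntegral.norm_integral_le_of_norm_le_const (a := 0) (b := x)
    (f := fun t => f t * g t) (C := S * P) fun t ht => by
      rw [uIoc_of_le hx] at ht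
      rw [norm_mul]
      exact mul_le_mul (hf t ht.1.le (ht.2.trans hxX)) (hg t ht.1.le (ht.2.trans hxX))
        (norm_nonneg _) hS
  rw [sub_zero, abs_of_nonneg hx] at h
  refine h.trans ?_
  rw [mul_comm]
  exact mul_le_mul_of_nonneg_right hxX (mul_nonneg hS hP)

namespace IsSolutionFamily

variable {V : ℝ → ℝ} {u u₁ v v₁ : ℂ → ℝ → ℂ}

theorem wronskian (h : IsSolutionFamily V u u₁ v v₁) (z : ℂ) (x : ℝ) :
    u z x * v₁ z x - u₁ z x * v z x = 1 :=
  ((h.left z).wronskian_const (h.right z) 0 x).trans (h.wronskian_zero z)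

/-- The coefficient of `u z₀` in the variation of constants formula for `u z`. -/
theorem wronskian_left (h : IsSolutionFamily V u u₁ v v₁) (z z₀ : ℂ) (x : ℝ) :
    u z x * v₁ z₀ x - u₁ z x * v z₀ x = 1 + (z - z₀) * ∫ t in (0 : ℝ)..x, u z t * v z₀ t := by
  have e := (h.left z).wronskian_sub (h.right z₀) 0 x
  rw [h.apply_zero z z₀, h.deriv_zero z z₀, h.wronskian_zero z₀] at e
  linear_combination e

theorem wronskian_right (h : IsSolutionFamily V u u₁ v v₁) (z z₀ : ℂ) (x : ℝ) :
    u z₀ x * u₁ z x - u₁ z₀ x * u z x = -((z - z₀) * ∫ t in (0 : ℝ)..x, u z t * u z₀ t) := by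
  have e := (h.left z).wronskian_sub (h.left z₀) 0 x
  rw [h.apply_zero z z₀, h.deriv_zero z z₀] at e
  linear_combination -e

/-- In the basis `u z₀`, `v z₀` the coefficients of `u z` are Wronskians, and these are integrals by
the Lagrange identity because the data at `0` do not depend on `z`. The formula is exact, with `u z`
on both sides; the size bounds, the analyticity in `z` and the expansion of the outgoing condition
all come from it. -/
theorem variation (h : IsSolutionFamily V u u₁ v v₁) (z z₀ : ℂ) (x : ℝ) :
    u z x = (1 + (z - z₀) * ∫ t in (0 : ℝ)..x, u z t * v z₀ t) * u z₀ x
      - ((z - z₀) * ∫ t in (0 : ℝ)..x, u z t * u z₀ t) * v z₀ x := by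
  have := h.wronskian_right z z₀ x
  rw [← h.wronskian_left]
  linear_combination (-u z x) * h.wronskian z₀ x + v z₀ x * this

theorem variation_deriv (h : IsSolutionFamily V u u₁ v v₁) (z z₀ : ℂ) (x : ℝ) :
    u₁ z x = (1 + (z - z₀) * ∫ t in (0 : ℝ)..x, u z t * v z₀ t) * u₁ z₀ x
      - ((z - z₀) * ∫ t in (0 : ℝ)..x, u z t * u z₀ t) * v₁ z₀ x := by
  have := h.wronskian_right z z₀ x
  rw [← h.wronskian_left]
  linear_combination (-u₁ z x) * h.wronskian z₀ x + v₁ z₀ x * this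

/-- If `S` is the maximum of `‖u z‖` on `[0, X]`, the variation formula gives `S ≤ P + 2 ‖z - z₀‖ X
P Q S ≤ P + S / 2`. -/
theorem norm_le_two_mul (h : IsSolutionFamily V u u₁ v v₁) {z z₀ : ℂ} {X P Q : ℝ} (hX : 0 ≤ X)
    (hP : ∀ t, 0 ≤ t → t ≤ X → ‖u z₀ t‖ ≤ P) (hQ : ∀ t, 0 ≤ t → t ≤ X → ‖v z₀ t‖ ≤ Q)
    (hz : 4 * (‖z - z₀‖ * X * P * Q) ≤ 1) : ∀ t, 0 ≤ t → t ≤ X → ‖u z t‖ ≤ 2 * P := by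
  have hP0 : 0 ≤ P := (norm_nonneg _).trans (hP 0 le_rfl hX)
  have hQ0 : 0 ≤ Q := (norm_nonneg _).trans (hQ 0 le_rfl hX)
  obtain ⟨p, hp, hmax⟩ := isCompact_Icc.exists_isMaxOn (nonempty_Icc.2 hX)
    ((h.left z).continuous.norm.continuousOn (s := Icc 0 X))
  set S := ‖u z p‖ with hS
  have hS0 : 0 ≤ S := norm_nonneg _
  have hm : ∀ t, 0 ≤ t → t ≤ X → ‖u z t‖ ≤ S := fun t h0 h1 => hmax ⟨h0, h1⟩
  have b1 := norm_integral_mul_le hp.1 hp.2 hS0 hQ0 hm hQ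
  have b2 := norm_integral_mul_le hp.1 hp.2 hS0 hP0 hm hP
  have key : S ≤ (1 + ‖z - z₀‖ * (X * (S * Q))) * P + ‖z - z₀‖ * (X * (S * P)) * Q := by
    rw [hS]
    nth_rewrite 1 [h.variation z z₀ p]
    refine (norm_sub_le _ _).trans (add_le_add ?_ ?_)
    · rw [norm_mul]
      refine mul_le_mul ((norm_add_le _ _).trans ?_) (hP p hp.1 hp.2) (norm_nonneg _)
        (by positivity)
      rw [norm_one, norm_mul]
      gcongr
    · rw [norm_mul, norm_mul]
      have := hQ p hp.1 hp.2
      gcongr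
  have : S ≤ 2 * P := by nlinarith [mul_le_mul_of_nonneg_right hz hS0]
  exact fun t h0 h1 => (hm t h0 h1).trans this

theorem norm_sub_le_of_bound (h : IsSolutionFamily V u u₁ v v₁) {z z₀ : ℂ} {X P Q : ℝ} (hX : 0 ≤ X)
    (hP : ∀ t, 0 ≤ t → t ≤ X → ‖u z₀ t‖ ≤ P) (hQ : ∀ t, 0 ≤ t → t ≤ X → ‖v z₀ t‖ ≤ Q)
    (hz : 4 * (‖z - z₀‖ * X * P * Q) ≤ 1) :
    ∀ t, 0 ≤ t → t ≤ X → ‖u z t - u z₀ t‖ ≤ 4 * (X * P * P * Q) * ‖z - z₀‖ := by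
  intro t h0 h1
  have hP0 : 0 ≤ P := (norm_nonneg _).trans (hP 0 le_rfl hX)
  have hQ0 : 0 ≤ Q := (norm_nonneg _).trans (hQ 0 le_rfl hX)
  have hm := h.norm_le_two_mul hX hP hQ hz
  have b1 := norm_integral_mul_le h0 h1 (by positivity) hQ0 hm hQ
  have b2 := norm_integral_mul_le h0 h1 (by positivity) hP0 hm hP
  have e : u z t - u z₀ t = (z - z₀) * ((∫ s in (0 : ℝ)..t, u z s * v z₀ s) * u z₀ t)
      - (z - z₀) * ((∫ s in (0 : ℝ)..t, u z s * u z₀ s) * v z₀ t) := by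
    rw [sub_eq_iff_eq_add]
    nth_rewrite 1 [h.variation z z₀ t]
    ring
  rw [e]
  refine (norm_sub_le _ _).trans ?_
  rw [norm_mul, norm_mul, norm_mul, norm_mul]
  have c1 := hP t h0 h1
  have c2 := hQ t h0 h1
  calc _ ≤ ‖z - z₀‖ * (X * (2 * P * Q) * P) + ‖z - z₀‖ * (X * (2 * P * P) * Q) := by gcongr
    _ = _ := by ring

theorem tendsto_integral_mul (h : IsSolutionFamily V u u₁ v v₁) (z₀ : ℂ) {x : ℝ} (hx : 0 ≤ x)
    {g : ℝ → ℂ} (hg : Continuous g) :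
    Tendsto (fun z => ∫ t in (0 : ℝ)..x, u z t * g t) (𝓝 z₀)
      (𝓝 (∫ t in (0 : ℝ)..x, u z₀ t * g t)) := by
  obtain ⟨P, hP⟩ := isCompact_Icc.exists_bound_of_continuousOn
    ((h.left z₀).continuous.continuousOn (s := Icc 0 x))
  obtain ⟨Q, hQ⟩ := isCompact_Icc.exists_bound_of_continuousOn
    ((h.right z₀).continuous.continuousOn (s := Icc 0 x))
  obtain ⟨G, hG⟩ := isCompact_Icc.exists_bound_of_continuousOn (hg.continuousOn (s := Icc 0 x))
  have hP0 : 0 ≤ P := (norm_nonneg _).trans (hP 0 ⟨le_rfl, hx⟩)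
  have hQ0 : 0 ≤ Q := (norm_nonneg _).trans (hQ 0 ⟨le_rfl, hx⟩)
  have hG0 : 0 ≤ G := (norm_nonneg _).trans (hG 0 ⟨le_rfl, hx⟩)
  have t0 : Tendsto (fun z => ‖z - z₀‖) (𝓝 z₀) (𝓝 0) := by
    have : Continuous fun z => ‖z - z₀‖ := by fun_prop
    simpa using this.tendsto z₀
  have t1 : Tendsto (fun z => 4 * (‖z - z₀‖ * x * P * Q)) (𝓝 z₀) (𝓝 0) := by
    simpa using (((t0.mul_const x).mul_const P).mul_const Q).const_mul 4
  rw [tendsto_iff_norm_sub_tendsto_zero]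
  refine squeeze_zero' (g := fun z => x * (4 * (x * P * P * Q) * ‖z - z₀‖ * G))
    (Eventually.of_forall fun z => norm_nonneg _) ?_ ?_
  · filter_upwards [t1.eventually (ge_mem_nhds zero_lt_one)] with z hz
    have hi : ∀ z, IntervalIntegrable (fun t => u z t * g t) volume 0 x := fun z =>
      ((h.left z).continuous.mul hg).intervalIntegrable _ _
    rw [← intervalIntegral.integral_sub (hi z) (hi z₀)]
    simp_rw [← sub_mul]
    exact norm_integral_mul_le hx le_rfl (by positivity) hG0
      (h.norm_sub_le_of_bound hx (fun t a b => hP t ⟨a, b⟩) (fun t a b => hQ t ⟨a, b⟩) hz)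
      fun t a b => hG t ⟨a, b⟩
  · simpa using ((t0.const_mul (4 * (x * P * P * Q))).mul_const G).const_mul x

/-- Here `g z₀` is the difference quotient at `z₀`. The variation formula supplies it explicitly, so
continuity of the integrals in `z` already yields that solutions are entire in the spectral
parameter. -/
theorem differentiable_of_factor {f : ℂ → ℂ} {g : ℂ → ℂ → ℂ}
    (hf : ∀ z₀ z, f z = f z₀ + (z - z₀) * g z₀ z)
    (hg : ∀ z₀, Tendsto (g z₀) (𝓝 z₀) (𝓝 (g z₀ z₀))) : Differentiable ℂ f := by
  intro z₀
  refine HasDerivAt.differentiableAt (f' := g z₀ z₀) ?_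
  rw [hasDerivAt_iff_tendsto_slope]
  refine ((hg z₀).mono_left nhdsWithin_le_nhds).congr' ?_
  filter_upwards [self_mem_nhdsWithin] with z hz
  have : z - z₀ ≠ 0 := sub_ne_zero.2 hz
  rw [slope_def_field, hf z₀ z]
  field_simp
  ring

theorem differentiable_apply (h : IsSolutionFamily V u u₁ v v₁) {x : ℝ} (hx : 0 ≤ x) :
    Differentiable ℂ fun z => u z x := by
  refine differentiable_of_factor
    (g := fun z₀ z => (∫ t in (0 : ℝ)..x, u z t * v z₀ t) * u z₀ x
      - (∫ t in (0 : ℝ)..x, u z t * u z₀ t) * v z₀ x) (fun z₀ z => ?_) fun z₀ => ?_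
  · rw [h.variation z z₀ x]
    ring
  · exact ((h.tendsto_integral_mul z₀ hx (h.right z₀).continuous).mul_const _).sub
      ((h.tendsto_integral_mul z₀ hx (h.left z₀).continuous).mul_const _)

theorem differentiable_deriv_apply (h : IsSolutionFamily V u u₁ v v₁) {x : ℝ} (hx : 0 ≤ x) :
    Differentiable ℂ fun z => u₁ z x := by
  refine differentiable_of_factor
    (g := fun z₀ z => (∫ t in (0 : ℝ)..x, u z t * v z₀ t) * u₁ z₀ x
      - (∫ t in (0 : ℝ)..x, u z t * u z₀ t) * v₁ z₀ x) (fun z₀ z => ?_) fun z₀ => ?_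
  · rw [h.variation_deriv z z₀ x]
    ring
  · exact ((h.tendsto_integral_mul z₀ hx (h.right z₀).continuous).mul_const _).sub
      ((h.tendsto_integral_mul z₀ hx (h.left z₀).continuous).mul_const _)

end IsSolutionFamily

/-! ### Gluing solutions across the edges of the truncated potential -/

theorem hasDerivAt_of_eq_left_right {F f g : ℝ → ℂ} {d : ℂ} {a : ℝ} (hf : HasDerivAt f d a)
    (hg : HasDerivAt g d a) (h1 : ∀ x, x ≤ a → F x = f x) (h2 : ∀ x, a ≤ x → F x = g x) :
    HasDerivAt F d a := by
  have l : HasDerivWithinAt F d (Iic a) a :=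
    hf.hasDerivWithinAt.congr (fun x hx => h1 x hx) (h1 a le_rfl)
  have r : HasDerivWithinAt F d (Ici a) a :=
    hg.hasDerivWithinAt.congr (fun x hx => h2 x hx) (h2 a le_rfl)
  have := l.union r
  rwa [Iic_union_Ici, hasDerivWithinAt_univ] at this

theorem hasDerivAt_ite_le {f g f' g' : ℝ → ℂ} {a : ℝ} (hf : ∀ x, HasDerivAt f (f' x) x)
    (hg : ∀ x, HasDerivAt g (g' x) x) (h : f a = g a) (h' : f' a = g' a) (x : ℝ) :
    HasDerivAt (fun x => if x ≤ a then f x else g x) (if x ≤ a then f' x else g' x) x := by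
  rcases lt_trichotomy x a with hx | rfl | hx
  · rw [if_pos hx.le]
    refine (hf x).congr_of_eventuallyEq ?_
    filter_upwards [Iio_mem_nhds hx] with t ht
    exact if_pos (le_of_lt ht)
  · rw [if_pos le_rfl]
    refine hasDerivAt_of_eq_left_right (hf x) (h' ▸ hg x) (fun t ht => if_pos ht) fun t ht => ?_
    rcases ht.eq_or_lt with rfl | ht
    · rw [if_pos le_rfl, h]
    · rw [if_neg (not_le.2 ht)]
  · rw [if_neg (not_le.2 hx)]
    refine (hg x).congr_of_eventuallyEq ?_
    filter_upwards [Ioi_mem_nhds hx] with t ht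
    exact if_neg (not_le.2 ht)

/-- The function equal to `w` on `[-M, M]`, to `h (x - M)` for `x > M`, and to `ε h (-x - M)` for
`x < -M`. -/
noncomputable def outerExtend (ε : ℂ) (M : ℝ) (w h : ℝ → ℂ) (x : ℝ) : ℂ :=
  if -x ≤ M then (if x ≤ M then w x else h (x - M)) else ε * h (-x - M)

section OuterExtend

variable {ε : ℂ} {M x : ℝ} {w w₁ h h₁ : ℝ → ℂ}

theorem outerExtend_of_gt (hM : 0 < M) (hx : M < x) : outerExtend ε M w h x = h (x - M) := by
  rw [outerExtend, if_pos (by linarith), if_neg (by linarith)]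

theorem outerExtend_of_lt (hx : x < -M) : outerExtend ε M w h x = ε * h (-x - M) := by
  rw [outerExtend, if_neg (by linarith)]

theorem outerExtend_of_mem (h1 : -M ≤ x) (h2 : x ≤ M) : outerExtend ε M w h x = w x := by
  rw [outerExtend, if_pos (by linarith), if_pos h2]

theorem outerExtend_neg (hM : 0 < M) (hε : ε * ε = 1) (hw : ∀ x, w (-x) = ε * w x) (x : ℝ) :
    outerExtend ε M w h (-x) = ε * outerExtend ε M w h x := by
  rcases lt_or_ge M x with h1 | h1
  · rw [outerExtend_of_gt hM h1, outerExtend_of_lt (by linarith), neg_neg]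
  rcases lt_or_ge x (-M) with h2 | h2
  · rw [outerExtend_of_lt h2, outerExtend_of_gt hM (by linarith), ← mul_assoc, hε, one_mul]
  · rw [outerExtend_of_mem h2 h1, outerExtend_of_mem (by linarith) (by linarith), hw]

/-- Differentiation reverses parity, hence `-ε` for the derivative. Matching is required only at
`M`; at `-M` it follows from the symmetry of the interior solution. -/
theorem hasDerivAt_outerExtend (hM : 0 < M) (hw : ∀ x, HasDerivAt w (w₁ x) x)
    (hh : ∀ x, HasDerivAt h (h₁ x) x) (hwε : ∀ x, w (-x) = ε * w x)
    (hw₁ε : ∀ x, w₁ (-x) = -ε * w₁ x) (h0 : h 0 = w M) (h0' : h₁ 0 = w₁ M) (x : ℝ) :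
    HasDerivAt (outerExtend ε M w h) (outerExtend (-ε) M w₁ h₁ x) x := by
  have hi := hasDerivAt_ite_le (a := M) hw (fun x => (hh (x - M)).comp_sub_const x M)
    (by simp [h0]) (by simp [h0'])
  have ho : ∀ x, HasDerivAt (fun x => ε * h (-x - M)) (-ε * h₁ (-x - M)) x := fun x =>
    (((hh (-x - M)).scomp x ((hasDerivAt_neg x).sub_const M)).const_mul ε).congr_deriv (by simp)
  rcases lt_trichotomy x (-M) with hx | rfl | hx
  · rw [outerExtend_of_lt hx]
    refine (ho x).congr_of_eventuallyEq ?_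
    filter_upwards [Iio_mem_nhds hx] with t ht
    exact outerExtend_of_lt ht
  · have e : outerExtend (-ε) M w₁ h₁ (-M) = -ε * h₁ (- -M - M) := by
      rw [outerExtend_of_mem le_rfl (by linarith), hw₁ε]
      simp [h0']
    have hi' := hi (-M)
    rw [if_pos (by linarith : -M ≤ M), hw₁ε] at hi'
    refine hasDerivAt_of_eq_left_right (e ▸ ho (-M))
      (hi'.congr_deriv (by rw [e]; simp [h0'])) (fun t ht => ?_) fun t ht => ?_
    · rcases ht.eq_or_lt with rfl | ht
      · rw [outerExtend_of_mem le_rfl (by linarith), hwε]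
        simp [h0]
      · exact outerExtend_of_lt ht
    · rw [outerExtend, if_pos (by linarith)]
  · have e : outerExtend (-ε) M w₁ h₁ x = if x ≤ M then w₁ x else h₁ (x - M) := by
      rw [outerExtend, if_pos (by linarith)]
    rw [e]
    refine (hi x).congr_of_eventuallyEq ?_
    filter_upwards [Ioi_mem_nhds hx] with t ht
    have ht' : -M < t := ht
    rw [outerExtend, if_pos (by linarith)]

theorem continuous_outerExtend (hM : 0 < M) (hw : Continuous w) (hh : Continuous h)
    (hwε : ∀ x, w (-x) = ε * w x) (h0 : h 0 = w M) : Continuous (outerExtend ε M w h) := by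
  refine Continuous.if_le ?_ (by fun_prop) continuous_neg continuous_const fun x hx => ?_
  · refine Continuous.if_le hw (by fun_prop) continuous_id continuous_const fun x hx => ?_
    rw [hx, sub_self, h0]
  · have : x = -M := by linarith
    rw [this, if_pos (by linarith), hwε]
    simp [h0]

end OuterExtend

theorem truncate_eq_indicator (V : ℝ → ℝ) (M : ℝ) :
    truncate V M = (Icc (-M) M).indicator V := by
  funext x
  simp only [truncate, indicator, mem_Icc, abs_le]

theorem intervalIntegrable_truncate {V : ℝ → ℝ} (hV : Continuous V) (M a b : ℝ) :
    IntervalIntegrable (fun x => (truncate V M x : ℂ)) volume a b := by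
  have : Integrable (truncate V M) := by
    rw [truncate_eq_indicator]
    exact (hV.integrableOn_Icc).integrable_indicator measurableSet_Icc
  exact this.ofReal.intervalIntegrable

theorem abs_truncate_le {V : ℝ → ℝ} {K : ℝ} (hK : ∀ x, |V x| ≤ K) (M x : ℝ) :
    |truncate V M x| ≤ K := by
  rw [truncate]
  split_ifs
  · exact hK x
  · rw [abs_zero]
    exact (abs_nonneg _).trans (hK 0)

/-- An interior solution glued to an exterior solution of `-h'' - z h = φ`. -/
theorem solvesSchrodinger_outerExtend {V : ℝ → ℝ} {z ε : ℂ} {M b : ℝ} {w w₁ h h₁ φ : ℝ → ℂ}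
    (hV : Continuous V) (hM : 0 < M) (hw : IsClassicalSolution V z w w₁)
    (hh : ∀ x, HasDerivAt h (h₁ x) x) (hh₁c : Continuous h₁)
    (hh₁ : ∀ y, 0 < y → y ≠ b → HasDerivAt h₁ (-z * h y - φ y) y)
    (hwε : ∀ x, w (-x) = ε * w x) (hw₁ε : ∀ x, w₁ (-x) = -ε * w₁ x)
    (h0 : h 0 = w M) (h0' : h₁ 0 = w₁ M)
    (hf : ∀ c d, IntervalIntegrable (outerExtend ε M 0 φ) volume c d) :
    SolvesSchrodinger (truncate V M) z (outerExtend ε M 0 φ) (outerExtend ε M w h) := by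
  have hd := hasDerivAt_outerExtend hM (fun x => (hw x).1) hh hwε hw₁ε h0 h0'
  have hcont : Continuous (outerExtend ε M w h) :=
    continuous_iff_continuousAt.2 fun x => (hd x).continuousAt
  -- The second derivative may fail only at the two edges `±M` and at `±(M + b)`, where the source
  -- is allowed to jump.
  refine solvesSchrodinger_of_hasDerivAt (s := {M, -M, M + b, -M - b}) (Set.toFinite _).countable
    hd (continuous_outerExtend hM hw.continuous' hh₁c hw₁ε h0') (fun c d => ?_) fun x hx => ?_
  · exact (((intervalIntegrable_truncate hV M c d).sub intervalIntegrable_const).mul_continuousOn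
      hcont.continuousOn).sub (hf c d)
  · simp only [mem_insert_iff, mem_singleton_iff, not_or] at hx
    obtain ⟨n1, n2, n3, n4⟩ := hx
    rcases lt_or_ge M x with h1 | h1
    · rw [outerExtend_of_gt hM h1, outerExtend_of_gt hM h1, truncate,
        if_neg (by rw [abs_le]; intro hc; linarith [hc.2]), Complex.ofReal_zero, zero_sub]
      have := (hh₁ (x - M) (by linarith) (fun h => n3 (by linarith))).comp_sub_const x M
      refine this.congr_of_eventuallyEq ?_
      filter_upwards [Ioi_mem_nhds h1] with t ht
      exact outerExtend_of_gt hM ht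
    rcases lt_or_ge x (-M) with h2 | h2
    · rw [outerExtend_of_lt h2, outerExtend_of_lt h2, truncate,
        if_neg (by rw [abs_le]; intro hc; linarith [hc.1]), Complex.ofReal_zero, zero_sub]
      have := ((hh₁ (-x - M) (by linarith) (fun h => n4 (by linarith))).scomp x
        ((hasDerivAt_neg x).sub_const M)).const_mul (-ε)
      refine HasDerivAt.congr_of_eventuallyEq (this.congr_deriv (by simp; ring)) ?_
      filter_upwards [Iio_mem_nhds h2] with t ht
      exact outerExtend_of_lt ht
    · have h1' : x < M := lt_of_le_of_ne h1 n1
      have h2' : -M < x := lt_of_le_of_ne h2 (Ne.symm n2)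
      rw [outerExtend_of_mem h2 h1, outerExtend_of_mem h2 h1, truncate, if_pos (abs_le.2 ⟨h2, h1⟩),
        Pi.zero_apply, sub_zero]
      refine (hw x).2.congr_of_eventuallyEq ?_
      filter_upwards [Ioo_mem_nhds h2' h1'] with t ht
      exact outerExtend_of_mem ht.1.le ht.2.le

theorem outerExtend_zero (ε : ℂ) (M : ℝ) : outerExtend ε M 0 0 = 0 := by
  funext x
  simp [outerExtend]

theorem hasDerivAt_exp_mul (a : ℂ) (x : ℝ) :
    HasDerivAt (fun x : ℝ => Complex.exp (a * x)) (a * Complex.exp (a * x)) x := by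
  have h := ((hasDerivAt_id x).ofReal_comp.const_mul a).cexp
  simpa [mul_comm] using h

/-! ### Resonant states -/

/-- The outgoing continuation of an interior solution. -/
noncomputable def outgoingState (ε ζ : ℂ) (M : ℝ) (w : ℝ → ℂ) : ℝ → ℂ :=
  outerExtend ε M w fun y => w M * Complex.exp (Complex.I * ζ * y)

theorem solvesSchrodinger_outgoingState {V : ℝ → ℝ} {ζ ε : ℂ} {M : ℝ} {w w₁ : ℝ → ℂ}
    (hV : Continuous V) (hM : 0 < M) (hw : IsClassicalSolution V (ζ ^ 2) w w₁)
    (hwε : ∀ x, w (-x) = ε * w x) (hw₁ε : ∀ x, w₁ (-x) = -ε * w₁ x)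
    (h0 : w₁ M = Complex.I * ζ * w M) :
    SolvesSchrodinger (truncate V M) (ζ ^ 2) 0 (outgoingState ε ζ M w) := by
  rw [← outerExtend_zero ε M]
  refine solvesSchrodinger_outerExtend (b := 0)
    (h₁ := fun y => w M * (Complex.I * ζ * Complex.exp (Complex.I * ζ * y))) hV hM hw
    (fun x => (hasDerivAt_exp_mul _ x).const_mul _) (by fun_prop) (fun y _ _ => ?_) hwε hw₁ε
    (by simp) (by simp [h0, mul_comm]) fun c d => ?_
  · refine (((hasDerivAt_exp_mul (Complex.I * ζ) y).const_mul (Complex.I * ζ)).const_mul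
      (w M)).congr_deriv ?_
    rw [Pi.zero_apply]
    linear_combination w M * ζ ^ 2 * Complex.exp (Complex.I * ζ * y) * Complex.I_sq
  · rw [outerExtend_zero]
    exact intervalIntegrable_const

theorem isResonantState_outgoingState {V : ℝ → ℝ} {z ε : ℂ} {M : ℝ} {w w₁ : ℝ → ℂ}
    (hV : Continuous V) (hM : 0 < M) (hw : IsClassicalSolution V z w w₁)
    (hz : csqrt z ^ 2 = z)
    (hwε : ∀ x, w (-x) = ε * w x) (hw₁ε : ∀ x, w₁ (-x) = -ε * w₁ x)
    (h0 : w₁ M = Complex.I * csqrt z * w M) (hne : w M ≠ 0) :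
    IsResonantState (truncate V M) z (outgoingState ε (csqrt z) M w) := by
  refine ⟨fun h => hne ?_, ?_, M, w M * Complex.exp (-(Complex.I * csqrt z * M)),
    ε * (w M * Complex.exp (-(Complex.I * csqrt z * M))), fun x hx => ?_, fun x hx => ?_⟩
  · have := congrFun h M
    rwa [outgoingState, outerExtend_of_mem (by linarith) le_rfl] at this
  · have := solvesSchrodinger_outgoingState hV hM (hz.symm ▸ hw) hwε hw₁ε h0
    rwa [hz] at this
  · rw [outgoingState, outerExtend_of_gt hM hx, mul_assoc (w M), ← Complex.exp_add]
    push_cast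
    ring_nf
  · rw [outgoingState, outerExtend_of_lt hx, mul_assoc ε, mul_assoc (w M), ← Complex.exp_add]
    push_cast
    ring_nf

/-- Far to the right both states are multiples of the same exponential, so a suitable combination
vanishes on a half-line and therefore everywhere. The outgoing condition on the right alone is
enough. -/
theorem IsResonantState.eq_const_mul_outgoingState {V : ℝ → ℝ} {z ε : ℂ} {M K : ℝ} {w : ℝ → ℂ}
    {Ψ : ℝ → ℂ} (hK : ∀ x, |V x| ≤ K) (hM : 0 < M) (hne : w M ≠ 0)
    (hΦ : SolvesSchrodinger (truncate V M) z 0 (outgoingState ε (csqrt z) M w))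
    (hΨ : IsResonantState (truncate V M) z Ψ) :
    ∃ c : ℂ, ∀ x, Ψ x = c * outgoingState ε (csqrt z) M w x := by
  obtain ⟨-, hs, R, a, -, ha, -⟩ := hΨ
  set c := a * Complex.exp (Complex.I * csqrt z * M) / w M with hc
  have hd := hs.sub_const_mul hΦ c
  have hout : ∀ x, max R M < x → Ψ x - c * outgoingState ε (csqrt z) M w x = 0 := by
    intro x hx
    rw [ha x ((le_max_left _ _).trans_lt hx), outgoingState,
      outerExtend_of_gt hM ((le_max_right _ _).trans_lt hx), hc]
    have e : Complex.exp (Complex.I * csqrt z * x) = Complex.exp (Complex.I * csqrt z * M) *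
        Complex.exp (Complex.I * csqrt z * ((x - M : ℝ) : ℂ)) := by
      rw [← Complex.exp_add]
      push_cast
      ring_nf
    rw [e]
    field_simp
    ring
  have hx0 : max R M < max R M + 1 := lt_add_one _
  refine ⟨c, fun x => sub_eq_zero.1 (hd.eq_zero (fun x => abs_truncate_le hK M x)
    (hout _ hx0) ?_ x)⟩
  have : (fun x => Ψ x - c * outgoingState ε (csqrt z) M w x) =ᶠ[𝓝 (max R M + 1)] fun _ => 0 := by
    filter_upwards [Ioi_mem_nhds hx0] with t ht
    exact hout t ht
  rw [this.deriv_eq, deriv_const]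

/-! ### Poles of the continued resolvent -/

theorem integrable_exp_neg_mul_abs {c : ℝ} (hc : 0 < c) :
    Integrable fun x : ℝ => Real.exp (-c * |x|) := by
  rw [← integrableOn_univ, ← Iic_union_Ioi (a := (0 : ℝ))]
  refine IntegrableOn.union ?_ ?_
  · refine (integrableOn_exp_mul_Iic hc 0).congr_fun (fun x hx => ?_) measurableSet_Iic
    simp only
    rw [abs_of_nonpos hx, neg_mul_neg]
  · refine (integrableOn_exp_mul_Ioi (neg_lt_zero.2 hc) 0).congr_fun (fun x hx => ?_)
      measurableSet_Ioi
    simp only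
    rw [abs_of_pos hx]

theorem memLp_two_of_exp_decay {W : ℝ → ℂ} {R C η : ℝ} (hW : Continuous W) (hη : 0 < η)
    (h : ∀ x, R < |x| → ‖W x‖ ≤ C * Real.exp (-η * |x|)) : MemLp W 2 volume := by
  obtain ⟨B, hB⟩ := isCompact_Icc.exists_bound_of_continuousOn (hW.continuousOn (s := Icc (-R) R))
  have hm : MemLp (fun x : ℝ => (|C| + |B| * Real.exp (η * R)) * Real.exp (-η * |x|)) 2 volume := by
    refine MemLp.const_mul ?_ _
    refine (memLp_two_iff_integrable_sq (by fun_prop)).2 ?_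
    refine (integrable_exp_neg_mul_abs (c := 2 * η) (by positivity)).congr
      (ae_of_all _ fun x => ?_)
    simp only
    rw [← Real.exp_nat_mul]
    push_cast
    ring_nf
  refine hm.mono' hW.aestronglyMeasurable (ae_of_all _ fun x => ?_)
  have hp := Real.exp_pos (-η * |x|)
  rcases lt_or_ge R |x| with hx | hx
  · refine (h x hx).trans (mul_le_mul_of_nonneg_right ?_ hp.le)
    have : 0 ≤ |B| * Real.exp (η * R) := by positivity
    linarith [le_abs_self C]
  · have h1 := (hB x (abs_le.1 hx)).trans (le_abs_self B)
    have h2 : 1 ≤ Real.exp (η * R) * Real.exp (-η * |x|) := by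
      rw [← Real.exp_add]
      exact Real.one_le_exp (by nlinarith)
    have h3 : |B| * 1 ≤ |B| * (Real.exp (η * R) * Real.exp (-η * |x|)) :=
      mul_le_mul_of_nonneg_left h2 (abs_nonneg B)
    have h4 : 0 ≤ |C| * Real.exp (-η * |x|) := by positivity
    linarith

/-- An interior solution cannot satisfy the outgoing condition in the first quadrant. -/
theorem IsClassicalSolution.ne_outgoing {V : ℝ → ℝ} {ζ : ℂ} {M : ℝ} {w w₁ : ℝ → ℂ}
    (h : IsClassicalSolution V (ζ ^ 2) w w₁) (hM : 0 < M) (hre : 0 < ζ.re) (him : 0 < ζ.im)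
    (h0 : w 0 * starRingEnd ℂ (w₁ 0) - w₁ 0 * starRingEnd ℂ (w 0) = 0)
    (hne : w M ≠ 0 ∨ w₁ M ≠ 0) : w₁ M - Complex.I * ζ * w M ≠ 0 := by
  intro hD
  have hD' : w₁ M = Complex.I * ζ * w M := sub_eq_zero.1 hD
  -- Flux identity: pairing `w` with its conjugate gives `-2i Re ζ |w(M)|² = 4i Re ζ Im ζ ∫ |w|²`.
  -- The signs are opposite, so `w(M) = 0`, and the outgoing condition then gives `w₁(M) = 0` as
  -- well.
  have e := h.wronskian_sub h.star 0 M
  rw [h0, hD'] at e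
  have e1 : ∫ t in (0 : ℝ)..M, w t * starRingEnd ℂ (w t)
      = ((∫ t in (0 : ℝ)..M, Complex.normSq (w t) : ℝ) : ℂ) := by
    rw [← intervalIntegral.integral_ofReal]
    simp only [Complex.mul_conj]
  have e2 : w M * starRingEnd ℂ (Complex.I * ζ * w M) - Complex.I * ζ * w M * starRingEnd ℂ (w M)
      = (Complex.normSq (w M) : ℂ) * (-2 * Complex.I * ζ.re) := by
    rw [← Complex.mul_conj, map_mul, map_mul, Complex.conj_I]
    have := Complex.add_conj ζ
    push_cast at this
    linear_combination (-Complex.I * w M * starRingEnd ℂ (w M)) * this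
  have e3 : ζ ^ 2 - starRingEnd ℂ (ζ ^ 2) = 4 * Complex.I * ζ.re * ζ.im := by
    conv_lhs => rw [← Complex.re_add_im ζ]
    simp only [map_pow, map_add, map_mul, Complex.conj_ofReal, Complex.conj_I]
    ring
  rw [e1, e2, e3] at e
  have hI : 0 ≤ ∫ t in (0 : ℝ)..M, Complex.normSq (w t) :=
    intervalIntegral.integral_nonneg hM.le fun t _ => Complex.normSq_nonneg _
  have e4 : ((Complex.normSq (w M) * ζ.re + 2 * ζ.re * ζ.im *
      ∫ t in (0 : ℝ)..M, Complex.normSq (w t) : ℝ) : ℂ) = 0 := by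
    push_cast
    have : (-2 * Complex.I : ℂ) ≠ 0 := by simp
    refine mul_left_cancel₀ this ?_
    linear_combination e
  have e5 := Complex.ofReal_eq_zero.1 e4
  have e6 : Complex.normSq (w M) * ζ.re ≤ 0 := by
    have : 0 ≤ 2 * ζ.re * ζ.im * ∫ t in (0 : ℝ)..M, Complex.normSq (w t) := by positivity
    linarith
  have e7 : w M = 0 := by
    have := Complex.normSq_nonneg (w M)
    exact Complex.normSq_eq_zero.1 (le_antisymm (by nlinarith) this)
  rcases hne with h | h
  · exact h e7
  · rw [hD', e7, mul_zero] at h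
    exact h rfl

/-! ### An explicit resolvent image for a source just outside the truncated potential -/

section ResolventImage

/-- The exterior part of the resolvent applied to the indicator function of a unit interval. -/
noncomputable def exteriorSolution (ζ α : ℂ) (y : ℝ) : ℂ :=
  if y ≤ 1 then α * Complex.exp (Complex.I * ζ * y)
    + Complex.exp (Complex.I * ζ) / (2 * ζ ^ 2) * Complex.exp (-(Complex.I * ζ) * y) - 1 / ζ ^ 2
  else (α * Complex.exp (Complex.I * ζ) - 1 / (2 * ζ ^ 2))
    * Complex.exp (Complex.I * ζ * ((y - 1 : ℝ) : ℂ))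

/-- The derivative of `exteriorSolution`. -/
noncomputable def exteriorSolutionDeriv (ζ α : ℂ) (y : ℝ) : ℂ :=
  if y ≤ 1 then Complex.I * ζ * (α * Complex.exp (Complex.I * ζ * y)
    - Complex.exp (Complex.I * ζ) / (2 * ζ ^ 2) * Complex.exp (-(Complex.I * ζ) * y))
  else Complex.I * ζ * ((α * Complex.exp (Complex.I * ζ) - 1 / (2 * ζ ^ 2))
    * Complex.exp (Complex.I * ζ * ((y - 1 : ℝ) : ℂ)))

variable {ζ α : ℂ}

theorem exp_mul_exp_neg_mul_one (κ : ℂ) :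
    Complex.exp κ * Complex.exp (-κ * ((1 : ℝ) : ℂ)) = 1 := by
  rw [← Complex.exp_add]
  simp

/-- The incoming coefficient `e^{iζ} / (2ζ²)` and the constant `-1 / (2ζ²)` are the ones for which
the two pieces match to first order at `y = 1`, leaving a purely outgoing wave beyond. The amplitude
`α` stays free, to be matched with the interior. -/
theorem hasDerivAt_exteriorSolution (hζ : ζ ≠ 0) (y : ℝ) :
    HasDerivAt (exteriorSolution ζ α) (exteriorSolutionDeriv ζ α y) y := by
  have hx := exp_mul_exp_neg_mul_one (Complex.I * ζ)
  refine hasDerivAt_ite_le (a := 1)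
    (f := fun y : ℝ => α * Complex.exp (Complex.I * ζ * y) + Complex.exp (Complex.I * ζ)
      / (2 * ζ ^ 2) * Complex.exp (-(Complex.I * ζ) * y) - 1 / ζ ^ 2)
    (g := fun y : ℝ => (α * Complex.exp (Complex.I * ζ) - 1 / (2 * ζ ^ 2))
      * Complex.exp (Complex.I * ζ * ((y - 1 : ℝ) : ℂ)))
    (f' := fun y : ℝ => Complex.I * ζ * (α * Complex.exp (Complex.I * ζ * y)
      - Complex.exp (Complex.I * ζ) / (2 * ζ ^ 2) * Complex.exp (-(Complex.I * ζ) * y)))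
    (g' := fun y : ℝ => Complex.I * ζ * ((α * Complex.exp (Complex.I * ζ) - 1 / (2 * ζ ^ 2))
      * Complex.exp (Complex.I * ζ * ((y - 1 : ℝ) : ℂ))))
    (fun y => ?_) (fun y => ?_) ?_ ?_ y
  · exact ((((hasDerivAt_exp_mul (Complex.I * ζ) y).const_mul α).add
      ((hasDerivAt_exp_mul (-(Complex.I * ζ)) y).const_mul _)).sub_const _).congr_deriv (by ring)
  · exact (((hasDerivAt_exp_mul (Complex.I * ζ) (y - 1)).comp_sub_const y 1).const_mul
      _).congr_deriv (by ring)
  · rw [div_mul_eq_mul_div, hx]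
    simp
    field_simp
    ring
  · rw [div_mul_eq_mul_div, hx]
    simp

theorem continuous_exteriorSolutionDeriv : Continuous (exteriorSolutionDeriv ζ α) := by
  refine Continuous.if_le (by fun_prop) (by fun_prop) continuous_id continuous_const fun y hy => ?_
  have hx := exp_mul_exp_neg_mul_one (Complex.I * ζ)
  have hy' : y = 1 := hy
  rw [hy', div_mul_eq_mul_div, hx]
  simp

theorem hasDerivAt_exteriorSolutionDeriv (hζ : ζ ≠ 0) {y : ℝ} (hy : y ≠ 1) :
    HasDerivAt (exteriorSolutionDeriv ζ α)
      (-ζ ^ 2 * exteriorSolution ζ α y - if y ≤ 1 then 1 else 0) y := by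
  rcases lt_or_gt_of_ne hy with h | h
  · have d : HasDerivAt (fun y : ℝ => Complex.I * ζ * (α * Complex.exp (Complex.I * ζ * y)
        - Complex.exp (Complex.I * ζ) / (2 * ζ ^ 2) * Complex.exp (-(Complex.I * ζ) * y))) _ y :=
      (((hasDerivAt_exp_mul (Complex.I * ζ) y).const_mul α).sub
        ((hasDerivAt_exp_mul (-(Complex.I * ζ)) y).const_mul _)).const_mul _
    refine HasDerivAt.congr_of_eventuallyEq (d.congr_deriv ?_) ?_
    · rw [exteriorSolution, if_pos h.le, if_pos h.le]
      field_simp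
      linear_combination (2 * ζ ^ 2 * α * Complex.exp (Complex.I * ζ * y) + Complex.exp
        (Complex.I * ζ) * Complex.exp (-(Complex.I * ζ * y))) * Complex.I_sq
    · filter_upwards [Iio_mem_nhds h] with t ht
      exact if_pos (le_of_lt ht)
  · have d : HasDerivAt (fun y : ℝ => Complex.I * ζ * ((α * Complex.exp (Complex.I * ζ)
        - 1 / (2 * ζ ^ 2)) * Complex.exp (Complex.I * ζ * ((y - 1 : ℝ) : ℂ)))) _ y :=
      (((hasDerivAt_exp_mul (Complex.I * ζ) (y - 1)).comp_sub_const y 1).const_mul _).const_mul _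
    refine HasDerivAt.congr_of_eventuallyEq (d.congr_deriv ?_) ?_
    · rw [exteriorSolution, if_neg (not_le.2 h), if_neg (not_le.2 h)]
      linear_combination ζ ^ 2 * (α * Complex.exp (Complex.I * ζ) - 1 / (2 * ζ ^ 2))
        * Complex.exp (Complex.I * ζ * ((y - 1 : ℝ) : ℂ)) * Complex.I_sq
    · filter_upwards [Ioi_mem_nhds h] with t ht
      exact if_neg (not_le.2 ht)

theorem integral_exteriorSolution (hζ : ζ ≠ 0) :
    ∫ y in (0 : ℝ)..1, exteriorSolution ζ α y
      = α * ((Complex.exp (Complex.I * ζ) - 1) / (Complex.I * ζ))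
        + (Complex.exp (Complex.I * ζ) - 1) / (2 * ζ ^ 2 * (Complex.I * ζ)) - 1 / ζ ^ 2 := by
  have hκ : Complex.I * ζ ≠ 0 := mul_ne_zero Complex.I_ne_zero hζ
  have e : ∫ y in (0 : ℝ)..1, exteriorSolution ζ α y = ∫ y in (0 : ℝ)..1,
      ((α * Complex.exp (Complex.I * ζ * y) + Complex.exp (Complex.I * ζ) / (2 * ζ ^ 2) *
        Complex.exp (-(Complex.I * ζ) * y)) - 1 / ζ ^ 2) := by
    refine intervalIntegral.integral_congr fun y hy => ?_
    rw [uIcc_of_le zero_le_one] at hy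
    exact if_pos hy.2
  have c1 : Continuous fun y : ℝ => α * Complex.exp (Complex.I * ζ * y) := by fun_prop
  have c2 : Continuous fun y : ℝ => Complex.exp (Complex.I * ζ) / (2 * ζ ^ 2) *
        Complex.exp (-(Complex.I * ζ) * y) := by fun_prop
  have c3 : Continuous fun y : ℝ => α * Complex.exp (Complex.I * ζ * y) +
      Complex.exp (Complex.I * ζ) / (2 * ζ ^ 2) * Complex.exp (-(Complex.I * ζ) * y) := c1.add c2
  rw [e, intervalIntegral.integral_sub (c3.intervalIntegrable _ _)
    intervalIntegrable_const, intervalIntegral.integral_add (c1.intervalIntegrable _ _)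
    (c2.intervalIntegrable _ _), intervalIntegral.integral_const_mul,
    intervalIntegral.integral_const_mul, integral_exp_mul_complex hκ,
    integral_exp_mul_complex (neg_ne_zero.2 hκ), intervalIntegral.integral_const]
  have hx := exp_mul_exp_neg_mul_one (Complex.I * ζ)
  have hx' : Complex.exp (Complex.I * ζ) / (2 * ζ ^ 2) *
      ((Complex.exp (-(Complex.I * ζ) * ((1 : ℝ) : ℂ))
        - Complex.exp (-(Complex.I * ζ) * ((0 : ℝ) : ℂ))) / -(Complex.I * ζ))
      = (Complex.exp (Complex.I * ζ) - 1) / (2 * ζ ^ 2 * (Complex.I * ζ)) := by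
    rw [div_mul_div_comm, mul_sub, hx]
    simp
    rw [div_neg, ← neg_div, neg_sub]
  rw [hx']
  simp

theorem norm_exteriorSolution_of_one_lt {y : ℝ} (hy : 1 < y) :
    ‖exteriorSolution ζ α y‖ = ‖α * Complex.exp (Complex.I * ζ) - 1 / (2 * ζ ^ 2)‖
      * Real.exp (-ζ.im * (y - 1)) := by
  rw [exteriorSolution, if_neg (not_le.2 hy), norm_mul, Complex.norm_exp]
  congr 2
  simp

/-- The source term of the resolvent matrix element. -/
theorem outerExtend_indicator (ε : ℂ) {M : ℝ} (hM : 0 < M) :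
    outerExtend ε M 0 (fun y => if y ≤ 1 then 1 else 0)
      = fun x => (Ioc M (M + 1)).indicator (fun _ => (1 : ℂ)) x
        + (Ico (-M - 1) (-M)).indicator (fun _ => ε) x := by
  funext x
  rcases lt_or_ge M x with h1 | h1
  · rw [outerExtend_of_gt hM h1, indicator_of_notMem (s := Ico _ _) (fun h => by linarith [h.2]),
      add_zero]
    simp only [indicator, mem_Ioc, h1, true_and, sub_le_iff_le_add, add_comm]
  rcases lt_or_ge x (-M) with h2 | h2
  · rw [outerExtend_of_lt h2, indicator_of_notMem (s := Ioc _ _) (fun h => by linarith [h.1]),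
      zero_add]
    have : -x - M ≤ 1 ↔ -M - 1 ≤ x := by constructor <;> intro <;> linarith
    simp only [indicator, mem_Ico, h2, and_true, this, mul_ite, mul_one, mul_zero]
  · rw [outerExtend_of_mem h2 h1, indicator_of_notMem (fun h => by linarith [h.1]),
      indicator_of_notMem (fun h => by linarith [h.2])]
    simp

/-- Matching value and derivative at the edge is a linear system for `c` and `α`. Eliminating `α`
gives `c (w₁(M) - iζ w(M)) = (e^{iζ} - 1) / (iζ)`, so the outgoing defect appears as the denominator
of `c`. -/
theorem isResolventImage_outerExtend {V : ℝ → ℝ} {ε c : ℂ} {M : ℝ} {w w₁ : ℝ → ℂ}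
    (hV : Continuous V) (hM : 0 < M) (hζ : ζ ≠ 0) (him : 0 < ζ.im)
    (hw : IsClassicalSolution V (ζ ^ 2) w w₁)
    (hwε : ∀ x, w (-x) = ε * w x) (hw₁ε : ∀ x, w₁ (-x) = -ε * w₁ x)
    (hD : w₁ M - Complex.I * ζ * w M ≠ 0)
    (hc : c = (Complex.exp (Complex.I * ζ) - 1) / (Complex.I * ζ) / (w₁ M - Complex.I * ζ * w M))
    (hα : α = c * w M - Complex.exp (Complex.I * ζ) / (2 * ζ ^ 2) + 1 / ζ ^ 2) :
    IsResolventImage (truncate V M) (ζ ^ 2)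
      (outerExtend ε M 0 fun y => if y ≤ 1 then 1 else 0)
      (outerExtend ε M (fun x => c * w x) (exteriorSolution ζ α)) := by
  have hcε : ∀ x, c * w (-x) = ε * (c * w x) := fun x => by rw [hwε]; ring
  have hcε' : ∀ x, c * w₁ (-x) = -ε * (c * w₁ x) := fun x => by rw [hw₁ε]; ring
  have h0 : exteriorSolution ζ α 0 = c * w M := by
    rw [exteriorSolution, if_pos zero_le_one, hα]
    simp only [Complex.ofReal_zero, mul_zero, Complex.exp_zero, mul_one]
    ring
  have h0' : exteriorSolutionDeriv ζ α 0 = c * w₁ M := by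
    have hcD : c * (w₁ M - Complex.I * ζ * w M)
        = (Complex.exp (Complex.I * ζ) - 1) / (Complex.I * ζ) := by
      rw [hc]
      field_simp
    have e : (Complex.exp (Complex.I * ζ) - 1) / (Complex.I * ζ)
        = Complex.I * ζ * (1 / ζ ^ 2 - Complex.exp (Complex.I * ζ) / ζ ^ 2) := by
      have := Complex.I_ne_zero
      field_simp
      linear_combination (Complex.exp (Complex.I * ζ) - 1) * Complex.I_sq
    rw [exteriorSolutionDeriv, if_pos zero_le_one, hα]
    rw [e] at hcD
    simp only [Complex.ofReal_zero, mul_zero, Complex.exp_zero, mul_one]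
    linear_combination -hcD
  have hsol := solvesSchrodinger_outerExtend (φ := fun y => if y ≤ 1 then 1 else 0) (b := 1) hV hM
    (hw.const_mul c) (hasDerivAt_exteriorSolution hζ) continuous_exteriorSolutionDeriv
    (fun y _ hy => hasDerivAt_exteriorSolutionDeriv hζ hy) hcε hcε' h0 h0' (fun a b => by
      rw [outerExtend_indicator ε hM]
      exact (((integrable_indicator_iff measurableSet_Ioc).2 (by simp)).add
        ((integrable_indicator_iff measurableSet_Ico).2 (by simp))).intervalIntegrable)
  refine ⟨?_, hsol⟩
  refine memLp_two_of_exp_decay (R := M + 1) (C := (1 + ‖ε‖) *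
    (‖α * Complex.exp (Complex.I * ζ) - 1 / (2 * ζ ^ 2)‖ * Real.exp (ζ.im * (M + 1))))
    hsol.1.continuous him fun x hx => ?_
  have key : ∀ y, 1 < y - M → ‖exteriorSolution ζ α (y - M)‖ =
      ‖α * Complex.exp (Complex.I * ζ) - 1 / (2 * ζ ^ 2)‖ * Real.exp (ζ.im * (M + 1))
        * Real.exp (-ζ.im * y) := fun y hy => by
    rw [norm_exteriorSolution_of_one_lt hy, mul_assoc, ← Real.exp_add]
    ring_nf
  rw [mul_assoc]
  rcases lt_or_ge 0 x with h | h
  · rw [abs_of_pos h] at hx ⊢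
    rw [outerExtend_of_gt hM (by linarith), key x (by linarith)]
    refine le_mul_of_one_le_left (by positivity) ?_
    linarith [norm_nonneg ε]
  · rw [abs_of_nonpos h] at hx ⊢
    rw [outerExtend_of_lt (by linarith), norm_mul, key (-x) (by linarith)]
    refine mul_le_mul_of_nonneg_right ?_ (by positivity)
    linarith [norm_nonneg ε]

end ResolventImage

/-- Zeros of `u₁(ζ², M) - i ζ u(ζ², M)` in the lower half-plane are poles of the resolvent. -/
theorem IsSolutionFamily.isResolventPole {V : ℝ → ℝ} {u u₁ v v₁ : ℂ → ℝ → ℂ} {ε ζ₀ : ℂ} {M : ℝ}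
    (h : IsSolutionFamily V u u₁ v v₁) (hV : Continuous V) (hM : 0 < M)
    (huε : ∀ z x, u z (-x) = ε * u z x) (hu₁ε : ∀ z x, u₁ z (-x) = -ε * u₁ z x)
    (h0 : ∀ z, u z 0 * starRingEnd ℂ (u₁ z 0) - u₁ z 0 * starRingEnd ℂ (u z 0) = 0)
    (him : ζ₀.im < 0) (hz : u₁ (ζ₀ ^ 2) M - Complex.I * ζ₀ * u (ζ₀ ^ 2) M = 0) :
    IsResolventPole (truncate V M) ζ₀ := by
  have hne : ∀ z, u z M ≠ 0 ∨ u₁ z M ≠ 0 := by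
    intro z
    by_contra hcon
    push Not at hcon
    have := h.wronskian z M
    rw [hcon.1, hcon.2] at this
    simp at this
  have hζ₀ : ζ₀ ≠ 0 := by
    rintro rfl
    simp at him
  -- The matrix element will be `J² p / D + G`: one factor `J` comes from the amplitude `J / D` of
  -- the interior solution, the other from integrating the outgoing wave over the unit interval
  -- carrying the test function. `G` collects the terms free of `D`.
  set p : ℂ → ℂ := fun ζ => u (ζ ^ 2) M with hp
  set D : ℂ → ℂ := fun ζ => u₁ (ζ ^ 2) M - Complex.I * ζ * u (ζ ^ 2) M with hD
  set J : ℂ → ℂ := fun ζ => (Complex.exp (Complex.I * ζ) - 1) / (Complex.I * ζ) with hJ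
  set B : ℂ → ℂ := fun ζ => Complex.exp (Complex.I * ζ) / (2 * ζ ^ 2) with hB
  set G : ℂ → ℂ := fun ζ => (1 / ζ ^ 2 - B ζ) * J ζ
    + (Complex.exp (Complex.I * ζ) - 1) / (2 * ζ ^ 2 * (Complex.I * ζ)) - 1 / ζ ^ 2 with hG
  have hpd : Differentiable ℂ p := (h.differentiable_apply hM.le).comp (differentiable_id.pow 2)
  have hDd : Differentiable ℂ D :=
    ((h.differentiable_deriv_apply hM.le).comp (differentiable_id.pow 2)).sub
      ((differentiable_id.const_mul _).mul hpd)
  have hDa : AnalyticOnNhd ℂ D univ := fun ζ _ => hDd.analyticAt ζ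
  have hpm : MeromorphicOn p univ := fun ζ _ => (hpd.analyticAt ζ).meromorphicAt
  have hDm : MeromorphicOn D univ := fun ζ _ => (hDa ζ trivial).meromorphicAt
  have hEa : ∀ ζ, AnalyticAt ℂ (fun ζ => Complex.exp (Complex.I * ζ)) ζ := fun ζ => by fun_prop
  have hJm : MeromorphicOn J univ := fun ζ _ => by
    have := (hEa ζ).meromorphicAt
    fun_prop
  have hGm : MeromorphicOn G univ := fun ζ _ => by
    have := (hEa ζ).meromorphicAt
    have := hJm ζ trivial
    fun_prop
  have hFm : MeromorphicOn (fun ζ => J ζ ^ 2 * p ζ / D ζ + G ζ) univ := fun ζ _ => by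
    have := hpm ζ trivial
    have := hDm ζ trivial
    have := hJm ζ trivial
    have := hGm ζ trivial
    fun_prop
  have hfL : ∀ s : Set ℝ, MeasurableSet s → volume s ≠ ⊤ → ∀ c : ℂ,
      MemLp (s.indicator fun _ => c) 2 volume := fun s hs hs' c =>
    memLp_indicator_const 2 hs c (Or.inr hs')
  refine ⟨outerExtend ε M 0 fun y => if y ≤ 1 then 1 else 0,
    (Ioc M (M + 1)).indicator fun _ => 1, ?_, ?_,
    hfL _ measurableSet_Ioc (by simp) _, ?_, fun ζ => J ζ ^ 2 * p ζ / D ζ + G ζ,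
    ⟨hFm, fun ζ hre him => ?_⟩, ?_⟩
  · rw [outerExtend_indicator ε hM]
    exact (hfL _ measurableSet_Ioc (by simp) _).add (hfL _ measurableSet_Ico (by simp) _)
  · rw [outerExtend_indicator ε hM]
    refine HasCompactSupport.intro (isCompact_Icc (a := -M - 1) (b := M + 1)) fun x hx => ?_
    rw [indicator_of_notMem fun hx' => hx ⟨by linarith [hx'.1], hx'.2⟩,
      indicator_of_notMem fun hx' => hx ⟨hx'.1, by linarith [hx'.2]⟩, add_zero]
  · exact HasCompactSupport.intro (isCompact_Icc (a := M) (b := M + 1)) fun x hx =>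
      indicator_of_notMem (fun hx' => hx ⟨hx'.1.le, hx'.2⟩) _
  · have hζ : ζ ≠ 0 := by
      rintro rfl
      simp at hre
    have hDζ : D ζ ≠ 0 := (h.left (ζ ^ 2)).ne_outgoing hM hre him (h0 _) (hne _)
    refine ⟨_, isResolventImage_outerExtend hV hM hζ him (h.left (ζ ^ 2)) (huε _) (hu₁ε _) hDζ
      rfl rfl, ?_⟩
    have e1 : ∀ W : ℝ → ℂ, ∫ x, (Ioc M (M + 1)).indicator (fun _ => (1 : ℂ)) x * W x
        = ∫ x in M..M + 1, W x := fun W => by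
      rw [intervalIntegral.integral_of_le (by linarith), ← integral_indicator measurableSet_Ioc]
      congr 1
      funext x
      by_cases hx : x ∈ Ioc M (M + 1) <;> simp [hx]
    rw [e1]
    set α := J ζ / D ζ * u (ζ ^ 2) M - B ζ + 1 / ζ ^ 2 with hα
    have e2 : ∫ x in M..M + 1, outerExtend ε M (fun x => J ζ / D ζ * u (ζ ^ 2) x)
        (exteriorSolution ζ α) x = ∫ x in M..M + 1, exteriorSolution ζ α (x - M) := by
      refine intervalIntegral.integral_congr_ae (ae_of_all _ fun x hx => ?_)
      rw [uIoc_of_le (by linarith)] at hx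
      exact outerExtend_of_gt hM hx.1
    refine Eq.trans ?_ e2.symm
    rw [intervalIntegral.integral_comp_sub_right (fun x => exteriorSolution ζ α x), sub_self,
      add_sub_cancel_left, integral_exteriorSolution hζ]
    simp only [hG, hα, hp]
    ring
  -- Without a pole the matrix element has a finite limit `L`, so `J² p = (element - G) D` tends to
  -- `0` at `ζ₀`. But `J(ζ₀) ≠ 0` because `|e^{iζ₀}| ≠ 1` below the real axis, and `p(ζ₀) ≠ 0`
  -- because otherwise the solution would have zero Cauchy data at `M`.
  · by_contra hord
    push Not at hord
    obtain ⟨L, hL⟩ := tendsto_nhds_of_meromorphicOrderAt_nonneg (hFm ζ₀ trivial) hord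
    have hexp : Complex.exp (Complex.I * ζ₀) ≠ 1 := fun hcon => by
      have := congrArg norm hcon
      rw [Complex.norm_exp, norm_one, Real.exp_eq_one_iff] at this
      simp at this
      exact him.ne this
    have hJ0 : J ζ₀ ≠ 0 :=
      div_ne_zero (sub_ne_zero.2 hexp) (mul_ne_zero Complex.I_ne_zero hζ₀)
    have hp0 : p ζ₀ ≠ 0 := fun hcon => by
      rcases hne (ζ₀ ^ 2) with h1 | h1
      · exact h1 hcon
      · have hcon' : u (ζ₀ ^ 2) M = 0 := hcon
        rw [hcon', mul_zero, sub_zero] at hz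
        exact h1 hz
    have hIζ : Complex.I * ζ₀ ≠ 0 := mul_ne_zero Complex.I_ne_zero hζ₀
    have hJc : ContinuousAt J ζ₀ := by fun_prop (disch := assumption)
    have hζ2 : 2 * ζ₀ ^ 2 ≠ 0 := by simpa using hζ₀
    have hζ3 : ζ₀ ^ 2 ≠ 0 := by simpa using hζ₀
    have hζ4 : 2 * ζ₀ ^ 2 * (Complex.I * ζ₀) ≠ 0 := mul_ne_zero hζ2 hIζ
    have hGc : ContinuousAt G ζ₀ := by fun_prop (disch := assumption)
    -- `D` is not identically zero, since it does not vanish in the first quadrant, for instance at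
    -- `1 + i`; hence its zeros are isolated.
    have hDne : ∀ᶠ ζ in 𝓝[≠] ζ₀, D ζ ≠ 0 := by
      refine (hDa ζ₀ trivial).eventually_eq_zero_or_eventually_ne_zero.resolve_left fun hcon => ?_
      have := hDa.eqOn_zero_of_preconnected_of_eventuallyEq_zero isPreconnected_univ
        (mem_univ ζ₀) hcon (mem_univ (1 + Complex.I))
      exact (h.left _).ne_outgoing hM (by simp) (by simp) (h0 _) (hne _) this
    have tD : Tendsto D (𝓝[≠] ζ₀) (𝓝 0) := by
      have := (hDd.continuous.tendsto ζ₀).mono_left (nhdsWithin_le_nhds (s := {ζ₀}ᶜ))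
      rwa [show D ζ₀ = 0 from hz] at this
    have tJ := hJc.tendsto.mono_left (nhdsWithin_le_nhds (s := {ζ₀}ᶜ))
    have tG := hGc.tendsto.mono_left (nhdsWithin_le_nhds (s := {ζ₀}ᶜ))
    have tp := (hpd.continuous.tendsto ζ₀).mono_left (nhdsWithin_le_nhds (s := {ζ₀}ᶜ))
    have t1 := ((hL.sub tG).mul tD)
    have t2 := (tJ.pow 2).mul tp
    have t3 : Tendsto (fun ζ => J ζ ^ 2 * p ζ) (𝓝[≠] ζ₀) (𝓝 ((L - G ζ₀) * 0)) := by
      refine t1.congr' ?_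
      filter_upwards [hDne] with ζ hζ
      field_simp
      ring
    have := tendsto_nhds_unique t2 t3
    rw [mul_zero] at this
    exact mul_ne_zero (pow_ne_zero 2 hJ0) hp0 this

/-! ### Solutions exponentially close to the energy of the bound state -/

theorem tendsto_exp_neg_mul {k : ℝ} (hk : 0 < k) :
    Tendsto (fun M => Real.exp (-(k * M))) atTop (𝓝 0) :=
  Real.tendsto_exp_neg_atTop_nhds_zero.comp (tendsto_id.const_mul_atTop hk)

theorem tendsto_mul_exp_neg_mul {k : ℝ} (hk : 0 < k) :
    Tendsto (fun M => M * Real.exp (-(k * M))) atTop (𝓝 0) := by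
  have := tendsto_rpow_mul_exp_neg_mul_atTop_nhds_zero 1 k hk
  simpa using this

theorem integral_exp_neg_mul_le {k : ℝ} (hk : 0 < k) (x : ℝ) :
    ∫ t in (0 : ℝ)..x, Real.exp (-(k * t)) ≤ 1 / k := by
  have hd : ∀ t ∈ uIcc 0 x, HasDerivAt (fun t => -(Real.exp (-(k * t)) / k))
      (Real.exp (-(k * t))) t := fun t _ =>
    ((((hasDerivAt_id t).const_mul k).neg.exp.div_const k).neg).congr_deriv (by
      simp only [id]
      field_simp
      rfl)
  rw [intervalIntegral.integral_eq_sub_of_hasDerivAt hd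
    ((by fun_prop : Continuous fun t => Real.exp (-(k * t))).intervalIntegrable _ _)]
  have := div_nonneg (Real.exp_pos (-(k * x))).le hk.le
  simp only [mul_zero, neg_zero, Real.exp_zero]
  linarith

theorem norm_integral_mul_le_of_decay {f g : ℝ → ℂ} {C k X S x : ℝ} (hk : 0 < k) (hC : 0 < C)
    (hg : ∀ x, 0 ≤ x → ‖g x‖ ≤ C * Real.exp (-(k * x))) (hS : 0 ≤ S)
    (hf : ∀ x, 0 ≤ x → x ≤ X → ‖f x‖ ≤ S) (hx : 0 ≤ x) (hxX : x ≤ X) :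
    ‖∫ t in (0 : ℝ)..x, f t * g t‖ ≤ S * C / k := by
  have hc : Continuous fun t => S * C * Real.exp (-(k * t)) := by fun_prop
  refine (intervalIntegral.norm_integral_le_of_norm_le hx (ae_of_all _ fun t ht => ?_)
    (hc.intervalIntegrable _ _)).trans ?_
  · rw [norm_mul, mul_assoc]
    exact mul_le_mul (hf t ht.1.le (ht.2.trans hxX)) (hg t ht.1.le) (norm_nonneg _) hS
  · rw [intervalIntegral.integral_const_mul, div_eq_mul_one_div]
    exact mul_le_mul_of_nonneg_left (integral_exp_neg_mul_le hk x) (by positivity)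

namespace IsSolutionFamily

variable {V : ℝ → ℝ} {u u₁ v v₁ : ℂ → ℝ → ℂ} {z₀ : ℂ} {C k : ℝ}

/-- Uniform bounds for solutions at distance `O(e^{-2kM})` from `z₀`. -/
theorem exists_amplitude_bounds (h : IsSolutionFamily V u u₁ v v₁) (hk : 0 < k) (hC : 0 < C)
    (hu : ∀ x, 0 ≤ x → ‖u z₀ x‖ ≤ C * Real.exp (-(k * x)))
    (hv : ∀ x, 0 ≤ x → ‖v z₀ x‖ ≤ C * Real.exp (k * x)) (Λ : ℝ) (hΛ : 0 < Λ) :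
    ∃ K, 0 < K ∧ ∀ᶠ M in atTop, ∀ z, ‖z - z₀‖ ≤ Λ * Real.exp (-(k * M)) ^ 2 →
      ‖∫ t in (0 : ℝ)..M, u z t * v z₀ t‖ ≤ K * M ∧
      ‖(∫ t in (0 : ℝ)..M, u z t * u z₀ t) - ∫ t in (0 : ℝ)..M, u z₀ t * u z₀ t‖
        ≤ K * M * ‖z - z₀‖ := by
  set C3 := 2 * C + 2 * C ^ 3 * Λ / k with hC3
  have hC3p : 0 < C3 := by positivity
  have hsmall : ∀ᶠ M in atTop, M * Real.exp (-(k * M)) < 1 / (4 * Λ * C ^ 2) :=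
    (tendsto_mul_exp_neg_mul hk).eventually (gt_mem_nhds (by positivity))
  refine ⟨C3 * C + C3 * C ^ 3 / k + 2 * C ^ 4 / k, by positivity, ?_⟩
  filter_upwards [hsmall, eventually_ge_atTop 1] with M hM hM1 z hz
  have hM0 : 0 ≤ M := by linarith
  set q := Real.exp (-(k * M)) with hq
  have hq0 : 0 < q := Real.exp_pos _
  have hqinv : Real.exp (k * M) = q⁻¹ := by rw [hq, Real.exp_neg, inv_inv]
  set δ := ‖z - z₀‖ with hδ
  have hδ0 : 0 ≤ δ := norm_nonneg _
  -- Since `‖z - z₀‖` is `O(q²)` and `v z₀` is `O(q⁻¹)` on `[0, M]`, the smallness needed for the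
  -- crude bound `‖u z‖ ≤ 2C` reduces to that of `M q`.
  have hMδ : 4 * (δ * M * C * (C * q⁻¹)) ≤ 1 := by
    rw [lt_div_iff₀ (by positivity)] at hM
    calc 4 * (δ * M * C * (C * q⁻¹)) ≤ 4 * (Λ * q ^ 2 * M * C * (C * q⁻¹)) := by gcongr
      _ = M * q * (4 * Λ * C ^ 2) := by field_simp
      _ ≤ 1 := hM.le
  have exp_le : ∀ {t}, 0 ≤ t → Real.exp (-(k * t)) ≤ 1 := fun ht =>
    Real.exp_le_one_iff.2 (neg_nonpos.2 (mul_nonneg hk.le ht))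
  have hP : ∀ t, 0 ≤ t → t ≤ M → ‖u z₀ t‖ ≤ C := fun t h0 _ =>
    (hu t h0).trans (mul_le_of_le_one_right hC.le (exp_le h0))
  have hQ : ∀ t, 0 ≤ t → t ≤ M → ‖v z₀ t‖ ≤ C * q⁻¹ := fun t h0 h1 =>
    (hv t h0).trans (mul_le_mul_of_nonneg_left (by
      rw [← hqinv]
      exact Real.exp_le_exp.2 (mul_le_mul_of_nonneg_left h1 hk.le)) hC.le)
  have hQ0 : 0 ≤ C * q⁻¹ := by positivity
  have hz2 := h.norm_le_two_mul hM0 hP hQ hMδ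
  have hB : ∀ t, 0 ≤ t → t ≤ M → ‖∫ s in (0 : ℝ)..t, u z s * u z₀ s‖ ≤ 2 * C ^ 2 / k :=
    fun t h0 h1 => (norm_integral_mul_le_of_decay hk hC hu (by positivity) hz2 h0 h1).trans
      (le_of_eq (by ring))
  -- Bootstrap: the crude bound is fed back into the variation formula. The growing term carries `q²
  -- e^{kt}`, which is at most `e^{-kt}` for `t ≤ M`, so `u z` inherits the decay of `u z₀` on the
  -- whole interval. This makes `∫ u_z v_{z₀}` only `O(M)`.
  have hz3 : ∀ t, 0 ≤ t → t ≤ M → ‖u z t‖ ≤ C3 * Real.exp (-(k * t)) := by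
    intro t h0 h1
    have b1 := norm_integral_mul_le h0 h1 (by positivity) hQ0 hz2 hQ
    have b2 := hB t h0 h1
    have hqt : q ^ 2 * Real.exp (k * t) ≤ Real.exp (-(k * t)) := by
      rw [hq, ← Real.exp_nat_mul, ← Real.exp_add]
      refine Real.exp_le_exp.2 ?_
      push_cast
      nlinarith
    have e1 : 1 + δ * (M * (2 * C * (C * q⁻¹))) ≤ 2 := by nlinarith
    rw [h.variation z z₀ t]
    refine (norm_sub_le _ _).trans ?_
    rw [norm_mul, norm_mul, norm_mul]
    calc _ ≤ (1 + δ * (M * (2 * C * (C * q⁻¹)))) * (C * Real.exp (-(k * t)))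
          + Λ * q ^ 2 * (2 * C ^ 2 / k) * (C * Real.exp (k * t)) := by
            refine add_le_add (mul_le_mul ((norm_add_le _ _).trans ?_) (hu t h0) (norm_nonneg _)
              (by positivity)) (mul_le_mul (mul_le_mul hz b2 (norm_nonneg _) (by positivity))
                (hv t h0) (norm_nonneg _) (by positivity))
            rw [norm_one, norm_mul]
            gcongr
      _ ≤ 2 * (C * Real.exp (-(k * t)))
          + 2 * C ^ 3 * Λ / k * (q ^ 2 * Real.exp (k * t)) :=
            add_le_add (mul_le_mul_of_nonneg_right e1 (by positivity)) (le_of_eq (by ring))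
      _ ≤ 2 * (C * Real.exp (-(k * t))) + 2 * C ^ 3 * Λ / k * Real.exp (-(k * t)) := by gcongr
      _ = _ := by rw [hC3]; ring
  have hA : ∀ t, 0 ≤ t → t ≤ M → ‖∫ s in (0 : ℝ)..t, u z s * v z₀ s‖ ≤ C3 * C * M := by
    intro t h0 h1
    have := intervalIntegral.norm_integral_le_of_norm_le_const (a := 0) (b := t)
      (f := fun s => u z s * v z₀ s) (C := C3 * C) fun s hs => by
        rw [uIoc_of_le h0] at hs
        rw [norm_mul]
        refine (mul_le_mul (hz3 s hs.1.le (hs.2.trans h1)) (hv s hs.1.le) (norm_nonneg _)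
          (by positivity)).trans (le_of_eq ?_)
        rw [mul_mul_mul_comm, ← Real.exp_add, neg_add_cancel, Real.exp_zero, mul_one]
    rw [sub_zero, abs_of_nonneg h0] at this
    exact this.trans (mul_le_mul_of_nonneg_left h1 (by positivity))
  have pos1 : 0 ≤ C3 * C ^ 3 / k + 2 * C ^ 4 / k := by positivity
  refine ⟨(hA M hM0 le_rfl).trans (mul_le_mul_of_nonneg_right (by linarith) hM0), ?_⟩
  have hi : ∀ z, IntervalIntegrable (fun t => u z t * u z₀ t) volume 0 M := fun z =>
    ((h.left z).continuous.mul (h.left z₀).continuous).intervalIntegrable _ _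
  rw [← intervalIntegral.integral_sub (hi z) (hi z₀)]
  have hc1 : Continuous fun t => δ * (C3 * C ^ 3 * M) * Real.exp (-(k * t)) := by fun_prop
  have hc2 : Continuous fun t => δ * (C3 * C ^ 3 * M) * Real.exp (-(k * t))
    + δ * (2 * C ^ 4 / k) := by fun_prop
  refine (intervalIntegral.norm_integral_le_of_norm_le hM0 (g := fun t =>
    δ * (C3 * C ^ 3 * M) * Real.exp (-(k * t)) + δ * (2 * C ^ 4 / k))
    (ae_of_all _ fun t ht => ?_) (hc2.intervalIntegrable _ _)).trans ?_
  · have h0 := ht.1.le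
    have e : u z t * u z₀ t - u z₀ t * u z₀ t
        = (z - z₀) * (∫ s in (0 : ℝ)..t, u z s * v z₀ s) * (u z₀ t * u z₀ t)
        - (z - z₀) * (∫ s in (0 : ℝ)..t, u z s * u z₀ s) * (v z₀ t * u z₀ t) := by
      nth_rewrite 1 [h.variation z z₀ t]
      ring
    rw [e]
    refine (norm_sub_le _ _).trans ?_
    simp only [norm_mul]
    rw [← hδ]
    have b1 := hA t h0 ht.2
    have b2 := hB t h0 ht.2
    have b3 : ‖u z₀ t‖ * ‖u z₀ t‖ ≤ C * (C * Real.exp (-(k * t))) :=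
      mul_le_mul (hP t h0 ht.2) (hu t h0) (norm_nonneg _) hC.le
    have b4 : ‖v z₀ t‖ * ‖u z₀ t‖ ≤ C * C := by
      refine (mul_le_mul (hv t h0) (hu t h0) (norm_nonneg _) (by positivity)).trans (le_of_eq ?_)
      rw [mul_mul_mul_comm, ← Real.exp_add, add_neg_cancel, Real.exp_zero, mul_one]
    calc _ ≤ δ * (C3 * C * M) * (C * (C * Real.exp (-(k * t))))
          + δ * (2 * C ^ 2 / k) * (C * C) :=
            add_le_add (mul_le_mul (mul_le_mul_of_nonneg_left b1 hδ0) b3 (by positivity)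
              (by positivity)) (mul_le_mul (mul_le_mul_of_nonneg_left b2 hδ0) b4 (by positivity)
              (by positivity))
      _ = _ := by ring
  · rw [intervalIntegral.integral_add (hc1.intervalIntegrable _ _) intervalIntegrable_const,
      intervalIntegral.integral_const_mul, intervalIntegral.integral_const, smul_eq_mul, sub_zero]
    have := integral_exp_neg_mul_le hk M
    calc _ ≤ δ * (C3 * C ^ 3 * M) * (1 / k) + M * (δ * (2 * C ^ 4 / k)) := by gcongr
      _ = (C3 * C ^ 3 / k + 2 * C ^ 4 / k) * M * δ := by ring
      _ ≤ _ := by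
        refine mul_le_mul_of_nonneg_right (mul_le_mul_of_nonneg_right ?_ hM0) hδ0
        have : 0 ≤ C3 * C := by positivity
        linarith

end IsSolutionFamily

/-! ### The principal square root near a positive number -/

theorem csqrt_sq (z : ℂ) : csqrt z ^ 2 = z := by
  rw [csqrt, ← Complex.cpow_nat_mul]
  simp

theorem csqrt_ofReal {E : ℝ} (hE : 0 ≤ E) : csqrt E = (Real.sqrt E : ℂ) := by
  rw [csqrt, Real.sqrt_eq_rpow, Complex.ofReal_cpow hE]
  simp

theorem csqrt_re_pos {z : ℂ} (hz : 0 < z.re) : 0 < (csqrt z).re := by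
  have h0 : z ≠ 0 := by
    rintro rfl
    simp at hz
  have harg := Complex.abs_arg_lt_pi_div_two_iff.2 (Or.inl hz)
  rw [csqrt, Complex.cpow_def_of_ne_zero h0, Complex.exp_re]
  refine mul_pos (Real.exp_pos _) (Real.cos_pos_of_mem_Ioo ?_)
  have e : (Complex.log z * (1 / 2)).im = z.arg / 2 := by
    have : (1 / 2 : ℂ) = ((1 / 2 : ℝ) : ℂ) := by push_cast; ring
    rw [this, Complex.im_mul_ofReal, Complex.log_im]
    ring
  rw [e]
  have := abs_lt.1 harg
  constructor <;> linarith [Real.pi_pos]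

theorem csqrt_im_neg {z : ℂ} (hz : 0 < z.re) (hz' : z.im < 0) : (csqrt z).im < 0 := by
  have h1 := csqrt_re_pos hz
  have h2 := congrArg Complex.im (csqrt_sq z)
  rw [sq, Complex.mul_im] at h2
  by_contra hcon
  push Not at hcon
  nlinarith [mul_nonneg h1.le hcon]

/-- Factor `z - E = (√z - √E)(√z + √E)`; the second factor has modulus at least `√E` because `Re √z
> 0`. -/
theorem norm_csqrt_sub_le {E : ℝ} (hE : 0 < E) {z : ℂ} (hz : 0 < z.re) :
    ‖csqrt z - Real.sqrt E‖ ≤ ‖z - E‖ / Real.sqrt E := by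
  have hs : 0 < Real.sqrt E := Real.sqrt_pos.2 hE
  rw [le_div_iff₀ hs]
  have e : z - E = (csqrt z - Real.sqrt E) * (csqrt z + Real.sqrt E) := by
    have h1 := csqrt_sq z
    have h2 : (Real.sqrt E : ℂ) ^ 2 = E := by exact_mod_cast Real.sq_sqrt hE.le
    linear_combination h2 - h1
  rw [e, norm_mul]
  refine mul_le_mul_of_nonneg_left ?_ (norm_nonneg _)
  have h3 := Complex.re_le_norm (csqrt z + Real.sqrt E)
  rw [Complex.add_re, Complex.ofReal_re] at h3
  linarith [csqrt_re_pos hz]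

theorem differentiableAt_csqrt {z : ℂ} (hz : 0 < z.re) : DifferentiableAt ℂ csqrt z :=
  differentiableAt_id.cpow_const (Or.inl hz)

/-! ### Existence and asymptotics of the resonance -/

theorem norm_le_norm_ofReal_sub_I_mul (a b s : ℝ) :
    |a| ≤ ‖(a : ℂ) - Complex.I * s * b‖ ∧ |s * b| ≤ ‖(a : ℂ) - Complex.I * s * b‖ := by
  have h1 := Complex.abs_re_le_norm ((a : ℂ) - Complex.I * s * b)
  have h2 := Complex.abs_im_le_norm ((a : ℂ) - Complex.I * s * b)
  simp only [Complex.sub_re, Complex.sub_im, Complex.mul_re, Complex.mul_im, Complex.I_re,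
    Complex.I_im, Complex.ofReal_re, Complex.ofReal_im, zero_mul, one_mul, mul_zero, sub_zero,
    zero_sub, zero_add, abs_neg] at h1 h2
  exact ⟨h1, h2⟩

/-- Lower bound on the outgoing defect of the growing solution. -/
theorem le_norm_growing {a a₁ b b₁ C q s : ℝ} (hs : 0 < s) (hC : 0 < C) (hq : 0 < q)
    (ha : |a| ≤ C * q) (ha₁ : |a₁| ≤ C * q) (hW : a * b₁ - a₁ * b = 1) :
    1 / (C * (1 + 1 / s)) * q⁻¹ ≤ ‖(b₁ : ℂ) - Complex.I * s * b‖ := by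
  obtain ⟨h1, h2⟩ := norm_le_norm_ofReal_sub_I_mul b₁ b s
  set D := ‖(b₁ : ℂ) - Complex.I * s * b‖
  rw [abs_mul, abs_of_pos hs] at h2
  have h3 : |b| ≤ D / s := by
    rw [le_div_iff₀ hs]
    linarith
  have hD : 0 ≤ D := norm_nonneg _
  -- With `a`, `a₁` of size `q`, Wronskian `1` forces `b` or `b₁` to be of size `q⁻¹`. Since `b`,
  -- `b₁` are real they are read off from the imaginary and real parts of the defect, so no
  -- cancellation can occur.
  have h4 : (1 : ℝ) ≤ C * q * D + C * q * (D / s) := by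
    calc (1 : ℝ) = |a * b₁ - a₁ * b| := by rw [hW, abs_one]
      _ ≤ |a| * |b₁| + |a₁| * |b| := (abs_sub _ _).trans (by rw [abs_mul, abs_mul])
      _ ≤ _ := add_le_add (mul_le_mul ha h1 (abs_nonneg _) (by positivity))
        (mul_le_mul ha₁ h3 (abs_nonneg _) (by positivity))
  rw [one_div, ← mul_inv, inv_le_iff_one_le_mul₀ (by positivity)]
  calc (1 : ℝ) ≤ _ := h4
    _ = _ := by ring

theorem norm_sub_I_mul_le {a b s : ℂ} {P S : ℝ} (ha : ‖a‖ ≤ P) (hb : ‖b‖ ≤ P) (hs : ‖s‖ ≤ S) :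
    ‖a - Complex.I * s * b‖ ≤ P * (1 + S) := by
  refine (norm_sub_le _ _).trans ?_
  rw [norm_mul, norm_mul, Complex.norm_I, one_mul]
  have := mul_le_mul hs hb (norm_nonneg _) ((norm_nonneg _).trans hs)
  linarith

theorem sub_le_norm_sub {x y : ℂ} {a b : ℝ} (hx : ‖x‖ ≤ a) (hy : b ≤ ‖y‖) : b - a ≤ ‖x - y‖ := by
  have := norm_sub_norm_le y x
  rw [norm_sub_rev] at this
  linarith

namespace IsSolutionFamily

variable {V : ℝ → ℝ} {u u₁ v v₁ : ℂ → ℝ → ℂ} {E C k : ℝ}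

/-- Supplies a bound uniform in `M`, namely the integral over `[0, 1]`. It is positive because a
solution vanishing on an interval would have Wronskian `0`. -/
theorem exists_integral_sq_lower_bound (h : IsSolutionFamily V u u₁ v v₁)
    (hur : ∀ x, ∃ r : ℝ, u E x = r) :
    ∃ I₁ : ℝ, 0 < I₁ ∧ ∀ M, 1 ≤ M →
      ∃ I : ℝ, I₁ ≤ I ∧ ∫ t in (0 : ℝ)..M, u E t * u E t = I := by
  choose r hr using hur
  have hrc : Continuous r := by
    have : r = fun x => (u E x).re := funext fun x => by rw [hr, Complex.ofReal_re]
    rw [this]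
    exact Complex.continuous_re.comp (h.left E).continuous
  have hr2 : Continuous fun t => r t * r t := hrc.mul hrc
  have hne : ∃ c ∈ Icc (0 : ℝ) 1, 0 < r c * r c := by
    by_contra hcon
    push Not at hcon
    have hz : ∀ c ∈ Icc (0 : ℝ) 1, r c = 0 := fun c hc =>
      mul_self_eq_zero.1 (le_antisymm (hcon c hc) (mul_self_nonneg _))
    have hev : u E =ᶠ[𝓝 (1 / 2)] fun _ => 0 := by
      filter_upwards [Icc_mem_nhds (a := (0 : ℝ)) (b := 1) (by norm_num) (by norm_num)] with t ht
      rw [hr, hz t ht, Complex.ofReal_zero]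
    have h1 : u₁ E (1 / 2) = 0 := by
      rw [← ((h.left E) (1 / 2)).1.deriv, hev.deriv_eq, deriv_const]
    have := h.wronskian E (1 / 2)
    rw [h1, hev.self_of_nhds] at this
    simp at this
  refine ⟨∫ t in (0 : ℝ)..1, r t * r t, intervalIntegral.integral_pos zero_lt_one hr2.continuousOn
    (fun t _ => mul_self_nonneg _) hne, fun M hM => ⟨∫ t in (0 : ℝ)..M, r t * r t,
    intervalIntegral.integral_mono_interval le_rfl zero_le_one hM
      (ae_of_all _ fun t => mul_self_nonneg _) (hr2.intervalIntegrable _ _), ?_⟩⟩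
  rw [← intervalIntegral.integral_ofReal]
  simp only [hr, Complex.ofReal_mul]

set_option maxHeartbeats 1000000 in
/-- For large `M` there is an energy close to `E` whose solution is outgoing at `M`, and it is
given by the first Newton step up to `O(M e^{-4kM})`. -/
theorem exists_outgoing (h : IsSolutionFamily V u u₁ v v₁) (hE : 0 < E) (hk : 0 < k) (hC : 0 < C)
    (hu : ∀ x, 0 ≤ x → ‖u E x‖ ≤ C * Real.exp (-(k * x)))
    (hu₁ : ∀ x, 0 ≤ x → ‖u₁ E x‖ ≤ C * Real.exp (-(k * x)))
    (hv : ∀ x, 0 ≤ x → ‖v E x‖ ≤ C * Real.exp (k * x))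
    (hv₁ : ∀ x, 0 ≤ x → ‖v₁ E x‖ ≤ C * Real.exp (k * x))
    (hur : ∀ x, ∃ r : ℝ, u E x = r) (hu₁r : ∀ x, ∃ r : ℝ, u₁ E x = r)
    (hvr : ∀ x, ∃ r : ℝ, v E x = r) (hv₁r : ∀ x, ∃ r : ℝ, v₁ E x = r) :
    ∃ K, 0 < K ∧ ∀ᶠ M in atTop, ∃ z : ℂ, ‖z - E‖ ≤ K * Real.exp (-(k * M)) ^ 2 ∧ 0 < z.re ∧
      u₁ z M - Complex.I * csqrt z * u z M = 0 ∧
      ‖(z - E) - (u₁ E M - Complex.I * (Real.sqrt E : ℂ) * u E M) /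
        ((v₁ E M - Complex.I * (Real.sqrt E : ℂ) * v E M) * ∫ t in (0 : ℝ)..M, u E t * u E t)‖
        ≤ K * (M * Real.exp (-(k * M)) ^ 4) := by
  obtain ⟨I₁, hI₁, hI⟩ := h.exists_integral_sq_lower_bound hur
  set s₀ := Real.sqrt E with hs₀
  have hs : 0 < s₀ := Real.sqrt_pos.2 hE
  set c₁ := 1 / (C * (1 + 1 / s₀)) with hc₁
  have hc₁p : 0 < c₁ := by positivity
  set C₅ := C * (1 + (s₀ + 1 / s₀)) with hC₅
  have hC₅p : 0 < C₅ := by positivity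
  -- On the disc, `|∫ u_z u_E| |D(z)| ≥ (I₁ / 2)(c₁ / 2) q⁻¹ = 2κ q⁻¹`; one half of this is given up
  -- to the remaining terms of `F(z) - F(E)`.
  set κ := I₁ * c₁ / 8 with hκ
  have hκp : 0 < κ := by positivity
  -- The disc has radius `Λ q²`. Its image contains a ball of radius `Λ κ q / 2` about `F(E)`, and
  -- `Λ κ = 2 C₅ + 1` makes this exceed `C₅ q ≥ |F(E)|`. There is no circularity: `Λ` is fixed
  -- before the constant `K₀` that depends on it.
  set Λ := (2 * C₅ + 1) / κ with hΛ
  have hΛp : 0 < Λ := by positivity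
  obtain ⟨K₀, hK₀, hamp⟩ := h.exists_amplitude_bounds hk hC hu hv Λ hΛp
  have tq : Tendsto (fun M => Real.exp (-(k * M)) ^ 2) atTop (𝓝 0) := by
    simpa using (tendsto_exp_neg_mul hk).pow 2
  have tMq : Tendsto (fun M => M * Real.exp (-(k * M)) ^ 2) atTop (𝓝 0) := by
    have := (tendsto_mul_exp_neg_mul hk).mul (tendsto_exp_neg_mul hk)
    rw [mul_zero] at this
    refine this.congr fun M => by ring
  have ev1 := (tq.const_mul Λ).eventually_le_const (u := 1) (by simp)
  have ev2 := (tq.const_mul Λ).eventually_lt_const (u := E) (by simpa)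
  have ev3 := ((tq.const_mul Λ).mul_const (C / s₀)).eventually_le_const (u := c₁ / 2)
    (by simpa using hc₁p)
  have ev4 := (tMq.const_mul (K₀ * Λ)).eventually_le_const (u := I₁ / 2) (by simpa using hI₁)
  have ev5 := ((tMq.const_mul (K₀ * C₅)).add (tq.const_mul (C / s₀))).eventually_le_const (u := κ)
    (by simpa using hκp)
  set K₇ := Λ * (Λ * C * (C * C / k) / s₀ + C₅ * K₀ * Λ) + Λ * K₀ * C₅ + Λ * C / s₀ with hK₇
  have hK₇p : 0 < K₇ := by positivity
  refine ⟨Λ + K₇ / (c₁ * I₁), by positivity, ?_⟩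
  filter_upwards [hamp, ev1, ev2, ev3, ev4, ev5, eventually_ge_atTop 1] with M hamp h1 h2 h3 h4 h5 hM
  have hM0 : 0 ≤ M := by linarith
  obtain ⟨I, hII, hIe⟩ := hI M hM
  have hIp : 0 < I := hI₁.trans_le hII
  set q := Real.exp (-(k * M)) with hq
  have hq0 : 0 < q := Real.exp_pos _
  have hqinv : Real.exp (k * M) = q⁻¹ := by rw [hq, Real.exp_neg, inv_inv]
  have bu := hu M hM0
  have bu₁ := hu₁ M hM0
  have bv := hv M hM0
  have bv₁ := hv₁ M hM0
  rw [hqinv] at bv bv₁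
  set D₀ := v₁ E M - Complex.I * (s₀ : ℂ) * v E M with hD₀
  set N₀ := u₁ E M - Complex.I * (s₀ : ℂ) * u E M with hN₀
  have lD₀ : c₁ * q⁻¹ ≤ ‖D₀‖ := by
    obtain ⟨a, ha⟩ := hur M
    obtain ⟨a₁, ha₁⟩ := hu₁r M
    obtain ⟨b, hb⟩ := hvr M
    obtain ⟨b₁, hb₁⟩ := hv₁r M
    have hW := h.wronskian E M
    rw [hD₀, hb, hb₁]
    rw [ha, ha₁, hb, hb₁] at hW
    rw [ha, Complex.norm_real, Real.norm_eq_abs] at bu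
    rw [ha₁, Complex.norm_real, Real.norm_eq_abs] at bu₁
    exact le_norm_growing hs hC hq0 bu bu₁ (by exact_mod_cast hW)
  -- estimates in the disc of radius `Λ q²`
  have hre : ∀ z : ℂ, ‖z - E‖ ≤ Λ * q ^ 2 → 0 < z.re := fun z hz => by
    have := (Complex.abs_re_le_norm (z - E)).trans_lt (hz.trans_lt h2)
    rw [Complex.sub_re, Complex.ofReal_re] at this
    linarith [(abs_lt.1 this).1]
  have hcs : ∀ z : ℂ, ‖z - E‖ ≤ Λ * q ^ 2 → ‖csqrt z - s₀‖ ≤ ‖z - E‖ / s₀ := fun z hz =>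
    norm_csqrt_sub_le hE (hre z hz)
  have hsn : ∀ z : ℂ, ‖z - E‖ ≤ Λ * q ^ 2 → ‖csqrt z‖ ≤ s₀ + 1 / s₀ := fun z hz => by
    have e1 := hcs z hz
    have e2 : ‖z - E‖ / s₀ ≤ 1 / s₀ := div_le_div_of_nonneg_right (hz.trans h1) hs.le
    have e3 : ‖csqrt z‖ ≤ ‖(s₀ : ℂ)‖ + ‖csqrt z - s₀‖ := by
      have := norm_add_le (s₀ : ℂ) (csqrt z - s₀)
      rwa [add_sub_cancel] at this
    rw [Complex.norm_real, Real.norm_of_nonneg hs.le] at e3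
    linarith
  have uN : ∀ z : ℂ, ‖z - E‖ ≤ Λ * q ^ 2 → ‖u₁ E M - Complex.I * csqrt z * u E M‖ ≤ C₅ * q :=
    fun z hz => (norm_sub_I_mul_le bu₁ bu (hsn z hz)).trans (le_of_eq (by rw [hC₅]; ring))
  have uD : ∀ z : ℂ, ‖z - E‖ ≤ Λ * q ^ 2 → ‖v₁ E M - Complex.I * csqrt z * v E M‖ ≤ C₅ * q⁻¹ :=
    fun z hz => (norm_sub_I_mul_le bv₁ bv (hsn z hz)).trans (le_of_eq (by rw [hC₅]; ring))
  have dN : ∀ z : ℂ, ‖z - E‖ ≤ Λ * q ^ 2 →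
      ‖u₁ E M - Complex.I * csqrt z * u E M - N₀‖ ≤ ‖z - E‖ * (C / s₀ * q) := fun z hz => by
    have e : u₁ E M - Complex.I * csqrt z * u E M - N₀
        = -Complex.I * (csqrt z - s₀) * u E M := by rw [hN₀]; ring
    rw [e, norm_mul, norm_mul, norm_neg, Complex.norm_I, one_mul]
    refine (mul_le_mul (hcs z hz) bu (norm_nonneg _) (by positivity)).trans (le_of_eq (by ring))
  have dD : ∀ z : ℂ, ‖z - E‖ ≤ Λ * q ^ 2 →
      ‖v₁ E M - Complex.I * csqrt z * v E M - D₀‖ ≤ ‖z - E‖ * (C / s₀ * q⁻¹) := fun z hz => by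
    have e : v₁ E M - Complex.I * csqrt z * v E M - D₀
        = -Complex.I * (csqrt z - s₀) * v E M := by rw [hD₀]; ring
    rw [e, norm_mul, norm_mul, norm_neg, Complex.norm_I, one_mul]
    refine (mul_le_mul (hcs z hz) bv (norm_nonneg _) (by positivity)).trans (le_of_eq (by ring))
  have lD : ∀ z : ℂ, ‖z - E‖ ≤ Λ * q ^ 2 →
      c₁ / 2 * q⁻¹ ≤ ‖v₁ E M - Complex.I * csqrt z * v E M‖ := fun z hz => by
    have e1 := dD z hz
    have e2 : ‖z - E‖ * (C / s₀ * q⁻¹) ≤ c₁ / 2 * q⁻¹ := by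
      rw [← mul_assoc]
      exact mul_le_mul_of_nonneg_right ((mul_le_mul_of_nonneg_right hz (by positivity)).trans h3)
        (by positivity)
    have e3 := norm_sub_norm_le D₀ (v₁ E M - Complex.I * csqrt z * v E M)
    rw [norm_sub_rev D₀] at e3
    linarith
  have lJ : ∀ z : ℂ, ‖z - E‖ ≤ Λ * q ^ 2 → I₁ / 2 ≤ ‖∫ t in (0 : ℝ)..M, u z t * u E t‖ :=
    fun z hz => by
    have e1 := (hamp z hz).2
    rw [hIe] at e1
    have e2 : K₀ * M * ‖z - E‖ ≤ I₁ / 2 := by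
      refine (mul_le_mul_of_nonneg_left hz (by positivity)).trans (le_trans (le_of_eq ?_) h4)
      ring
    have e3 := norm_sub_norm_le (I : ℂ) (∫ t in (0 : ℝ)..M, u z t * u E t)
    rw [norm_sub_rev, Complex.norm_real, Real.norm_of_nonneg hIp.le] at e3
    linarith
  set F : ℂ → ℂ := fun z => u₁ z M - Complex.I * csqrt z * u z M with hF
  -- The variation formulas for `u z` and its derivative, combined with coefficients `-i√z` and `1`.
  have hFe : ∀ z : ℂ, F z = (u₁ E M - Complex.I * csqrt z * u E M)
      + (z - E) * (∫ t in (0 : ℝ)..M, u z t * v E t) * (u₁ E M - Complex.I * csqrt z * u E M)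
      - (z - E) * ((∫ t in (0 : ℝ)..M, u z t * u E t)
        * (v₁ E M - Complex.I * csqrt z * v E M)) := fun z => by
    linear_combination h.variation_deriv z E M - Complex.I * csqrt z * h.variation z E M
  have hFE : F E = N₀ := by
    simp only [hF, hN₀]
    rw [csqrt_ofReal hE.le]
  have lF : ∀ z : ℂ, ‖z - E‖ ≤ Λ * q ^ 2 → ‖z - E‖ * (κ * q⁻¹) ≤ ‖F z - F E‖ := fun z hz => by
    have a1 := (hamp z hz).1
    have e : F z - F E = (u₁ E M - Complex.I * csqrt z * u E M - N₀)
      + (z - E) * (∫ t in (0 : ℝ)..M, u z t * v E t) * (u₁ E M - Complex.I * csqrt z * u E M)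
      - (z - E) * ((∫ t in (0 : ℝ)..M, u z t * u E t)
        * (v₁ E M - Complex.I * csqrt z * v E M)) := by
      rw [hFE, hFe]
      ring
    have e1 : ‖z - E‖ * (2 * κ * q⁻¹) ≤ ‖(z - E) * ((∫ t in (0 : ℝ)..M, u z t * u E t)
        * (v₁ E M - Complex.I * csqrt z * v E M))‖ := by
      rw [norm_mul, norm_mul]
      refine mul_le_mul_of_nonneg_left ?_ (norm_nonneg _)
      refine le_trans (le_of_eq ?_) (mul_le_mul (lJ z hz) (lD z hz) (by positivity)
        (norm_nonneg _))
      rw [hκ]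
      ring
    have e2 : ‖(u₁ E M - Complex.I * csqrt z * u E M - N₀)
      + (z - E) * (∫ t in (0 : ℝ)..M, u z t * v E t) * (u₁ E M - Complex.I * csqrt z * u E M)‖
        ≤ ‖z - E‖ * (κ * q⁻¹) := by
      refine (norm_add_le _ _).trans ?_
      rw [norm_mul, norm_mul]
      calc _ ≤ ‖z - E‖ * (C / s₀ * q) + ‖z - E‖ * (K₀ * M) * (C₅ * q) :=
            add_le_add (dN z hz) (mul_le_mul (mul_le_mul_of_nonneg_left a1 (norm_nonneg _))
              (uN z hz) (norm_nonneg _) (by positivity))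
        _ = ‖z - E‖ * ((K₀ * C₅ * (M * q ^ 2) + C / s₀ * q ^ 2) * q⁻¹) := by field_simp; ring
        _ ≤ _ := by gcongr
    rw [e]
    refine le_trans ?_ (sub_le_norm_sub e2 e1)
    have : ‖z - E‖ * (2 * κ * q⁻¹) = ‖z - E‖ * (κ * q⁻¹) + ‖z - E‖ * (κ * q⁻¹) := by ring
    linarith
  have hr : 0 < Λ * q ^ 2 := by positivity
  have hzE : ‖(E : ℂ) - E‖ ≤ Λ * q ^ 2 := by
    rw [sub_self, norm_zero]
    exact hr.le
  have hFd : DiffContOnCl ℂ F (Metric.ball (E : ℂ) (Λ * q ^ 2)) := by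
    refine DifferentiableOn.diffContOnCl_ball (U := Metric.closedBall (E : ℂ) (Λ * q ^ 2))
      (fun z hz => ?_) subset_rfl
    rw [Metric.mem_closedBall, dist_eq_norm] at hz
    exact (((h.differentiable_deriv_apply hM0) z).sub
      (((differentiableAt_csqrt (hre z hz)).const_mul _).mul
        ((h.differentiable_apply hM0) z))).differentiableWithinAt
  -- Quantitative open mapping: the bound `lF` on the boundary circle, together with nonconstancy
  -- near `E` (also from `lF`), puts a ball about `F(E)` of half the boundary bound inside the
  -- image.
  have hball := hFd.ball_subset_image_closedBall (ε := Λ * q ^ 2 * (κ * q⁻¹)) hr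
    (fun z hz => by
      rw [mem_sphere_iff_norm] at hz
      have := lF z hz.le
      rwa [hz] at this) (by
      have : ∃ᶠ z : ℂ in 𝓝 (E : ℂ), z ≠ E := by
        have : ∃ᶠ z : ℂ in 𝓝[≠] (E : ℂ), z ≠ E :=
          (eventually_mem_nhdsWithin (a := (E : ℂ)) (s := {(E : ℂ)}ᶜ)).frequently
        exact this.filter_mono nhdsWithin_le_nhds
      refine (this.and_eventually (Metric.closedBall_mem_nhds (E : ℂ) hr)).mono ?_
      rintro z ⟨hz, hzb⟩ hcon
      rw [dist_eq_norm] at hzb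
      have := lF z hzb
      rw [hcon, sub_self, norm_zero] at this
      have hp : 0 < ‖z - E‖ := norm_pos_iff.2 (sub_ne_zero.2 hz)
      have : 0 < ‖z - E‖ * (κ * q⁻¹) := by positivity
      linarith)
  obtain ⟨z, hzb, hFz⟩ := hball (a := (0 : ℂ)) (by
    rw [Metric.mem_ball, dist_eq_norm, zero_sub, norm_neg, hFE]
    have e1 := uN E hzE
    rw [csqrt_ofReal hE.le] at e1
    refine e1.trans_lt ?_
    have e2 : Λ * κ = 2 * C₅ + 1 := div_mul_cancel₀ _ hκp.ne'
    have e3 : Λ * q ^ 2 * (κ * q⁻¹) / 2 = (Λ * κ) * q / 2 := by field_simp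
    rw [e3, e2]
    nlinarith)
  rw [Metric.mem_closedBall, dist_eq_norm] at hzb
  refine ⟨z, hzb.trans ?_, hre z hzb, hFz, ?_⟩
  · refine mul_le_mul_of_nonneg_right ?_ (by positivity)
    have : 0 < K₇ / (c₁ * I₁) := by positivity
    linarith
  rw [hIe]
  have hDI : c₁ * q⁻¹ * I₁ ≤ ‖D₀ * (I : ℂ)‖ := by
    rw [norm_mul, Complex.norm_real, Real.norm_of_nonneg hIp.le]
    exact mul_le_mul lD₀ hII hI₁.le (norm_nonneg _)
  have hDIp : 0 < ‖D₀ * (I : ℂ)‖ := lt_of_lt_of_le (by positivity) hDI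
  have hDI0 : D₀ * (I : ℂ) ≠ 0 := norm_pos_iff.1 hDIp
  have uI : ‖(I : ℂ)‖ ≤ C * C / k := by
    rw [← hIe]
    refine norm_integral_mul_le_of_decay hk hC hu hC.le (fun x hx _ => ?_) hM0 le_rfl
    exact (hu x hx).trans (mul_le_of_le_one_right hC.le
      (Real.exp_le_one_iff.2 (neg_nonpos.2 (mul_nonneg hk.le hx))))
  -- At the zero, the equation `F(z) = 0` is compared with its linearization `(z - E) D₀ I = N₀`.
  -- Each discrepancy is `O(M q³)`, and division by `|D₀ I|`, which is at least a constant times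
  -- `q⁻¹`, yields `O(M q⁴)`.
  have key : ‖(z - E) * (D₀ * I) - N₀‖ ≤ K₇ * (M * q ^ 3) := by
    have a1 := hamp z hzb
    rw [hIe] at a1
    have e0 := hFe z
    rw [hFz] at e0
    set N := u₁ E M - Complex.I * csqrt z * u E M with hN
    set D := v₁ E M - Complex.I * csqrt z * v E M with hD
    set J := ∫ t in (0 : ℝ)..M, u z t * u E t with hJ
    set a := ∫ t in (0 : ℝ)..M, u z t * v E t with ha
    have e : (z - E) * (D₀ * I) - N₀ = (z - E) * (-((D - D₀) * I) - D * (J - I))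
        + (z - E) * a * N + (N - N₀) := by linear_combination e0
    have b1 := dN z hzb
    have b2 := dD z hzb
    have b3 := uN z hzb
    have b4 := uD z hzb
    rw [e]
    calc _ ≤ ‖z - E‖ * (‖D - D₀‖ * ‖(I : ℂ)‖ + ‖D‖ * ‖J - I‖) + ‖z - E‖ * ‖a‖ * ‖N‖
          + ‖N - N₀‖ := by
            refine (norm_add_le _ _).trans (add_le_add_left ((norm_add_le _ _).trans ?_) _)
            rw [norm_mul, norm_mul, norm_mul]
            refine add_le_add_left (mul_le_mul_of_nonneg_left ?_ (norm_nonneg _)) _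
            refine (norm_sub_le _ _).trans ?_
            rw [norm_neg, norm_mul, norm_mul]
      _ ≤ Λ * q ^ 2 * (Λ * q ^ 2 * (C / s₀ * q⁻¹) * (C * C / k)
            + C₅ * q⁻¹ * (K₀ * M * (Λ * q ^ 2)))
          + Λ * q ^ 2 * (K₀ * M) * (C₅ * q) + Λ * q ^ 2 * (C / s₀ * q) := by
            have b5 := b2.trans (mul_le_mul_of_nonneg_right hzb (by positivity))
            have b6 := b1.trans (mul_le_mul_of_nonneg_right hzb (by positivity))
            have b7 := a1.2.trans (mul_le_mul_of_nonneg_left hzb (by positivity))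
            have b8 := a1.1
            gcongr
      _ = (Λ * (Λ * C * (C * C / k) / s₀) + Λ * C / s₀) * q ^ 3
          + (Λ * (C₅ * K₀ * Λ) + Λ * K₀ * C₅) * (M * q ^ 3) := by field_simp; ring
      _ ≤ (Λ * (Λ * C * (C * C / k) / s₀) + Λ * C / s₀) * (M * q ^ 3)
          + (Λ * (C₅ * K₀ * Λ) + Λ * K₀ * C₅) * (M * q ^ 3) := by
            refine add_le_add_left (mul_le_mul_of_nonneg_left ?_ (by positivity)) _
            exact le_mul_of_one_le_left (by positivity) hM
      _ = _ := by rw [hK₇]; ring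
  have e : (z - E) - N₀ / (D₀ * I) = ((z - E) * (D₀ * I) - N₀) / (D₀ * I) := by
    rw [sub_div _ N₀, mul_div_cancel_right₀ _ hDI0]
  rw [e, norm_div, div_le_iff₀ hDIp]
  refine key.trans ?_
  calc K₇ * (M * q ^ 3) = K₇ / (c₁ * I₁) * (M * q ^ 4) * (c₁ * q⁻¹ * I₁) := by field_simp
    _ ≤ (Λ + K₇ / (c₁ * I₁)) * (M * q ^ 4) * ‖D₀ * (I : ℂ)‖ := by
      gcongr
      linarith

end IsSolutionFamily

/-! ### Symmetry, reality, and the main result -/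

/-- The reflected solution and `ε` times the solution have the same data at `0`; differentiating the
resulting identity gives the parity of the derivative. -/
theorem IsClassicalSolution.parity {V : ℝ → ℝ} {z ε : ℂ} {w w₁ : ℝ → ℂ} {K : ℝ}
    (h : IsClassicalSolution V z w w₁) (hV : Continuous V) (hVe : Function.Even V)
    (hK : ∀ x, |V x| ≤ K) (h0 : w 0 = ε * w 0) (h0' : -w₁ 0 = ε * w₁ 0) :
    (∀ x, w (-x) = ε * w x) ∧ ∀ x, w₁ (-x) = -ε * w₁ x := by
  have h1 : ∀ x, w (-x) = ε * w x := fun x =>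
    sub_eq_zero.1 (((h.comp_neg hVe).sub (h.const_mul ε)).eq_zero hV hK (a := 0)
      (by rw [neg_zero, ← h0, sub_self]) (by rw [neg_zero, h0', sub_self]) x)
  refine ⟨h1, fun x => ?_⟩
  have e : (fun x => w (-x)) = fun x => ε * w x := funext h1
  have d := (h.comp_neg hVe x).1
  rw [e] at d
  have := d.unique (h.const_mul ε x).1
  linear_combination -this

theorem IsClassicalSolution.conj_eq {V : ℝ → ℝ} {E : ℝ} {w w₁ : ℝ → ℂ} {K : ℝ}
    (h : IsClassicalSolution V E w w₁) (hV : Continuous V) (hK : ∀ x, |V x| ≤ K)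
    (h0 : starRingEnd ℂ (w 0) = w 0) (h0' : starRingEnd ℂ (w₁ 0) = w₁ 0) :
    (∀ x, starRingEnd ℂ (w x) = w x) ∧ ∀ x, starRingEnd ℂ (w₁ x) = w₁ x := by
  have hs := h.star
  rw [Complex.conj_ofReal] at hs
  have h1 : ∀ x, starRingEnd ℂ (w x) = w x := fun x =>
    sub_eq_zero.1 ((hs.sub h).eq_zero hV hK (a := 0) (sub_eq_zero.2 h0) (sub_eq_zero.2 h0') x)
  refine ⟨h1, fun x => ?_⟩
  have e : (fun x => starRingEnd ℂ (w x)) = w := funext h1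
  have d := (hs x).1
  rw [e] at d
  exact d.unique (h x).1

/-- Real and imaginary parts of the first Newton step. -/
theorem newton_step_eq {a a₁ b b₁ s E I : ℝ} (hs : s ^ 2 = E) (hW : a * b₁ - a₁ * b = 1)
    (hden : (b₁ ^ 2 + E * b ^ 2) * I ≠ 0)
    (hD : ((b₁ : ℂ) - Complex.I * s * b) * I ≠ 0) :
    ((a₁ : ℂ) - Complex.I * s * a) / (((b₁ : ℂ) - Complex.I * s * b) * I)
      = (((a₁ * b₁ + E * a * b) / ((b₁ ^ 2 + E * b ^ 2) * I) : ℝ) : ℂ)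
        + ((-s / ((b₁ ^ 2 + E * b ^ 2) * I) : ℝ) : ℂ) * Complex.I := by
  have hden' : (((b₁ ^ 2 + E * b ^ 2) * I : ℝ) : ℂ) ≠ 0 := by exact_mod_cast hden
  have hWc : (a : ℂ) * b₁ - a₁ * b = 1 := by exact_mod_cast hW
  have hsc : (s : ℂ) ^ 2 = E := by exact_mod_cast hs
  rw [Complex.ofReal_div, Complex.ofReal_div, div_mul_eq_mul_div, ← add_div,
    div_eq_div_iff hD hden']
  push_cast
  -- Behind the coefficients is `(a₁ - i s a)(b₁ + i s b) = a₁ b₁ + E a b - i s (a b₁ - a₁ b)`,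
  -- where the last bracket is the Wronskian `1`.
  linear_combination (-(Complex.I * s * b₁ * I + E * b * I)) * hWc
    + ((-(b : ℂ) * I) * Complex.I ^ 2) * hsc - (E * b * I) * Complex.I_sq

section Resonance

variable {V : ℝ → ℝ} {u v : ℂ → ℝ → ℂ} {E K : ℝ} {ε : ℂ}

theorem IsSolutionFamily.exists_resonance
    (h : IsSolutionFamily V u (fun z => deriv (u z)) v (fun z => deriv (v z)))
    (hV : Continuous V) (hK : ∀ x, |V x| ≤ K) (hε : ε * ε = 1)
    (huε : ∀ z x, u z (-x) = ε * u z x) (hu₁ε : ∀ z x, deriv (u z) (-x) = -ε * deriv (u z) x)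
    (h0 : ∀ z, u z 0 * starRingEnd ℂ (deriv (u z) 0) - deriv (u z) 0 * starRingEnd ℂ (u z 0) = 0)
    {C k : ℝ} (hE : 0 < E) (hk : 0 < k) (hC : 0 < C)
    (hu : ∀ x, 0 ≤ x → ‖u E x‖ ≤ C * Real.exp (-(k * x)))
    (hu₁ : ∀ x, 0 ≤ x → ‖deriv (u E) x‖ ≤ C * Real.exp (-(k * x)))
    (hv : ∀ x, 0 ≤ x → ‖v E x‖ ≤ C * Real.exp (k * x))
    (hv₁ : ∀ x, 0 ≤ x → ‖deriv (v E) x‖ ≤ C * Real.exp (k * x))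
    (hur : ∀ x, ∃ r : ℝ, u E x = r) (hu₁r : ∀ x, ∃ r : ℝ, deriv (u E) x = r)
    (hvr : ∀ x, ∃ r : ℝ, v E x = r) (hv₁r : ∀ x, ∃ r : ℝ, deriv (v E) x = r) :
    ∃ C', ∀ᶠ M in atTop, ∃ zs : ℂ, IsResonance (truncate V M) zs ∧
      0 < zs.re ∧ zs.im < 0 ∧
      |zs.im| ≤ C' * Real.exp (-2 * k * M) ∧
      ‖(zs.re : ℂ) - ((E : ℂ) +
          (deriv (u E) M * deriv (v E) M + (E : ℂ) * u E M * v E M) /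
            correctionDenom E (u E) (v E) M)‖ ≤ C' * (M * Real.exp (-4 * k * M)) ∧
      ‖(zs.im : ℂ) - (-(Real.sqrt E : ℂ)) / correctionDenom E (u E) (v E) M‖
        ≤ C' * (M * Real.exp (-4 * k * M)) ∧
      ∃ Φs : ℝ → ℂ, IsResonantState (truncate V M) zs Φs ∧
        (∀ Ψ : ℝ → ℂ, IsResonantState (truncate V M) zs Ψ → ∃ c : ℂ, ∀ x, Ψ x = c * Φs x) ∧
        (∀ x, 0 ≤ x → x ≤ M → Φs x = u zs x) ∧
        (∀ x, M < x →
          Φs x = u zs M * Complex.exp (Complex.I * csqrt zs * ((x - M : ℝ) : ℂ))) ∧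
        ∀ x, Φs (-x) = ε * Φs x := by
  obtain ⟨K₁, hK₁, hev⟩ := h.exists_outgoing hE hk hC hu hu₁ hv hv₁ hur hu₁r hvr hv₁r
  obtain ⟨I₁, hI₁, hI⟩ := h.exists_integral_sq_lower_bound hur
  have tMq : Tendsto (fun M => K₁ * (C ^ 2 * (1 + E) * (C * C / k))
      * (M * Real.exp (-(k * M)) * Real.exp (-(k * M)))) atTop (𝓝 0) := by
    have := ((tendsto_mul_exp_neg_mul hk).mul (tendsto_exp_neg_mul hk)).const_mul
      (K₁ * (C ^ 2 * (1 + E) * (C * C / k)))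
    simpa using this
  have hs : 0 < Real.sqrt E := Real.sqrt_pos.2 hE
  have hs2 : Real.sqrt E ^ 2 = E := Real.sq_sqrt hE.le
  refine ⟨K₁, ?_⟩
  filter_upwards [hev, tMq.eventually_lt_const hs, eventually_ge_atTop 1] with M hz hsmall hM1
  obtain ⟨z, hzE, hzre, hz0, hzX⟩ := hz
  have hM : 0 < M := by linarith
  obtain ⟨I, hII, hIe⟩ := hI M hM1
  obtain ⟨a, ha⟩ := hur M
  obtain ⟨a₁, ha₁⟩ := hu₁r M
  obtain ⟨b, hb⟩ := hvr M
  obtain ⟨b₁, hb₁⟩ := hv₁r M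
  set q := Real.exp (-(k * M)) with hq
  have hq0 : 0 < q := Real.exp_pos _
  have hqinv : Real.exp (k * M) = q⁻¹ := by rw [hq, Real.exp_neg, inv_inv]
  have hq2 : Real.exp (-2 * k * M) = q ^ 2 := by
    rw [hq, ← Real.exp_nat_mul]
    push_cast
    ring_nf
  have hq4 : Real.exp (-4 * k * M) = q ^ 4 := by
    rw [hq, ← Real.exp_nat_mul]
    push_cast
    ring_nf
  have hW : a * b₁ - a₁ * b = 1 := by
    have := h.wronskian E M
    simp only [ha, ha₁, hb, hb₁] at this
    exact_mod_cast this
  have hIp : 0 < I := hI₁.trans_le hII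
  have hsum : 0 < b₁ ^ 2 + E * b ^ 2 := by
    by_contra hcon
    push Not at hcon
    have p1 : b₁ ^ 2 = 0 := by nlinarith [sq_nonneg b₁, sq_nonneg b]
    have p2 : E * b ^ 2 = 0 := by nlinarith [sq_nonneg b₁, sq_nonneg b]
    have p3 : b₁ = 0 := by simpa using p1
    have p4 : b = 0 := by simpa [hE.ne'] using p2
    rw [p3, p4] at hW
    simp at hW
  set den := (b₁ ^ 2 + E * b ^ 2) * I with hden
  have hdenp : 0 < den := mul_pos hsum hIp
  have hDne : ((b₁ : ℂ) - Complex.I * (Real.sqrt E : ℂ) * b) * I ≠ 0 := by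
    refine mul_ne_zero (fun hcon => ?_) (by exact_mod_cast hIp.ne')
    obtain ⟨p1, p2⟩ := norm_le_norm_ofReal_sub_I_mul b₁ b (Real.sqrt E)
    rw [hcon, norm_zero] at p1 p2
    have p3 : b₁ = 0 := abs_nonpos_iff.1 p1
    have p4 : b = 0 := by simpa [hs.ne'] using abs_nonpos_iff.1 p2
    rw [p3, p4] at hW
    simp at hW
  have hcd : correctionDenom E (u E) (v E) M = (den : ℂ) := by
    have : ∫ y in (0 : ℝ)..M, (u E y) ^ 2 = (I : ℂ) := by
      rw [← hIe]
      simp only [sq]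
    rw [correctionDenom, this, hb, hb₁, hden]
    push_cast
    ring
  rw [hIe] at hzX
  simp only [ha, ha₁, hb, hb₁] at hzX
  rw [newton_step_eq hs2 hW hdenp.ne' hDne] at hzX
  rw [hcd, ha, ha₁, hb, hb₁, hq2, hq4]
  have hre := (Complex.abs_re_le_norm _).trans hzX
  have him := (Complex.abs_im_le_norm _).trans hzX
  have er : (z - E - ((((a₁ * b₁ + E * a * b) / den : ℝ) : ℂ)
      + ((-Real.sqrt E / den : ℝ) : ℂ) * Complex.I)).re
      = z.re - (E + (a₁ * b₁ + E * a * b) / den) := by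
    simp only [Complex.sub_re, Complex.add_re, Complex.ofReal_re, Complex.re_ofReal_mul,
      Complex.I_re, mul_zero, add_zero]
    ring
  have ei : (z - E - ((((a₁ * b₁ + E * a * b) / den : ℝ) : ℂ)
      + ((-Real.sqrt E / den : ℝ) : ℂ) * Complex.I)).im = z.im - -Real.sqrt E / den := by
    simp only [Complex.sub_im, Complex.add_im, Complex.ofReal_im, Complex.im_ofReal_mul,
      Complex.I_im, mul_one, zero_add, sub_zero]
  rw [er] at hre
  rw [ei] at him
  -- The denominator is `O(q⁻²)`, so the leading term `-√E / den` of the imaginary part is at least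
  -- a constant times `q²` in modulus and outweighs the error `K₁ M q⁴` for large `M`.
  have hdenle : den ≤ C ^ 2 * (1 + E) * (C * C / k) * (q ^ 2)⁻¹ := by
    have e1 := hv M hM.le
    have e2 := hv₁ M hM.le
    rw [hb, Complex.norm_real, Real.norm_eq_abs, hqinv] at e1
    rw [hb₁, Complex.norm_real, Real.norm_eq_abs, hqinv] at e2
    have e3 : b ^ 2 ≤ (C * q⁻¹) ^ 2 := sq_le_sq' (abs_le.1 e1).1 (abs_le.1 e1).2
    have e4 : b₁ ^ 2 ≤ (C * q⁻¹) ^ 2 := sq_le_sq' (abs_le.1 e2).1 (abs_le.1 e2).2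
    have e5 : I ≤ C * C / k := by
      have := norm_integral_mul_le_of_decay (f := u E) hk hC hu hC.le (X := M)
        (fun x hx _ => (hu x hx).trans (mul_le_of_le_one_right hC.le
          (Real.exp_le_one_iff.2 (neg_nonpos.2 (mul_nonneg hk.le hx))))) hM.le le_rfl
      rwa [hIe, Complex.norm_real, Real.norm_of_nonneg hIp.le] at this
    calc den ≤ ((C * q⁻¹) ^ 2 + E * (C * q⁻¹) ^ 2) * (C * C / k) := by rw [hden]; gcongr
      _ = _ := by field_simp
  have himneg : z.im < 0 := by
    have e1 := (abs_le.1 him).2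
    have e2 : K₁ * (M * q ^ 4) * den < Real.sqrt E := by
      refine lt_of_le_of_lt ?_ hsmall
      calc K₁ * (M * q ^ 4) * den
          ≤ K₁ * (M * q ^ 4) * (C ^ 2 * (1 + E) * (C * C / k) * (q ^ 2)⁻¹) := by gcongr
        _ = _ := by field_simp
    rw [← lt_div_iff₀ hdenp] at e2
    rw [neg_div] at e1
    linarith
  have hzD : deriv (u z) M = Complex.I * csqrt z * u z M := sub_eq_zero.1 hz0
  have hne : u z M ≠ 0 := fun hcon => by
    have := h.wronskian z M
    simp only [hzD, hcon] at this
    simp at this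
  have hsols := solvesSchrodinger_outgoingState (ε := ε) (ζ := csqrt z) hV hM
    (by rw [csqrt_sq]; exact h.left z) (huε z) (hu₁ε z) hzD
  rw [csqrt_sq] at hsols
  refine ⟨z, ⟨csqrt_im_neg hzre himneg, h.isResolventPole hV hM huε hu₁ε h0
    (csqrt_im_neg hzre himneg) (by rw [csqrt_sq]; exact hz0)⟩, hzre, himneg, ?_, ?_, ?_,
    outgoingState ε (csqrt z) M (u z),
    isResonantState_outgoingState hV hM (h.left z) (csqrt_sq z) (huε z) (hu₁ε z) hzD hne,
    fun Ψ hΨ => hΨ.eq_const_mul_outgoingState hK hM hne hsols,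
    fun x hx0 hxM => outerExtend_of_mem (by linarith) hxM,
    fun x hx => outerExtend_of_gt hM hx, outerExtend_neg hM hε (huε z)⟩
  · have := Complex.abs_im_le_norm (z - E)
    rw [Complex.sub_im, Complex.ofReal_im, sub_zero] at this
    exact this.trans hzE
  · have e : (z.re : ℂ) - (E + ((a₁ : ℂ) * b₁ + E * a * b) / den)
        = ((z.re - (E + (a₁ * b₁ + E * a * b) / den) : ℝ) : ℂ) := by push_cast; ring
    rw [e, Complex.norm_real, Real.norm_eq_abs]
    exact hre
  · have e : (z.im : ℂ) - -(Real.sqrt E : ℂ) / den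
        = ((z.im - -Real.sqrt E / den : ℝ) : ℂ) := by push_cast; ring
    rw [e, Complex.norm_real, Real.norm_eq_abs]
    exact him

/-- Resonances for real initial data of definite parity. -/
theorem exists_resonance_of_memLp {Vper Vdef : ℝ → ℝ} {ρ a b c d : ℝ}
    (hV : Continuous V) (hVe : Function.Even V) (hVsum : ∀ x, V x = Vper x + Vdef x)
    (hVper : ∀ x, Vper (x + 1) = Vper x) (hVdef : ∀ x, ρ < |x| → Vdef x = 0)
    (hK : ∀ x, |V x| ≤ K) (hE : 0 < E)
    (huv : ∀ z, SolvesIVP V z a b (u z) ∧ SolvesIVP V z c d (v z)) (hW : a * d - b * c = 1)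
    (hε : ε * ε = 1) (ha : (a : ℂ) = ε * a) (hb : -(b : ℂ) = ε * b) (hL : MemLp (u E) 2 volume) :
    ∃ k : ℝ, 0 < k ∧
      (∃ μ : ℝ, IsCharacteristicMultiplier Vper E μ ∧ k = Real.log |μ|) ∧
      ∃ M₀ C : ℝ, ρ < M₀ ∧ ∀ M : ℝ, M₀ ≤ M →
        ∃ zs : ℂ, IsResonance (truncate V M) zs ∧
          0 < zs.re ∧ zs.im < 0 ∧
          |zs.im| ≤ C * Real.exp (-2 * k * M) ∧
          ‖(zs.re : ℂ) - ((E : ℂ) +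
              (deriv (u E) M * deriv (v E) M + (E : ℂ) * u E M * v E M) /
                correctionDenom E (u E) (v E) M)‖ ≤ C * (M * Real.exp (-4 * k * M)) ∧
          ‖(zs.im : ℂ) - (-(Real.sqrt E : ℂ)) / correctionDenom E (u E) (v E) M‖
            ≤ C * (M * Real.exp (-4 * k * M)) ∧
          ∃ Φs : ℝ → ℂ, IsResonantState (truncate V M) zs Φs ∧
            (∀ Ψ : ℝ → ℂ, IsResonantState (truncate V M) zs Ψ → ∃ c : ℂ, ∀ x, Ψ x = c * Φs x) ∧
            (∀ x, 0 ≤ x → x ≤ M → Φs x = u zs x) ∧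
            (∀ x, M < x →
              Φs x = u zs M * Complex.exp (Complex.I * csqrt zs * ((x - M : ℝ) : ℂ))) ∧
            ∀ x, Φs (-x) = ε * Φs x := by
  have hus := fun z => (huv z).1.1.isClassicalSolution hV
  have hvs := fun z => (huv z).2.1.isClassicalSolution hV
  have h : IsSolutionFamily V u (fun z => deriv (u z)) v (fun z => deriv (v z)) := by
    refine ⟨hus, hvs, fun z z' => ?_, fun z z' => ?_, fun z => ?_⟩
    · rw [(huv z).1.2.1, (huv z').1.2.1]
    · rw [(huv z).1.2.2, (huv z').1.2.2]
    · rw [(huv z).1.2.1, (huv z).1.2.2, (huv z).2.2.1, (huv z).2.2.2]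
      exact_mod_cast hW
  have hVW : ∀ x, ρ < x → V x = Vper x := fun x hx => by
    rw [hVsum, hVdef x (hx.trans_le (le_abs_self x)), add_zero]
  -- The defect is only known to vanish for `|x| > ρ`, strictly, whereas the Floquet argument needs
  -- a closed half-line; `ρ + 1` gives the margin.
  have hp : ∀ x, ρ + 1 ≤ x → V (x + 1) = V x := fun x hx => by
    rw [hVW x (by linarith), hVW (x + 1) (by linarith), hVper]
  obtain ⟨hur, hu₁r⟩ := (hus E).conj_eq hV hK (by rw [(huv E).1.2.1, Complex.conj_ofReal])
    (by rw [(huv E).1.2.2, Complex.conj_ofReal])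
  obtain ⟨hvr, hv₁r⟩ := (hvs E).conj_eq hV hK (by rw [(huv E).2.2.1, Complex.conj_ofReal])
    (by rw [(huv E).2.2.2, Complex.conj_ofReal])
  have hpar := fun z => (hus z).parity (ε := ε) hV hVe hK (by rw [(huv z).1.2.1, ← ha])
    (by rw [(huv z).1.2.2, hb])
  obtain ⟨m, hm0, hm1, hshift, γ, hγ⟩ :=
    (hus E).exists_floquet hV hK hp (hvs E) (h.wronskian E) hur hu₁r hL
  obtain ⟨C₀, hC₀⟩ := (hus E).exists_exp_bounds (hvs E) hm0 hm1 hshift hγ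
  set k := Real.log |m⁻¹| with hk
  have hk0 : 0 < k := by
    rw [hk, abs_inv]
    exact Real.log_pos ((one_lt_inv₀ (abs_pos.2 hm0)).2 hm1)
  have up : ∀ {x t : ℝ}, 0 < t → x ≤ C₀ * t → x ≤ (|C₀| + 1) * t := fun ht hx =>
    hx.trans (mul_le_mul_of_nonneg_right (by linarith [le_abs_self C₀]) ht.le)
  have real : ∀ {w : ℝ → ℂ}, (∀ x, starRingEnd ℂ (w x) = w x) → ∀ x, ∃ r : ℝ, w x = r :=
    fun hw x => Complex.conj_eq_iff_real.1 (hw x)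
  obtain ⟨C', hC'⟩ := h.exists_resonance hV hK hε (fun z => (hpar z).1) (fun z => (hpar z).2)
    (fun z => by
      rw [(huv z).1.2.1, (huv z).1.2.2, Complex.conj_ofReal, Complex.conj_ofReal]
      ring)
    hE hk0 (C := |C₀| + 1) (by positivity)
    (fun x hx => up (Real.exp_pos _) (hC₀ x hx).1)
    (fun x hx => up (Real.exp_pos _) (hC₀ x hx).2.1)
    (fun x hx => up (Real.exp_pos _) (hC₀ x hx).2.2.1)
    (fun x hx => up (Real.exp_pos _) (hC₀ x hx).2.2.2)
    (real hur) (real hu₁r) (real hvr) (real hv₁r)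
  obtain ⟨M₁, hM₁⟩ := eventually_atTop.1 hC'
  refine ⟨k, hk0, ⟨m⁻¹, ?_, rfl⟩, max M₁ (ρ + 1), C',
    lt_of_lt_of_le (lt_add_one ρ) (le_max_right _ _),
    fun M hM => hM₁ M ((le_max_left _ _).trans hM)⟩
  -- The growing combination `v + γ u` carries the larger multiplier `m⁻¹`. It cannot vanish
  -- identically beyond `ρ + 1`, since `u` and `v` would then be proportional there, against
  -- Wronskian `1`.
  have hψ := (hvs E).add ((hus E).const_mul γ)
  refine isCharacteristicMultiplier_of_shift (R := ρ + 1) hV hVper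
    (fun x hx => hVW x (by linarith)) (inv_ne_zero hm0) hψ ?_ fun x hx => ?_
  · by_contra hcon
    push Not at hcon
    have hx : ρ + 1 < ρ + 2 := by linarith
    have h1 := hcon (ρ + 2) hx.le
    have hev : (fun x => v E x + γ * u E x) =ᶠ[𝓝 (ρ + 2)] fun _ => 0 := by
      filter_upwards [Ioi_mem_nhds hx] with t ht
      exact hcon t (le_of_lt ht)
    have h2 : deriv (v E) (ρ + 2) + γ * deriv (u E) (ρ + 2) = 0 := by
      have := (hψ (ρ + 2)).1.deriv
      rw [hev.deriv_eq, deriv_const] at this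
      exact this.symm
    have h3 := h.wronskian E (ρ + 2)
    have : (0 : ℂ) = 1 := by
      linear_combination h3 - u E (ρ + 2) * h2 + deriv (u E) (ρ + 2) * h1
    exact zero_ne_one this
  · have := hγ x hx
    push_cast
    exact this

end Resonance

/-- `V` is continuous and periodic far to the right, hence bounded on `[0, ∞)`; evenness covers the
other side. -/
theorem exists_abs_le_of_even {V Vper Vdef : ℝ → ℝ} {ρ : ℝ} (hV : Continuous V)
    (hVe : Function.Even V) (hVsum : ∀ x, V x = Vper x + Vdef x)
    (hVper : ∀ x, Vper (x + 1) = Vper x) (hVdef : ∀ x, ρ < |x| → Vdef x = 0) :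
    ∃ K, ∀ x, |V x| ≤ K := by
  obtain ⟨K, hK⟩ := exists_bound_of_periodic_right (R := ρ + 1) hV fun x hx => by
    rw [hVsum, hVsum, hVdef x ((lt_add_one ρ).trans_le (hx.trans (le_abs_self x))),
      hVdef (x + 1) (lt_of_lt_of_le (by linarith) (le_abs_self _)), hVper]
  refine ⟨K, fun x => ?_⟩
  rcases le_total 0 x with hx | hx
  · exact hK x hx
  · rw [← hVe x]
    exact hK (-x) (neg_nonneg.2 hx)

theorem mainTheorem3
    (V Vper Vdef : ℝ → ℝ) (ρ E : ℝ) (Φ : ℝ → ℂ) (u v : ℂ → ℝ → ℂ)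
    (hVsmooth : ContDiff ℝ ∞ V)
    (hVsum : ∀ x, V x = Vper x + Vdef x)
    (hVper : ∀ x, Vper (x + 1) = Vper x)
    (hρ : 0 ≤ ρ)
    (hVdef : ∀ x, ρ < |x| → Vdef x = 0)
    (hVeven : Function.Even V)
    (hE : 0 < E)
    (hΦ : IsBoundState V E Φ)
    (huv_even : Function.Even Φ → ∀ z, SolvesIVP V z 1 0 (u z) ∧ SolvesIVP V z 0 1 (v z))
    (huv_odd : Function.Odd Φ → ∀ z, SolvesIVP V z 0 1 (u z) ∧ SolvesIVP V z (-1) 0 (v z)) :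
    (Function.Even Φ ∨ Function.Odd Φ) ∧
    ∃ k : ℝ, 0 < k ∧
      (∃ μ : ℝ, IsCharacteristicMultiplier Vper E μ ∧ k = Real.log |μ|) ∧
      ∃ M₀ C : ℝ, ρ < M₀ ∧ ∀ M : ℝ, M₀ ≤ M →
        ∃ zs : ℂ, IsResonance (truncate V M) zs ∧
          0 < zs.re ∧ zs.im < 0 ∧
          |zs.im| ≤ C * Real.exp (-2 * k * M) ∧
          ‖(zs.re : ℂ) - ((E : ℂ) +
              (deriv (u E) M * deriv (v E) M + (E : ℂ) * u E M * v E M) /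
                correctionDenom E (u E) (v E) M)‖
            ≤ C * (M * Real.exp (-4 * k * M)) ∧
          ‖(zs.im : ℂ) - (-(Real.sqrt E : ℂ)) / correctionDenom E (u E) (v E) M‖
            ≤ C * (M * Real.exp (-4 * k * M)) ∧
          ∃ Φs : ℝ → ℂ, IsResonantState (truncate V M) zs Φs ∧
            (∀ Ψ : ℝ → ℂ, IsResonantState (truncate V M) zs Ψ →
              ∃ c : ℂ, ∀ x, Ψ x = c * Φs x) ∧
            (∀ x, 0 ≤ x → x ≤ M → Φs x = u zs x) ∧
            (∀ x, M < x →
              Φs x = u zs M * Complex.exp (Complex.I * csqrt zs * ((x - M : ℝ) : ℂ))) ∧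
            (Function.Even Φ → Function.Even Φs) ∧
            (Function.Odd Φ → Function.Odd Φs) := by
  have hV : Continuous V := hVsmooth.continuous
  obtain ⟨K, hK⟩ := exists_abs_le_of_even hV hVeven hVsum hVper hVdef
  have hs : IsClassicalSolution V E Φ (deriv Φ) := hΦ.2.2.isClassicalSolution hV
  have hne : ¬(Φ 0 = 0 ∧ deriv Φ 0 = 0) := fun hcon =>
    hΦ.1 (funext fun x => hs.eq_zero hV hK hcon.1 hcon.2 x)
  -- Only the actual parity of `Φ` has to be treated: the implication for the other parity holds
  -- vacuously.
  have hnot : ¬(Function.Even Φ ∧ Function.Odd Φ) := fun ⟨he, ho⟩ => hΦ.1 (funext fun x => by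
    have e : Φ x = -Φ x := (he x).symm.trans (ho x)
    simpa using self_eq_neg.1 e)
  rcases hs.even_or_odd hV hVeven hK (hs.mul_eq_zero_of_memLp hV hVeven hK hΦ.2.1) with
    ⟨h0, hev⟩ | ⟨h0, hodd⟩
  · refine ⟨Or.inl hev, ?_⟩
    have huv := huv_even hev
    have hΦ0 : Φ 0 ≠ 0 := fun h => hne ⟨h, h0⟩
    -- `Φ` and `u E` satisfy the same boundary condition at `0`, so `u E` is a scalar multiple of
    -- the bound state and inherits square-integrability.
    have hL : MemLp (u E) 2 volume := by
      have e : u E = fun x => (Φ 0)⁻¹ * Φ x := funext fun x => sub_eq_zero.1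
        ((((huv E).1.1.isClassicalSolution hV).sub (hs.const_mul (Φ 0)⁻¹)).eq_zero hV hK (a := 0)
          (by rw [(huv E).1.2.1, inv_mul_cancel₀ hΦ0, sub_self])
          (by rw [(huv E).1.2.2, h0, mul_zero, sub_self]) x)
      rw [e]
      exact hΦ.2.1.const_mul _
    obtain ⟨k, hk, hμ, M₀, C, hM₀, H⟩ := exists_resonance_of_memLp (a := 1) (b := 0) (c := 0)
      (d := 1) (ε := 1) hV hVeven hVsum hVper hVdef hK hE
      (by simpa only [Complex.ofReal_zero, Complex.ofReal_one] using huv) (by norm_num)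
      (by norm_num) (by simp) (by simp) hL
    refine ⟨k, hk, hμ, M₀, C, hM₀, fun M hM => ?_⟩
    obtain ⟨zs, r1, r2, r3, r4, r5, r6, Φs, s1, s2, s3, s4, s5⟩ := H M hM
    exact ⟨zs, r1, r2, r3, r4, r5, r6, Φs, s1, s2, s3, s4,
      fun _ x => by rw [s5, one_mul], fun ho => absurd ⟨hev, ho⟩ hnot⟩
  · refine ⟨Or.inr hodd, ?_⟩
    have huv := huv_odd hodd
    have hΦ0 : deriv Φ 0 ≠ 0 := fun h => hne ⟨h0, h⟩
    have hL : MemLp (u E) 2 volume := by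
      have e : u E = fun x => (deriv Φ 0)⁻¹ * Φ x := funext fun x => sub_eq_zero.1
        ((((huv E).1.1.isClassicalSolution hV).sub
          (hs.const_mul (deriv Φ 0)⁻¹)).eq_zero hV hK (a := 0)
          (by rw [(huv E).1.2.1, h0, mul_zero, sub_self])
          (by rw [(huv E).1.2.2, inv_mul_cancel₀ hΦ0, sub_self]) x)
      rw [e]
      exact hΦ.2.1.const_mul _
    obtain ⟨k, hk, hμ, M₀, C, hM₀, H⟩ := exists_resonance_of_memLp (a := 0) (b := 1) (c := -1)
      (d := 0) (ε := -1) hV hVeven hVsum hVper hVdef hK hE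
      (by simpa only [Complex.ofReal_zero, Complex.ofReal_one, Complex.ofReal_neg] using huv)
      (by norm_num) (by norm_num) (by simp) (by simp) hL
    refine ⟨k, hk, hμ, M₀, C, hM₀, fun M hM => ?_⟩
    obtain ⟨zs, r1, r2, r3, r4, r5, r6, Φs, s1, s2, s3, s4, s5⟩ := H M hM
    exact ⟨zs, r1, r2, r3, r4, r5, r6, Φs, s1, s2, s3, s4,
      fun he => absurd ⟨he, hodd⟩ hnot, fun _ x => by rw [s5, neg_one_mul]⟩
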